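/- Let $(P,\Pi)$ be a (finite-dimensional, Hausdorff, second countable, smooth) Poisson manifold, let $\sharp\colon T^*P\to TP$ be contraction with $\Pi$, $\langle\beta,\sharp\alpha\rangle=\Pi(\alpha,\beta)$, and let $C\subset P$ be an embedded submanifold with conormal bundle $N^*C=(TC)^\circ\subset T^*P|_C$. Regard $T^*P$ as a Lie algebroid with anchor $\sharp$ and bracket $[\alpha,\beta]=\mathcal L_{\sharp\alpha}\beta-\mathcal L_{\sharp\beta}\alpha-d(\Pi(\alpha,\beta))$. Call $C$ *pre-Poisson* if the rank of $TC+\sharp N^*C$ is constant along $C$. A *Lie subalgebroid* of $T^*P$ over $C$ is a smooth vector subbundle $B\subset T^*P|_C$ (of constant rank) with a Lie algebroid structure over $C$ whose anchor is the restriction of $\sharp$ and whose bracket of two sections is the restriction to $C$ of the bracket of any (local) one-forms on $P$ that extend them. 1. $N^*C\cap\sharp^{-1}TC$ is a Lie subalgebroid of $T^*P$ if and only if $C$ is pre-Poisson. 2. Suppose that $C$ is pre-Poisson. Let $\tilde P\subset P$ be an embedded submanifold containing $C$ that is cosymplectic, i.e. $T\tilde P\oplus\sharp N^*\tilde P=TP|_{\tilde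 P}$, with the induced Poisson structure, whose contraction map is $\tilde\sharp\,\eta=\sharp\xi$, where $\xi\in T^*P|_{\tilde P}$ is the extension of $\eta\in T^*\tilde P$ that annihilates $\sharp N^*\tilde P$. Suppose that $C$ is coisotropic in $\tilde P$, i.e. $\tilde\sharp\,N^*_{\tilde P}C\subset TC$, where $N^*_{\tilde P}C\subset T^*\tilde P|_C$ is the annihilator of $TC$. Then $N^*C\cap\sharp^{-1}TC$, with the Lie algebroid structure induced from $T^*P$, is isomorphic as a Lie algebroid over $C$ (over the identity of $C$) to $N^*_{\tilde P}C$, with the Lie algebroid structure induced from $T^*\tilde P$. -/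

import Mathlib

open Manifold
open scoped Manifold ContDiff Topology Bundle

noncomputable section

/-- The tangent space of a manifold `M` modelled on the vector space `E`. -/
abbrev Tan (E : Type*) [NormedAddCommGroup E] [NormedSpace ℝ E] {M : Type*}
    [TopologicalSpace M] [ChartedSpace E M] (x : M) : Type _ :=
  TangentSpace 𝓘(ℝ, E) x

/-- The cotangent space of a manifold `M` modelled on the vector space `E`. -/
abbrev Cot (E : Type*) [NormedAddCommGroup E] [NormedSpace ℝ E] {M : Type*}
    [TopologicalSpace M] [ChartedSpace E M] (x : M) : Type _ :=
  TangentSpace 𝓘(ℝ, E) x →L[ℝ] Bundle.Trivial M ℝ x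

section Calculus

variable {E : Type*} [NormedAddCommGroup E] [NormedSpace ℝ E]
  {M : Type*} [TopologicalSpace M] [ChartedSpace E M] [IsManifold 𝓘(ℝ, E) ∞ M]

/-- The differential `dh` of a real function. -/
def dfun (h : M → ℝ) (x : M) : Cot E x := mfderiv 𝓘(ℝ, E) 𝓘(ℝ, ℝ) h x

/-- Smoothness on `U` of a real function. -/
def SmoothFunOn (E : Type*) [NormedAddCommGroup E] [NormedSpace ℝ E] {M : Type*}
    [TopologicalSpace M] [ChartedSpace E M] (h : M → ℝ) (U : Set M) : Prop :=
  ContMDiffOn 𝓘(ℝ, E) 𝓘(ℝ, ℝ) ∞ h U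

/-- Smoothness on `U` of a vector field. -/
def SmoothFieldOn (X : ∀ x : M, Tan E x) (U : Set M) : Prop :=
  ContMDiffOn 𝓘(ℝ, E) (𝓘(ℝ, E).prod 𝓘(ℝ, E)) ∞
    (fun x => (⟨x, X x⟩ : TangentBundle 𝓘(ℝ, E) M)) U

/-- Smoothness on `U` of a differential one-form. -/
def SmoothFormOn (α : ∀ x : M, Cot E x) (U : Set M) : Prop :=
  ContMDiffOn 𝓘(ℝ, E) (𝓘(ℝ, E).prod 𝓘(ℝ, E →L[ℝ] ℝ)) ∞
    (fun x => Bundle.TotalSpace.mk' (E →L[ℝ] ℝ) (E := fun x : M => Cot E x) x (α x)) U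

/-- `(L_X β)(Z) = X (β Z) - β [X, Z]`: the Lie derivative of the one-form `β` along `X`, evaluated
on the vector field `Z`. -/
def lieDerivForm (X : ∀ x : M, Tan E x) (β : ∀ x : M, Cot E x) (Z : ∀ x : M, Tan E x)
    (x : M) : ℝ :=
  dfun (E := E) (fun y => β y (Z y)) x (X x) - β x (VectorField.mlieBracket 𝓘(ℝ, E) X Z x)

end Calculus

section Poisson

variable {E : Type*} [NormedAddCommGroup E] [NormedSpace ℝ E]
  {M : Type*} [TopologicalSpace M] [ChartedSpace E M] [IsManifold 𝓘(ℝ, E) ∞ M]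

/-- The bracket `{g, h} = Π(dg, dh)` of functions, for the bivector field `Π` with contraction map
`sharp : T*M → TM`, that is `Π(α, β) = β (sharp α)`. -/
def poissonBracket (sharp : ∀ x : M, Cot E x →L[ℝ] Tan E x) (g h : M → ℝ) (x : M) : ℝ :=
  dfun (E := E) h x (sharp x (dfun (E := E) g x))

/-- `sharp` is the contraction map of a Poisson bivector field `Π(α, β) = β (sharp α)`. The
condition `[Π, Π] = 0` is the Jacobi identity for the bracket of (locally defined) functions. -/
structure IsPoisson (sharp : ∀ x : M, Cot E x →L[ℝ] Tan E x) : Prop where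
  skew : ∀ (x : M) (α β : Cot E x), β (sharp x α) = -α (sharp x β)
  smooth : ContMDiff 𝓘(ℝ, E) (𝓘(ℝ, E).prod 𝓘(ℝ, (E →L[ℝ] ℝ) →L[ℝ] E)) ∞
    (fun x => Bundle.TotalSpace.mk' ((E →L[ℝ] ℝ) →L[ℝ] E)
      (E := fun x : M => Cot E x →L[ℝ] Tan E x) x (sharp x))
  jacobi : ∀ (U : Set M) (g₁ g₂ g₃ : M → ℝ), IsOpen U →
    SmoothFunOn E g₁ U → SmoothFunOn E g₂ U → SmoothFunOn E g₃ U → ∀ x ∈ U,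
    poissonBracket sharp g₁ (poissonBracket sharp g₂ g₃) x
      + poissonBracket sharp g₂ (poissonBracket sharp g₃ g₁) x
      + poissonBracket sharp g₃ (poissonBracket sharp g₁ g₂) x = 0

/-- The Lie bracket of the cotangent Lie algebroid of a Poisson manifold,
`[α, β] = L_{♯α} β - L_{♯β} α - d(Π(α, β))`, evaluated on the vector field `Z` at `x`. The anchor
of this Lie algebroid is `♯`. -/
def koszul (sharp : ∀ x : M, Cot E x →L[ℝ] Tan E x) (α β : ∀ x : M, Cot E x)
    (Z : ∀ x : M, Tan E x) (x : M) : ℝ :=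
  lieDerivForm (fun y => sharp y (α y)) β Z x - lieDerivForm (fun y => sharp y (β y)) α Z x
    - dfun (E := E) (fun y => β y (sharp y (α y))) x (Z x)

end Poisson

section Submanifold

variable {E : Type*} [NormedAddCommGroup E] [NormedSpace ℝ E]
  {P : Type*} [TopologicalSpace P] [ChartedSpace E P]
  {F : Type*} [NormedAddCommGroup F] [NormedSpace ℝ F]
  {C : Type*} [TopologicalSpace C] [ChartedSpace F C]

variable (F) in
/-- The tangent space `T_cC`, as a subspace of `T_{f c}P`, for a submanifold `f : C → P`. -/
abbrev tangentAlong (f : C → P) (c : C) : Submodule ℝ (Tan E (f c)) :=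
  LinearMap.range (mfderiv 𝓘(ℝ, F) 𝓘(ℝ, E) f c).toLinearMap

/-- The annihilator `W° ⊆ T*_xP` of a subspace `W ⊆ T_xP`. -/
def ann {x : P} (W : Submodule ℝ (Tan E x)) : Submodule ℝ (Cot E x) where
  carrier := {ξ | ∀ v ∈ W, ξ v = 0}
  add_mem' := fun ha hb v hv => by simp [ha v hv, hb v hv]
  zero_mem' := fun v _ => by simp
  smul_mem' := fun r a ha v hv => by simp [ha v hv]

variable (F) in
/-- The conormal bundle `N*C` of a submanifold `f : C → P`. -/
def conormal (f : C → P) (c : C) : Submodule ℝ (Cot E (f c)) := ann (tangentAlong F f c)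

variable (F) in
/-- The subspace `♯N*C` of `T_{f c}P`. -/
def sharpConormal (sharp : ∀ x : P, Cot E x →L[ℝ] Tan E x) (f : C → P) (c : C) :
    Submodule ℝ (Tan E (f c)) :=
  (conormal F f c).map (sharp (f c)).toLinearMap

variable (F) in
/-- The family of subspaces `N*C ∩ ♯⁻¹TC` of `T*P|_C`. -/
def charConormal (sharp : ∀ x : P, Cot E x →L[ℝ] Tan E x) (f : C → P) (c : C) :
    Submodule ℝ (Cot E (f c)) :=
  conormal F f c ⊓ (tangentAlong F f c).comap (sharp (f c)).toLinearMap

variable (F) in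
/-- `C` is pre-Poisson: the rank of `TC + ♯N*C` is constant along `C`. -/
def IsPrePoisson (sharp : ∀ x : P, Cot E x →L[ℝ] Tan E x) (f : C → P) : Prop :=
  ∃ k : ℕ, ∀ c, Module.finrank ℝ ↥(tangentAlong F f c ⊔ sharpConormal F sharp f c) = k

variable (F) in
/-- `C` is coisotropic: `♯N*C ⊆ TC`. -/
def IsCoisotropic (sharp : ∀ x : P, Cot E x →L[ℝ] Tan E x) (f : C → P) : Prop :=
  ∀ c, sharpConormal F sharp f c ≤ tangentAlong F f c

variable (F) in
/-- `C` is cosymplectic: `TC ⊕ ♯N*C = TP|_C`. -/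
def IsCosymplectic (sharp : ∀ x : P, Cot E x →L[ℝ] Tan E x) (f : C → P) : Prop :=
  ∀ c, IsCompl (tangentAlong F f c) (sharpConormal F sharp f c)

open scoped Classical in
/-- For a submanifold `f : C → P`, the linear map `T_{f c}P → T_cC` which is the identity on `T_cC`
and vanishes on `♯N*C`. (Junk value `0` where `f` is not immersive or `C` not cosymplectic.) -/
def cosymplecticProj [FiniteDimensional ℝ E] (sharp : ∀ x : P, Cot E x →L[ℝ] Tan E x)
    (f : C → P) (c : C) : Tan E (f c) →L[ℝ] Tan F c :=
  if h : Function.Injective (mfderiv 𝓘(ℝ, F) 𝓘(ℝ, E) f c).toLinearMap ∧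
      IsCompl (tangentAlong F f c) (sharpConormal F sharp f c) then
    haveI : FiniteDimensional ℝ (Tan E (f c)) := inferInstanceAs (FiniteDimensional ℝ E)
    haveI : T2Space (Tan E (f c)) := inferInstanceAs (T2Space E)
    LinearMap.toContinuousLinearMap
      ((LinearEquiv.ofInjective _ h.1).symm.toLinearMap ∘ₗ
        (tangentAlong F f c).projectionOnto (sharpConormal F sharp f c) h.2)
  else 0

/-- The contraction map `T*C → TC` of the bivector field induced on a cosymplectic submanifold `C`:
extend `η ∈ T*_cC` to the covector on `T_{f c}P` that annihilates `♯N*C`, and apply `♯`. The result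
is tangent to `C`, hence unchanged by the projection. -/
def inducedSharp [FiniteDimensional ℝ E] (sharp : ∀ x : P, Cot E x →L[ℝ] Tan E x)
    (f : C → P) (c : C) : Cot F c →L[ℝ] Tan F c :=
  cosymplecticProj sharp f c ∘L sharp (f c) ∘L
    ContinuousLinearMap.precomp ℝ (cosymplecticProj sharp f c)

end Submanifold

section Algebroid

variable {E : Type*} [NormedAddCommGroup E] [NormedSpace ℝ E]
  {P : Type*} [TopologicalSpace P] [ChartedSpace E P] [IsManifold 𝓘(ℝ, E) ∞ P]
  {F : Type*} [NormedAddCommGroup F] [NormedSpace ℝ F]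
  {C : Type*} [TopologicalSpace C] [ChartedSpace F C] [IsManifold 𝓘(ℝ, F) ∞ C]

variable (F) in
/-- Smoothness on `U` of a section of `T*P|_C`, for `f : C → P`. -/
def SmoothAlongOn (f : C → P) (σ : ∀ c, Cot E (f c)) (U : Set C) : Prop :=
  ContMDiffOn 𝓘(ℝ, F) (𝓘(ℝ, E).prod 𝓘(ℝ, E →L[ℝ] ℝ)) ∞
    (fun c => Bundle.TotalSpace.mk' (E →L[ℝ] ℝ) (E := fun x : P => Cot E x) (f c) (σ c)) U

variable (F) in
/-- The family `B` of subspaces is a smooth vector subbundle of `T*P|_C`: it has constant rank `k`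
and, around every point, a smooth frame. -/
def IsSmoothSubbundle (f : C → P) (B : ∀ c, Submodule ℝ (Cot E (f c))) : Prop :=
  ∃ k : ℕ, ∀ c₀ : C, ∃ U : Set C, IsOpen U ∧ c₀ ∈ U ∧ ∃ s : Fin k → ∀ c, Cot E (f c),
    (∀ i, SmoothAlongOn F f (s i) U) ∧
    ∀ c ∈ U, LinearIndependent ℝ (fun i => s i c) ∧ Submodule.span ℝ (Set.range fun i => s i c) = B c

variable (F) in
/-- `σ` is a smooth section of the subbundle `B` of `T*P|_C`. -/
structure IsSection (f : C → P) (B : ∀ c, Submodule ℝ (Cot E (f c)))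
    (σ : ∀ c, Cot E (f c)) : Prop where
  mem : ∀ c, σ c ∈ B c
  smooth : SmoothAlongOn F f σ Set.univ

variable (F) in
/-- A Lie algebroid structure over `C` on a subbundle `B` of `T*P|_C`: a bundle map (the anchor)
`B → TC` and a Lie bracket on the smooth sections of `B` satisfying the Leibniz rule. Only values
of `bracket` on smooth sections matter. Bilinearity over `ℝ` follows from `add`, `leibniz` (with
constant `h`) and `skew`. -/
structure LieAlgebroid (f : C → P) (B : ∀ c, Submodule ℝ (Cot E (f c))) where
  anchor : ∀ c, B c →ₗ[ℝ] Tan F c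
  bracket : (∀ c, Cot E (f c)) → (∀ c, Cot E (f c)) → ∀ c, Cot E (f c)
  anchor_smooth : ∀ σ (hσ : IsSection F f B σ),
    SmoothFieldOn (fun c => anchor c ⟨σ c, hσ.mem c⟩) Set.univ
  bracket_isSection : ∀ σ τ, IsSection F f B σ → IsSection F f B τ →
    IsSection F f B (bracket σ τ)
  add : ∀ σ τ₁ τ₂, IsSection F f B σ → IsSection F f B τ₁ → IsSection F f B τ₂ →
    bracket σ (τ₁ + τ₂) = bracket σ τ₁ + bracket σ τ₂
  skew : ∀ σ τ, IsSection F f B σ → IsSection F f B τ → bracket σ τ = -bracket τ σ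
  jacobi : ∀ σ τ υ, IsSection F f B σ → IsSection F f B τ → IsSection F f B υ →
    bracket σ (bracket τ υ) + bracket τ (bracket υ σ) + bracket υ (bracket σ τ) = 0
  leibniz : ∀ σ τ (hσ : IsSection F f B σ), IsSection F f B τ →
    ∀ h : C → ℝ, SmoothFunOn F h Set.univ → ∀ c,
    bracket σ (fun c => h c • τ c) c =
      h c • bracket σ τ c + (dfun (E := F) h c (anchor c ⟨σ c, hσ.mem c⟩) : ℝ) • τ c

/-- The Lie algebroid structure `L` on `B` is the one induced by the cotangent Lie algebroid of
`(P, ♯)`: its anchor is the restriction of `♯`, and the bracket of two sections of `B` is the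
restriction to `C` of the bracket of any one-forms (on open sets of `P`) extending them. -/
structure LieAlgebroid.IsInduced (sharp : ∀ x : P, Cot E x →L[ℝ] Tan E x) {f : C → P}
    {B : ∀ c, Submodule ℝ (Cot E (f c))} (L : LieAlgebroid F f B) : Prop where
  anchor : ∀ c (ξ : B c), mfderiv 𝓘(ℝ, F) 𝓘(ℝ, E) f c (L.anchor c ξ) = sharp (f c) (ξ : Cot E (f c))
  bracket : ∀ σ τ, IsSection F f B σ → IsSection F f B τ →
    ∀ (U : Set P) (α β : ∀ x : P, Cot E x) (Z : ∀ x : P, Tan E x), IsOpen U →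
    SmoothFormOn α U → SmoothFormOn β U → SmoothFieldOn Z U →
    (∀ c, f c ∈ U → α (f c) = σ c) → (∀ c, f c ∈ U → β (f c) = τ c) →
    ∀ c, f c ∈ U → L.bracket σ τ c (Z (f c)) = koszul sharp α β Z (f c)

variable (F) in
/-- `B` is a Lie subalgebroid, over the submanifold `f : C → P`, of the cotangent Lie algebroid of
`(P, ♯)`: a vector subbundle with a Lie algebroid structure compatible with the inclusion. -/
def IsLieSubalgebroid (sharp : ∀ x : P, Cot E x →L[ℝ] Tan E x) (f : C → P)
    (B : ∀ c, Submodule ℝ (Cot E (f c))) : Prop :=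
  IsSmoothSubbundle F f B ∧ ∃ L : LieAlgebroid F f B, L.IsInduced sharp

variable {G : Type*} [NormedAddCommGroup G] [NormedSpace ℝ G]
  {Q : Type*} [TopologicalSpace Q] [ChartedSpace G Q] [IsManifold 𝓘(ℝ, G) ∞ Q]

/-- An isomorphism, over the identity of `C`, of Lie algebroids over `C`: a smooth vector bundle
isomorphism that intertwines the anchors and the brackets. -/
structure LieAlgebroid.Iso {f : C → P} {B : ∀ c, Submodule ℝ (Cot E (f c))}
    {g : C → Q} {B' : ∀ c, Submodule ℝ (Cot G (g c))}
    (L : LieAlgebroid F f B) (L' : LieAlgebroid F g B') where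
  toFun : ∀ c, B c ≃ₗ[ℝ] B' c
  smooth : ∀ σ (hσ : IsSection F f B σ),
    IsSection F g B' (fun c => (toFun c ⟨σ c, hσ.mem c⟩ : Cot G (g c)))
  symm_smooth : ∀ τ (hτ : IsSection F g B' τ),
    IsSection F f B (fun c => ((toFun c).symm ⟨τ c, hτ.mem c⟩ : Cot E (f c)))
  anchor : ∀ c (ξ : B c), L'.anchor c (toFun c ξ) = L.anchor c ξ
  bracket : ∀ σ τ (hσ : IsSection F f B σ) (hτ : IsSection F f B τ) (c : C),
    (toFun c ⟨L.bracket σ τ c, (L.bracket_isSection σ τ hσ hτ).mem c⟩ : Cot G (g c)) =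
      L'.bracket (fun c => (toFun c ⟨σ c, hσ.mem c⟩ : Cot G (g c)))
        (fun c => (toFun c ⟨τ c, hτ.mem c⟩ : Cot G (g c))) c

end Algebroid

end

/-!
Since `♯` is skew, `N*C ∩ ♯⁻¹TC` is the annihilator of `TC + ♯N*C`. The ranks of these two families
are therefore complementary, so that a subbundle requires `C` to be pre-Poisson. Conversely, in
charts of `P` in which `C` is a linear subspace, `N*C ∩ ♯⁻¹TC` is the kernel of a smooth family of
linear maps, which has smooth frames as soon as its rank is constant.

The Koszul bracket `D_{♯α} β - D_{♯β} α + β ((D♯) α)` of extensions `α`, `β` of two sections of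
`N*C ∩ ♯⁻¹TC` differentiates `α` and `β` only along `♯α` and `♯β`, which are tangent to `C`, so it
does not depend on the extensions. It is again conormal, as one sees by pairing it with vectors
tangent to `C`, and `♯` maps it to the bracket of `♯α` and `♯β` by the Jacobi identity, so to a
vector tangent to `C`.

If `C` is coisotropic in a cosymplectic `Q`, restricting covectors to `TQ` maps `N*C ∩ ♯⁻¹TC`
isomorphically to `N*_Q C`; the inverse extends covectors by zero on `♯N*Q`. If one-forms on `Q` are
extended in this way, `♯` maps the extensions to vectors tangent to `Q`, so that the brackets on `P`
and `Q` correspond.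
-/

noncomputable section

section ShortcutInstances

variable {V W : Type*} [NormedAddCommGroup V] [NormedSpace ℝ V]
  [NormedAddCommGroup W] [NormedSpace ℝ W]

-- Instance search for the norm on this iterated space of maps times out without the shortcut.
instance contractionNormedAddCommGroup : NormedAddCommGroup ((V →L[ℝ] ℝ) →L[ℝ] W) :=
  ContinuousLinearMap.toNormedAddCommGroup

instance contractionNormedSpace : NormedSpace ℝ ((V →L[ℝ] ℝ) →L[ℝ] W) :=
  ContinuousLinearMap.toNormedSpace

end ShortcutInstances

section KoszulForm

variable {V : Type*} [NormedAddCommGroup V] [NormedSpace ℝ V]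

/-- The Koszul bracket of one-forms on a vector space, for a contraction map `S`, with the exterior
derivatives written out: `D_{Sα} β - D_{Sβ} α + β ((D S) α)`. It is bilinear over constants and
agrees with `koszul` where `S` is skew, but mentions no vector fields. -/
def koszulForm (S : V → (V →L[ℝ] ℝ) →L[ℝ] V) (α β : V → V →L[ℝ] ℝ) (y : V) : V →L[ℝ] ℝ :=
  fderiv ℝ β y (S y (α y)) - fderiv ℝ α y (S y (β y)) + (β y).comp ((fderiv ℝ S y).flip (α y))

/-- A contraction map is skew if it comes from a bivector. -/
def IsSkew (T : (V →L[ℝ] ℝ) →L[ℝ] V) : Prop := ∀ a b : V →L[ℝ] ℝ, b (T a) = -a (T b)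

/-- The Jacobi identity at `y` for the bivector with contraction map `S`, evaluated on constant
one-forms. -/
def JacobiAt (S : V → (V →L[ℝ] ℝ) →L[ℝ] V) (y : V) : Prop :=
  ∀ a b c : V →L[ℝ] ℝ, c (fderiv ℝ S y (S y a) b) + a (fderiv ℝ S y (S y b) c)
    + b (fderiv ℝ S y (S y c) a) = 0

variable {S : V → (V →L[ℝ] ℝ) →L[ℝ] V} {α β γ : V → V →L[ℝ] ℝ} {y : V}

lemma koszulForm_apply (z : V) : koszulForm S α β y z =
    fderiv ℝ β y (S y (α y)) z - fderiv ℝ α y (S y (β y)) z + β y (fderiv ℝ S y z (α y)) := rfl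

section Derivatives

variable {W W' : Type*} [NormedAddCommGroup W] [NormedSpace ℝ W]
  [NormedAddCommGroup W'] [NormedSpace ℝ W'] {A : V → W →L[ℝ] W'}

lemma fderiv_clm_apply_apply {b : V → W} (hA : DifferentiableAt ℝ A y)
    (hb : DifferentiableAt ℝ b y) (v : V) :
    fderiv ℝ (fun x => A x (b x)) y v = fderiv ℝ A y v (b y) + A y (fderiv ℝ b y v) := by
  rw [fderiv_clm_apply hA hb]
  exact add_comm _ _

lemma fderiv_clm_apply_const (hA : DifferentiableAt ℝ A y) (b : W) (v : V) :
    fderiv ℝ (fun x => A x b) y v = fderiv ℝ A y v b := by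
  rw [fderiv_clm_apply_apply hA (differentiableAt_const b)]
  simp

lemma fderiv_const_clm_apply {b : V → W} (hb : DifferentiableAt ℝ b y) (c : W →L[ℝ] W') (v : V) :
    fderiv ℝ (fun x => c (b x)) y v = c (fderiv ℝ b y v) :=
  congrArg (fun T : V →L[ℝ] W' => T v) (c.hasFDerivAt.comp y hb.hasFDerivAt).fderiv

lemma differentiableAt_fderiv_of_contDiffAt_two {B : V → W} (hB : ContDiffAt ℝ 2 B y) :
    DifferentiableAt ℝ (fderiv ℝ B) y :=
  (hB.fderiv_right (m := 1) (by norm_num [one_add_one_eq_two])).differentiableAt one_ne_zero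

end Derivatives

lemma apply_fderiv_eq_neg_of_isSkew (hS : DifferentiableAt ℝ S y)
    (hskew : ∀ᶠ x in 𝓝 y, IsSkew (S x)) (a b : V →L[ℝ] ℝ) (v : V) :
    b (fderiv ℝ S y v a) = -a (fderiv ℝ S y v b) := by
  have fderiv_pairing (a b : V →L[ℝ] ℝ) :
      fderiv ℝ (fun x => b (S x a)) y v = b (fderiv ℝ S y v a) := by
    rw [fderiv_const_clm_apply (hS.clm_apply (differentiableAt_const a)),
      fderiv_clm_apply_const hS]
  have hpairing : (fun x => b (S x a)) =ᶠ[𝓝 y] fun x => -a (S x b) := by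
    filter_upwards [hskew] with x hx using hx a b
  rw [← fderiv_pairing, ← fderiv_pairing, hpairing.fderiv_eq, fderiv_fun_neg]
  rfl

lemma koszulForm_swap (hS : DifferentiableAt ℝ S y) (hskew : ∀ᶠ x in 𝓝 y, IsSkew (S x)) :
    koszulForm S β α y = -koszulForm S α β y := by
  ext z
  have hDS := apply_fderiv_eq_neg_of_isSkew hS hskew (α y) (β y) z
  simp only [koszulForm_apply, neg_apply]
  linarith

lemma koszulForm_add (hβ : DifferentiableAt ℝ β y) (hγ : DifferentiableAt ℝ γ y) :
    koszulForm S α (β + γ) y = koszulForm S α β y + koszulForm S α γ y := by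
  ext z
  simp only [koszulForm_apply, add_apply, fderiv_add hβ hγ, Pi.add_apply, map_add]
  ring

lemma koszulForm_smul {h : V → ℝ} (hh : DifferentiableAt ℝ h y) (hβ : DifferentiableAt ℝ β y) :
    koszulForm S α (fun x => h x • β x) y =
      h y • koszulForm S α β y + fderiv ℝ h y (S y (α y)) • β y := by
  ext z
  simp only [koszulForm_apply, add_apply, fderiv_fun_smul hh hβ,
    smul_apply, ContinuousLinearMap.smulRight_apply, map_smul, smul_eq_mul]
  ring

lemma koszulForm_congr_sharp {S' : V → (V →L[ℝ] ℝ) →L[ℝ] V} (hS : S =ᶠ[𝓝 y] S') :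
    koszulForm S α β y = koszulForm S' α β y := by
  simp only [koszulForm, hS.fderiv_eq, hS.self_of_nhds]

lemma contDiffOn_koszulForm [FiniteDimensional ℝ V] {W : Set V} (hW : IsOpen W)
    (hS : ContDiffOn ℝ ∞ S W) (hα : ContDiffOn ℝ ∞ α W) (hβ : ContDiffOn ℝ ∞ β W) :
    ContDiffOn ℝ ∞ (koszulForm S α β) W := by
  have hDS := hS.fderiv_of_isOpen hW (m := ∞) le_rfl
  have hDα := hα.fderiv_of_isOpen hW (m := ∞) le_rfl
  have hDβ := hβ.fderiv_of_isOpen hW (m := ∞) le_rfl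
  refine contDiffOn_clm_apply.2 fun z => ?_
  simp only [koszulForm_apply]
  exact (((hDβ.clm_apply (hS.clm_apply hα)).clm_apply contDiffOn_const).sub
    ((hDα.clm_apply (hS.clm_apply hβ)).clm_apply contDiffOn_const)).add
    (hβ.clm_apply ((hDS.clm_apply contDiffOn_const).clm_apply hα))

lemma mlieBracket_vectorSpace (X Z : V → V) (x : V) :
    VectorField.mlieBracket 𝓘(ℝ, V) (M := V) X Z x = VectorField.lieBracket ℝ X Z x := by
  have h := congrFun (VectorField.mlieBracketWithin_eq_lieBracketWithin (𝕜 := ℝ) (V := X) (W := Z)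
    (s := Set.univ)) x
  rw [VectorField.lieBracketWithin_univ] at h
  exact (congrFun VectorField.mlieBracketWithin_univ x).symm.trans h

lemma lieDerivForm_vectorSpace (X : V → V) {Z : V → V}
    (hβ : DifferentiableAt ℝ β y) (hZ : DifferentiableAt ℝ Z y) :
    lieDerivForm (E := V) (M := V) X β Z y =
      fderiv ℝ β y (X y) (Z y) + β y (fderiv ℝ X y (Z y)) := by
  have h : lieDerivForm (E := V) (M := V) X β Z y =
      fderiv ℝ (fun x => β x (Z x)) y (X y) - β y (VectorField.lieBracket ℝ X Z y) := by
    rw [← mlieBracket_vectorSpace, ← mfderiv_eq_fderiv]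
    rfl
  rw [h, fderiv_clm_apply_apply hβ hZ, VectorField.lieBracket, map_sub]
  ring

lemma koszul_eq_koszulForm {Z : V → V} (hS : DifferentiableAt ℝ S y)
    (hskew : ∀ᶠ x in 𝓝 y, IsSkew (S x))
    (hα : DifferentiableAt ℝ α y) (hβ : DifferentiableAt ℝ β y) (hZ : DifferentiableAt ℝ Z y) :
    koszul (E := V) (M := V) S α β Z y = koszulForm S α β y (Z y) := by
  have hSα : DifferentiableAt ℝ (fun x => S x (α x)) y := hS.clm_apply hα
  have hunfold : koszul (E := V) (M := V) S α β Z y =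
      lieDerivForm (E := V) (M := V) (fun x => S x (α x)) β Z y
      - lieDerivForm (E := V) (M := V) (fun x => S x (β x)) α Z y
      - fderiv ℝ (fun x => β x (S x (α x))) y (Z y) := by
    rw [← mfderiv_eq_fderiv]
    rfl
  have hDS := apply_fderiv_eq_neg_of_isSkew hS hskew (α y) (β y) (Z y)
  have hDβ := hskew.self_of_nhds (α y) (fderiv ℝ β y (Z y))
  rw [hunfold, lieDerivForm_vectorSpace _ hβ hZ, lieDerivForm_vectorSpace _ hα hZ,
    koszulForm_apply, fderiv_clm_apply_apply hβ hSα, fderiv_clm_apply_apply hS hα,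
    fderiv_clm_apply_apply hS hβ]
  simp only [map_add]
  linarith

lemma sharp_koszulForm (hS : DifferentiableAt ℝ S y)
    (hskew : ∀ᶠ x in 𝓝 y, IsSkew (S x)) (hJ : JacobiAt S y)
    (hα : DifferentiableAt ℝ α y) (hβ : DifferentiableAt ℝ β y) :
    S y (koszulForm S α β y) = fderiv ℝ (fun x => S x (β x)) y (S y (α y))
      - fderiv ℝ (fun x => S x (α x)) y (S y (β y)) := by
  refine (SeparatingDual.eq_iff_forall_dual_eq (R := ℝ)).2 fun c => ?_
  rw [fderiv_clm_apply_apply hS hα, fderiv_clm_apply_apply hS hβ,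
    hskew.self_of_nhds (koszulForm S α β y) c, koszulForm_apply]
  simp only [map_add, map_sub]
  have hjacobi := hJ (α y) (β y) c
  have hDβ := hskew.self_of_nhds (fderiv ℝ β y (S y (α y))) c
  have hDα := hskew.self_of_nhds (fderiv ℝ α y (S y (β y))) c
  have hDS := apply_fderiv_eq_neg_of_isSkew hS hskew c (α y) (S y (β y))
  linarith

section Jacobi

lemma differentiableAt_koszulForm (hS : ContDiffAt ℝ 2 S y) (hα : ContDiffAt ℝ 2 α y)
    (hβ : ContDiffAt ℝ 2 β y) : DifferentiableAt ℝ (koszulForm S α β) y := by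
  have dS := hS.differentiableAt two_ne_zero
  have dα := hα.differentiableAt two_ne_zero
  have dβ := hβ.differentiableAt two_ne_zero
  have dDS_flip : DifferentiableAt ℝ (fun x => (fderiv ℝ S x).flip) y :=
    (ContinuousLinearMap.flipₗᵢ ℝ V (V →L[ℝ] ℝ) V).toContinuousLinearEquiv.differentiableAt.comp
      y (differentiableAt_fderiv_of_contDiffAt_two hS)
  exact (((differentiableAt_fderiv_of_contDiffAt_two hβ).clm_apply (dS.clm_apply dα)).sub
    ((differentiableAt_fderiv_of_contDiffAt_two hα).clm_apply (dS.clm_apply dβ))).add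
    (dβ.clm_comp (dDS_flip.clm_apply dα))

lemma fderiv_fderiv_sharp_apply (hS : DifferentiableAt ℝ S y) (hα : DifferentiableAt ℝ α y)
    (hβ : ContDiffAt ℝ 2 β y) (v z : V) :
    fderiv ℝ (fun x => fderiv ℝ β x (S x (α x)) z) y v =
      fderiv ℝ (fderiv ℝ β) y v (S y (α y)) z + fderiv ℝ β y (fderiv ℝ S y v (α y)) z
        + fderiv ℝ β y (S y (fderiv ℝ α y v)) z := by
  have dDβ := differentiableAt_fderiv_of_contDiffAt_two hβ
  rw [fderiv_clm_apply_const (dDβ.clm_apply (hS.clm_apply hα)),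
    fderiv_clm_apply_apply dDβ (hS.clm_apply hα), fderiv_clm_apply_apply hS hα, map_add]
  simp only [add_apply, add_assoc]

lemma fderiv_apply_fderiv_sharp (hS : ContDiffAt ℝ 2 S y) (hα : DifferentiableAt ℝ α y)
    (hβ : DifferentiableAt ℝ β y) (v z : V) :
    fderiv ℝ (fun x => β x (fderiv ℝ S x z (α x))) y v =
      fderiv ℝ β y v (fderiv ℝ S y z (α y)) + β y (fderiv ℝ (fderiv ℝ S) y v z (α y))
        + β y (fderiv ℝ S y z (fderiv ℝ α y v)) := by
  have dDS := differentiableAt_fderiv_of_contDiffAt_two hS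
  have dDSz : DifferentiableAt ℝ (fun x => fderiv ℝ S x z) y :=
    dDS.clm_apply (differentiableAt_const z)
  rw [fderiv_clm_apply_apply hβ (dDSz.clm_apply hα), fderiv_clm_apply_apply dDSz hα,
    fderiv_clm_apply_const dDS, map_add, add_assoc]

lemma fderiv_koszulForm_apply (hS : ContDiffAt ℝ 2 S y) (hα : ContDiffAt ℝ 2 α y)
    (hβ : ContDiffAt ℝ 2 β y) (v z : V) : fderiv ℝ (koszulForm S α β) y v z =
      fderiv ℝ (fderiv ℝ β) y v (S y (α y)) z + fderiv ℝ β y (fderiv ℝ S y v (α y)) z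
        + fderiv ℝ β y (S y (fderiv ℝ α y v)) z
      - (fderiv ℝ (fderiv ℝ α) y v (S y (β y)) z + fderiv ℝ α y (fderiv ℝ S y v (β y)) z
        + fderiv ℝ α y (S y (fderiv ℝ β y v)) z)
      + (fderiv ℝ β y v (fderiv ℝ S y z (α y)) + β y (fderiv ℝ (fderiv ℝ S) y v z (α y))
        + β y (fderiv ℝ S y z (fderiv ℝ α y v))) := by
  have dS := hS.differentiableAt two_ne_zero
  have dα := hα.differentiableAt two_ne_zero
  have dβ := hβ.differentiableAt two_ne_zero
  have dDS := differentiableAt_fderiv_of_contDiffAt_two hS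
  have dβSα : DifferentiableAt ℝ (fun x => fderiv ℝ β x (S x (α x)) z) y :=
    ((differentiableAt_fderiv_of_contDiffAt_two hβ).clm_apply (dS.clm_apply dα)).clm_apply
      (differentiableAt_const z)
  have dαSβ : DifferentiableAt ℝ (fun x => fderiv ℝ α x (S x (β x)) z) y :=
    ((differentiableAt_fderiv_of_contDiffAt_two hα).clm_apply (dS.clm_apply dβ)).clm_apply
      (differentiableAt_const z)
  have dβDSα : DifferentiableAt ℝ (fun x => β x (fderiv ℝ S x z (α x))) y :=
    dβ.clm_apply ((dDS.clm_apply (differentiableAt_const z)).clm_apply dα)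
  rw [← fderiv_clm_apply_const (differentiableAt_koszulForm hS hα hβ)]
  simp only [koszulForm_apply]
  rw [fderiv_fun_add (dβSα.fun_sub dαSβ) dβDSα, fderiv_fun_sub dβSα dαSβ]
  simp only [add_apply, sub_apply, fderiv_fderiv_sharp_apply dS dα hβ,
    fderiv_fderiv_sharp_apply dS dβ hα, fderiv_apply_fderiv_sharp hS dα dβ]

lemma fderiv_jacobiAt (hS : ContDiffAt ℝ 2 S y) (hJ : ∀ᶠ x in 𝓝 y, JacobiAt S x)
    (a b c : V →L[ℝ] ℝ) (z : V) :
    c (fderiv ℝ (fderiv ℝ S) y z (S y a) b) + c (fderiv ℝ S y (fderiv ℝ S y z a) b)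
    + (a (fderiv ℝ (fderiv ℝ S) y z (S y b) c) + a (fderiv ℝ S y (fderiv ℝ S y z b) c))
    + (b (fderiv ℝ (fderiv ℝ S) y z (S y c) a) + b (fderiv ℝ S y (fderiv ℝ S y z c) a)) = 0 := by
  have dS := hS.differentiableAt two_ne_zero
  have dDS := differentiableAt_fderiv_of_contDiffAt_two hS
  have dDSSa (a : V →L[ℝ] ℝ) : DifferentiableAt ℝ (fun x => fderiv ℝ S x (S x a)) y :=
    dDS.clm_apply (dS.clm_apply (differentiableAt_const a))
  have dDSSab (a b : V →L[ℝ] ℝ) : DifferentiableAt ℝ (fun x => fderiv ℝ S x (S x a) b) y :=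
    (dDSSa a).clm_apply (differentiableAt_const b)
  have dterm (a b c : V →L[ℝ] ℝ) : DifferentiableAt ℝ (fun x => c (fderiv ℝ S x (S x a) b)) y :=
    c.differentiableAt.comp y (dDSSab a b)
  have fderiv_term (a b c : V →L[ℝ] ℝ) :
      fderiv ℝ (fun x => c (fderiv ℝ S x (S x a) b)) y z =
        c (fderiv ℝ (fderiv ℝ S) y z (S y a) b) + c (fderiv ℝ S y (fderiv ℝ S y z a) b) := by
    rw [fderiv_const_clm_apply (dDSSab a b), fderiv_clm_apply_const (dDSSa a),
      fderiv_clm_apply_apply dDS (dS.clm_apply (differentiableAt_const a)),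
      fderiv_clm_apply_const dS, add_apply, map_add]
  have hzero : (fun x => c (fderiv ℝ S x (S x a) b) + a (fderiv ℝ S x (S x b) c)
      + b (fderiv ℝ S x (S x c) a)) =ᶠ[𝓝 y] fun _ => 0 := by
    filter_upwards [hJ] with x hx using hx a b c
  have hfderiv := congrArg (fun T : V →L[ℝ] ℝ => T z) hzero.fderiv_eq
  rw [fderiv_fun_add ((dterm a b c).fun_add (dterm b c a)) (dterm c a b),
    fderiv_fun_add (dterm a b c) (dterm b c a)] at hfderiv
  simpa only [add_apply, fderiv_term, fderiv_fun_const, Pi.zero_apply, zero_apply] using hfderiv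

lemma koszulForm_jacobi (hS : ContDiffAt ℝ 2 S y)
    (hskew : ∀ᶠ x in 𝓝 y, IsSkew (S x)) (hJ : ∀ᶠ x in 𝓝 y, JacobiAt S x)
    (hα : ContDiffAt ℝ 2 α y) (hβ : ContDiffAt ℝ 2 β y) (hγ : ContDiffAt ℝ 2 γ y) :
    koszulForm S α (koszulForm S β γ) y + koszulForm S β (koszulForm S γ α) y
      + koszulForm S γ (koszulForm S α β) y = 0 := by
  have dS := hS.differentiableAt two_ne_zero
  have dα := hα.differentiableAt two_ne_zero
  have dβ := hβ.differentiableAt two_ne_zero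
  have dγ := hγ.differentiableAt two_ne_zero
  have hmin : minSmoothness ℝ 2 ≤ 2 := by simp
  have hJy := hJ.self_of_nhds
  ext z
  have D2_symm {δ : V → V →L[ℝ] ℝ} (hδ : ContDiffAt ℝ 2 δ y) (v w : V) :
      fderiv ℝ (fderiv ℝ δ) y v w z = fderiv ℝ (fderiv ℝ δ) y w v z :=
    congrArg (fun T : V →L[ℝ] ℝ => T z) (hδ.isSymmSndFDerivAt hmin v w)
  have D2α := D2_symm hα (S y (β y)) (S y (γ y))
  have D2β := D2_symm hβ (S y (γ y)) (S y (α y))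
  have D2γ := D2_symm hγ (S y (α y)) (S y (β y))
  have skewγβ := apply_fderiv_eq_neg_of_isSkew dS hskew (γ y) (fderiv ℝ β y (S y (α y))) z
  have skewαγ := apply_fderiv_eq_neg_of_isSkew dS hskew (α y) (fderiv ℝ γ y (S y (β y))) z
  have skewβα := apply_fderiv_eq_neg_of_isSkew dS hskew (β y) (fderiv ℝ α y (S y (γ y))) z
  have DJ := fderiv_jacobiAt hS hJ (α y) (β y) (γ y) z
  have D2S := hS.isSymmSndFDerivAt hmin
  rw [D2S z (S y (α y)), D2S z (S y (β y)), D2S z (S y (γ y))] at DJ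
  simp only [add_apply, zero_apply, koszulForm_apply (β := koszulForm S _ _),
    fderiv_koszulForm_apply hS hα hβ, fderiv_koszulForm_apply hS hβ hγ,
    fderiv_koszulForm_apply hS hγ hα, sharp_koszulForm dS hskew hJy dα dβ,
    sharp_koszulForm dS hskew hJy dβ dγ, sharp_koszulForm dS hskew hJy dγ dα,
    fderiv_clm_apply_apply dS dα, fderiv_clm_apply_apply dS dβ,
    fderiv_clm_apply_apply dS dγ, map_add, map_sub, sub_apply]
  simp only [koszulForm_apply]
  linarith

end Jacobi

end KoszulForm

section ConormalSpace

variable {V : Type*} [NormedAddCommGroup V] [NormedSpace ℝ V]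
  {U : Type*} [NormedAddCommGroup U] [NormedSpace ℝ U]
  {T : (V →L[ℝ] ℝ) →L[ℝ] V} {ι : U →L[ℝ] V} {ρ : V →L[ℝ] U}

instance precompNormedAddCommGroup : NormedAddCommGroup ((U →L[ℝ] ℝ) →L[ℝ] V →L[ℝ] ℝ) :=
  ContinuousLinearMap.toNormedAddCommGroup

/-- The covectors which annihilate the image of `ι`. -/
def conormalSpace (ι : U →L[ℝ] V) : Submodule ℝ (V →L[ℝ] ℝ) :=
  (ContinuousLinearMap.precomp ℝ ι : (V →L[ℝ] ℝ) →L[ℝ] (U →L[ℝ] ℝ)).ker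

/-- The vector space model of `charConormal`: the conormal covectors of the image of `ι` which `T`
maps into that image. -/
def charCovectors (T : (V →L[ℝ] ℝ) →L[ℝ] V) (ι : U →L[ℝ] V) : Submodule ℝ (V →L[ℝ] ℝ) :=
  conormalSpace ι ⊓ ι.range.comap T.toLinearMap

/-- A map whose kernel is `charCovectors T ι`, for a left inverse `ρ` of `ι`. -/
def charMap (T : (V →L[ℝ] ℝ) →L[ℝ] V) (ι : U →L[ℝ] V) (ρ : V →L[ℝ] U) :
    (V →L[ℝ] ℝ) →L[ℝ] (U →L[ℝ] ℝ) × V :=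
  (ContinuousLinearMap.precomp ℝ ι).prod ((ContinuousLinearMap.id ℝ V - ι.comp ρ).comp T)

lemma mem_conormalSpace {k : V →L[ℝ] ℝ} : k ∈ conormalSpace ι ↔ ∀ z, k (ι z) = 0 := by
  simp [conormalSpace, ContinuousLinearMap.ext_iff]

lemma mem_charCovectors {k : V →L[ℝ] ℝ} :
    k ∈ charCovectors T ι ↔ k ∈ conormalSpace ι ∧ ∃ w, ι w = T k :=
  Iff.rfl

lemma range_eq_ker_id_sub_comp (hρ : ∀ z, ρ (ι z) = z) :
    ι.range = (ContinuousLinearMap.id ℝ V - ι.comp ρ).ker := by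
  ext v
  refine ⟨?_, fun hv => ⟨ρ v, (sub_eq_zero.1 hv).symm⟩⟩
  rintro ⟨z, rfl⟩
  simp [hρ]

lemma ker_charMap (hρ : ∀ z, ρ (ι z) = z) : (charMap T ι ρ).ker = charCovectors T ι := by
  rw [charCovectors, range_eq_ker_id_sub_comp hρ]
  exact LinearMap.ker_prod _ _

lemma finrank_continuousDual (W : Type*) [NormedAddCommGroup W] [NormedSpace ℝ W]
    [FiniteDimensional ℝ W] : Module.finrank ℝ (W →L[ℝ] ℝ) = Module.finrank ℝ W := by
  rw [← (LinearMap.toContinuousLinearMap (𝕜 := ℝ) (E := W) (F' := ℝ)).finrank_eq]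
  exact Subspace.dual_finrank_eq

lemma finrank_add_finrank_conormalSpace [FiniteDimensional ℝ V] [FiniteDimensional ℝ U]
    (hρ : ∀ z, ρ (ι z) = z) :
    Module.finrank ℝ U + Module.finrank ℝ (conormalSpace ι) = Module.finrank ℝ V := by
  have hsurj : (ContinuousLinearMap.precomp ℝ ι : (V →L[ℝ] ℝ) →L[ℝ] (U →L[ℝ] ℝ)).range = ⊤ := by
    refine LinearMap.range_eq_top.2 fun η => ⟨η.comp ρ, ?_⟩
    ext z
    simp [hρ]
  have hrank := LinearMap.finrank_range_add_finrank_ker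
    (ContinuousLinearMap.precomp ℝ ι : (V →L[ℝ] ℝ) →L[ℝ] (U →L[ℝ] ℝ)).toLinearMap
  rwa [hsurj, finrank_top, finrank_continuousDual, finrank_continuousDual] at hrank

end ConormalSpace

section AlongSubspace

variable {V : Type*} [NormedAddCommGroup V] [NormedSpace ℝ V]
  {U : Type*} [NormedAddCommGroup U] [NormedSpace ℝ U]
  {S : V → (V →L[ℝ] ℝ) →L[ℝ] V} {ι : U →L[ℝ] V} {ρ : V →L[ℝ] U} {u : U}
  {α β : V → V →L[ℝ] ℝ}

section Restriction

variable {W : Type*} [NormedAddCommGroup W] [NormedSpace ℝ W]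

lemma fderiv_comp_clm_apply {A : V → W} (hA : DifferentiableAt ℝ A (ι u)) (w : U) :
    fderiv ℝ (fun x => A (ι x)) u w = fderiv ℝ A (ι u) (ι w) :=
  congrArg (fun T : U →L[ℝ] W => T w) (hA.hasFDerivAt.comp u ι.hasFDerivAt).fderiv

lemma fderiv_apply_eq_of_eventuallyEq_comp {A A' : V → W} (hA : DifferentiableAt ℝ A (ι u))
    (hA' : DifferentiableAt ℝ A' (ι u)) (h : ∀ᶠ x in 𝓝 u, A (ι x) = A' (ι x)) (w : U) :
    fderiv ℝ A (ι u) (ι w) = fderiv ℝ A' (ι u) (ι w) := by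
  rw [← fderiv_comp_clm_apply hA, ← fderiv_comp_clm_apply hA', Filter.EventuallyEq.fderiv_eq h]

lemma fderiv_mem_ker {W' : Type*} [NormedAddCommGroup W'] [NormedSpace ℝ W'] {L : W →L[ℝ] W'}
    {A : V → W} (hA : DifferentiableAt ℝ A (ι u)) (h : ∀ᶠ x in 𝓝 u, A (ι x) ∈ L.ker) (w : U) :
    fderiv ℝ A (ι u) (ι w) ∈ L.ker := by
  have hAι : DifferentiableAt ℝ (fun x => A (ι x)) u := hA.comp u ι.differentiableAt
  have hLA : (fun x => L (A (ι x))) =ᶠ[𝓝 u] fun _ => 0 := h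
  change L _ = 0
  rw [← fderiv_comp_clm_apply hA, ← fderiv_const_clm_apply hAι,
    hLA.fderiv_eq, fderiv_fun_const]
  rfl

end Restriction

lemma koszulForm_congr_of_tangent {α' β' : V → V →L[ℝ] ℝ}
    (hα : DifferentiableAt ℝ α (ι u)) (hβ : DifferentiableAt ℝ β (ι u))
    (hα' : DifferentiableAt ℝ α' (ι u)) (hβ' : DifferentiableAt ℝ β' (ι u))
    (hαα' : ∀ᶠ x in 𝓝 u, α (ι x) = α' (ι x)) (hββ' : ∀ᶠ x in 𝓝 u, β (ι x) = β' (ι x))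
    (hSα : S (ι u) (α (ι u)) ∈ ι.range) (hSβ : S (ι u) (β (ι u)) ∈ ι.range) :
    koszulForm S α β (ι u) = koszulForm S α' β' (ι u) := by
  obtain ⟨w, hw : ι w = _⟩ := hSα
  obtain ⟨w', hw' : ι w' = _⟩ := hSβ
  simp only [koszulForm, ← hαα'.self_of_nhds, ← hββ'.self_of_nhds, ← hw, ← hw',
    fderiv_apply_eq_of_eventuallyEq_comp hα hα' hαα',
    fderiv_apply_eq_of_eventuallyEq_comp hβ hβ' hββ']

lemma apply_fderiv_sharp_eq_zero_of_charCovectors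
    (hS : DifferentiableAt ℝ S (ι u)) (hskew : IsSkew (S (ι u)))
    (hα : DifferentiableAt ℝ α (ι u)) (hβ : DifferentiableAt ℝ β (ι u))
    (hαchar : ∀ᶠ x in 𝓝 u, α (ι x) ∈ charCovectors (S (ι x)) ι)
    (hβchar : ∀ᶠ x in 𝓝 u, β (ι x) ∈ charCovectors (S (ι x)) ι) (z : U) :
    β (ι u) (fderiv ℝ S (ι u) (ι z) (α (ι u))) = 0 := by
  obtain ⟨-, w, hw⟩ := mem_charCovectors.1 hαchar.self_of_nhds
  obtain ⟨-, w', hw'⟩ := mem_charCovectors.1 hβchar.self_of_nhds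
  have hSα : DifferentiableAt ℝ (fun x => S x (α x)) (ι u) := hS.clm_apply hα
  have hpairing : (fun x => β (ι x) (S (ι x) (α (ι x)))) =ᶠ[𝓝 u] fun _ => 0 := by
    filter_upwards [hαchar, hβchar] with x ⟨_, v, hv⟩ hx'
    exact (congrArg (β (ι x)) hv.symm).trans (mem_conormalSpace.1 hx'.1 v)
  have hDα := mem_conormalSpace.1 (fderiv_mem_ker hα (hαchar.mono fun _ hx => hx.1) z) w'
  have hDβ := mem_conormalSpace.1 (fderiv_mem_ker hβ (hβchar.mono fun _ hx => hx.1) z) w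
  have hDpairing := fderiv_clm_apply_apply hβ hSα (ι z)
  rw [← fderiv_comp_clm_apply (hβ.clm_apply hSα), hpairing.fderiv_eq,
    fderiv_clm_apply_apply hS hα, map_add, hskew _ (β (ι u)), ← hw, ← hw', hDα, hDβ] at hDpairing
  simpa using hDpairing.symm

lemma koszulForm_mem_charCovectors (hρ : ∀ z, ρ (ι z) = z)
    (hS : DifferentiableAt ℝ S (ι u)) (hskew : ∀ᶠ x in 𝓝 (ι u), IsSkew (S x))
    (hJ : JacobiAt S (ι u))
    (hα : DifferentiableAt ℝ α (ι u)) (hβ : DifferentiableAt ℝ β (ι u))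
    (hαchar : ∀ᶠ x in 𝓝 u, α (ι x) ∈ charCovectors (S (ι x)) ι)
    (hβchar : ∀ᶠ x in 𝓝 u, β (ι x) ∈ charCovectors (S (ι x)) ι) :
    koszulForm S α β (ι u) ∈ charCovectors (S (ι u)) ι := by
  obtain ⟨-, w, hw⟩ := mem_charCovectors.1 hαchar.self_of_nhds
  obtain ⟨-, w', hw'⟩ := mem_charCovectors.1 hβchar.self_of_nhds
  have hDconormal {γ : V → V →L[ℝ] ℝ} (hγ : DifferentiableAt ℝ γ (ι u))
      (hγchar : ∀ᶠ x in 𝓝 u, γ (ι x) ∈ charCovectors (S (ι x)) ι) (v z : U) :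
      fderiv ℝ γ (ι u) (ι v) (ι z) = 0 :=
    mem_conormalSpace.1 (fderiv_mem_ker hγ (hγchar.mono fun _ hx => hx.1) v) z
  have hDtangent {γ : V → V →L[ℝ] ℝ} (hγ : DifferentiableAt ℝ γ (ι u))
      (hγchar : ∀ᶠ x in 𝓝 u, γ (ι x) ∈ charCovectors (S (ι x)) ι) (v : U) :
      fderiv ℝ (fun x => S x (γ x)) (ι u) (ι v) ∈ ι.range := by
    rw [range_eq_ker_id_sub_comp hρ]
    refine fderiv_mem_ker (hS.clm_apply hγ) (hγchar.mono fun x hx => ?_) v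
    exact (range_eq_ker_id_sub_comp hρ).le hx.2
  refine mem_charCovectors.2 ⟨mem_conormalSpace.2 fun z => ?_, ?_⟩
  · rw [koszulForm_apply, ← hw, ← hw', hDconormal hα hαchar, hDconormal hβ hβchar,
      apply_fderiv_sharp_eq_zero_of_charCovectors hS hskew.self_of_nhds hα hβ hαchar hβchar]
    norm_num
  · rw [sharp_koszulForm hS hskew hJ hα hβ, ← hw, ← hw']
    exact sub_mem (hDtangent hβ hβchar w) (hDtangent hα hαchar w')

end AlongSubspace

section CosymplecticProjection

variable {V : Type*} [NormedAddCommGroup V] [NormedSpace ℝ V]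
  {U : Type*} [NormedAddCommGroup U] [NormedSpace ℝ U]
  {S : V → (V →L[ℝ] ℝ) →L[ℝ] V} {ι : U →L[ℝ] V} {p : U → V →L[ℝ] U} {u : U}

/-- `q` is the projection, along the image of the conormal space under `T`, onto the domain of
`ι`: the vector space model of `cosymplecticProj`. -/
structure IsCosymplecticProjection (T : (V →L[ℝ] ℝ) →L[ℝ] V) (ι : U →L[ℝ] V) (q : V →L[ℝ] U) :
    Prop where
  apply_inclusion : ∀ z, q (ι z) = z
  apply_sharp : ∀ k ∈ conormalSpace ι, q (T k) = 0

/-- The contraction map induced on the domain of `ι` by a family `p` of projections onto it: the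
vector space model of `inducedSharp`. -/
def inducedContraction (S : V → (V →L[ℝ] ℝ) →L[ℝ] V) (ι : U →L[ℝ] V) (p : U → V →L[ℝ] U) (u : U) :
    (U →L[ℝ] ℝ) →L[ℝ] U :=
  (p u).comp ((S (ι u)).comp (ContinuousLinearMap.precomp ℝ (p u)))

lemma IsCosymplecticProjection.sharp_comp {T : (V →L[ℝ] ℝ) →L[ℝ] V} {q : V →L[ℝ] U}
    (hq : IsCosymplecticProjection T ι q) (hT : IsSkew T) (η : U →L[ℝ] ℝ) :
    T (η.comp q) = ι (q (T (η.comp q))) := by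
  refine (SeparatingDual.eq_iff_forall_dual_eq (R := ℝ)).2 fun c => ?_
  have hconormal : c - c.comp (ι.comp q) ∈ conormalSpace ι :=
    mem_conormalSpace.2 fun z => by simp [hq.apply_inclusion]
  have hpairing := hT (η.comp q) (c - c.comp (ι.comp q))
  rw [ContinuousLinearMap.comp_apply η, hq.apply_sharp _ hconormal, map_zero, neg_zero]
    at hpairing
  simpa [sub_eq_zero] using hpairing

lemma fderiv_projection_apply_inclusion (hp : DifferentiableAt ℝ p u)
    (hpι : ∀ᶠ x in 𝓝 u, ∀ z, p x (ι z) = z) (z w : U) : fderiv ℝ p u z (ι w) = 0 := by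
  have hconst : (fun x => p x (ι w)) =ᶠ[𝓝 u] fun _ => w := hpι.mono fun _ hx => hx w
  rw [← fderiv_clm_apply_const hp, hconst.fderiv_eq, fderiv_fun_const]
  rfl

lemma fderiv_apply_inclusion_of_comp_eq {γ : V → V →L[ℝ] ℝ} {γ' : U → U →L[ℝ] ℝ}
    (hγ : DifferentiableAt ℝ γ (ι u)) (hγ' : DifferentiableAt ℝ γ' u)
    (h : ∀ᶠ x in 𝓝 u, (γ (ι x)).comp ι = γ' x) (w z : U) :
    fderiv ℝ γ (ι u) (ι w) (ι z) = fderiv ℝ γ' u w z := by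
  have heq : (fun x => γ (ι x) (ι z)) =ᶠ[𝓝 u] fun x => γ' x z :=
    h.mono fun x hx => congrArg (fun η : U →L[ℝ] ℝ => η z) hx
  rw [← fderiv_clm_apply_const hγ, ← fderiv_clm_apply_const hγ', ← heq.fderiv_eq,
    fderiv_comp_clm_apply (hγ.clm_apply (differentiableAt_const _))]

lemma differentiableAt_inducedContraction (hS : DifferentiableAt ℝ S (ι u))
    (hp : DifferentiableAt ℝ p u) : DifferentiableAt ℝ (inducedContraction S ι p) u :=
  hp.clm_comp ((hS.comp u ι.differentiableAt).clm_comp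
    ((ContinuousLinearMap.compL ℝ V U ℝ).flip.differentiableAt.comp u hp))

lemma fderiv_inducedContraction_apply
    (hS : DifferentiableAt ℝ S (ι u)) (hskew : IsSkew (S (ι u))) (hp : DifferentiableAt ℝ p u)
    (hproj : ∀ᶠ x in 𝓝 u, IsCosymplecticProjection (S (ι x)) ι (p x)) (z : U) (η : U →L[ℝ] ℝ) :
    fderiv ℝ (inducedContraction S ι p) u z η =
      p u (fderiv ℝ S (ι u) (ι z) (η.comp (p u))) := by
  have hpι : ∀ᶠ x in 𝓝 u, ∀ z, p x (ι z) = z := hproj.mono fun _ hx => hx.apply_inclusion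
  have hSι : DifferentiableAt ℝ (fun x => S (ι x)) u := hS.comp u ι.differentiableAt
  have hηp : DifferentiableAt ℝ (fun x => η.comp (p x)) u :=
    (differentiableAt_const _).clm_comp hp
  have hDηp : fderiv ℝ (fun x => η.comp (p x)) u z = η.comp (fderiv ℝ p u z) := by
    rw [((hasFDerivAt_const η u).clm_comp hp.hasFDerivAt).fderiv]
    ext
    simp
  have hconormal : η.comp (fderiv ℝ p u z) ∈ conormalSpace ι := mem_conormalSpace.2 fun w => by
    rw [ContinuousLinearMap.comp_apply, fderiv_projection_apply_inclusion hp hpι, map_zero]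
  calc fderiv ℝ (inducedContraction S ι p) u z η
    _ = fderiv ℝ (fun x => p x (S (ι x) (η.comp (p x)))) u z :=
      (fderiv_clm_apply_const (differentiableAt_inducedContraction hS hp) η z).symm
    _ = fderiv ℝ p u z (S (ι u) (η.comp (p u))) + p u (fderiv ℝ S (ι u) (ι z) (η.comp (p u)))
          + p u (S (ι u) (η.comp (fderiv ℝ p u z))) := by
      rw [fderiv_clm_apply_apply hp (hSι.clm_apply hηp), fderiv_clm_apply_apply hSι hηp,
        fderiv_comp_clm_apply hS, hDηp, map_add, add_assoc]
    _ = p u (fderiv ℝ S (ι u) (ι z) (η.comp (p u))) := by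
      rw [hproj.self_of_nhds.sharp_comp hskew, fderiv_projection_apply_inclusion hp hpι,
        hproj.self_of_nhds.apply_sharp _ hconormal, zero_add, add_zero]

lemma koszulForm_inducedContraction
    (hS : DifferentiableAt ℝ S (ι u)) (hskew : IsSkew (S (ι u))) (hp : DifferentiableAt ℝ p u)
    (hproj : ∀ᶠ x in 𝓝 u, IsCosymplecticProjection (S (ι x)) ι (p x))
    {α' β' : U → U →L[ℝ] ℝ} (hα' : DifferentiableAt ℝ α' u) (hβ' : DifferentiableAt ℝ β' u)
    {α β : V → V →L[ℝ] ℝ} (hα : DifferentiableAt ℝ α (ι u)) (hβ : DifferentiableAt ℝ β (ι u))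
    (hαα' : ∀ᶠ x in 𝓝 u, α (ι x) = (α' x).comp (p x))
    (hββ' : ∀ᶠ x in 𝓝 u, β (ι x) = (β' x).comp (p x)) (z : U) :
    koszulForm S α β (ι u) (ι z) = koszulForm (inducedContraction S ι p) α' β' u z := by
  have hsharp (η : U →L[ℝ] ℝ) : S (ι u) (η.comp (p u)) = ι (inducedContraction S ι p u η) :=
    hproj.self_of_nhds.sharp_comp hskew η
  have hrestrict {γ : V → V →L[ℝ] ℝ} {γ' : U → U →L[ℝ] ℝ}
      (h : ∀ᶠ x in 𝓝 u, γ (ι x) = (γ' x).comp (p x)) : ∀ᶠ x in 𝓝 u, (γ (ι x)).comp ι = γ' x := by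
    filter_upwards [h, hproj] with x hx hpx
    ext w
    simp [hx, hpx.apply_inclusion]
  rw [koszulForm_apply, koszulForm_apply, fderiv_inducedContraction_apply hS hskew hp hproj,
    hαα'.self_of_nhds, hββ'.self_of_nhds, hsharp, hsharp,
    fderiv_apply_inclusion_of_comp_eq hα hα' (hrestrict hαα'),
    fderiv_apply_inclusion_of_comp_eq hβ hβ' (hrestrict hββ')]
  rfl

end CosymplecticProjection

section SmoothFamilies

variable {X Y Z : Type*} [NormedAddCommGroup X] [NormedSpace ℝ X]
  [NormedAddCommGroup Y] [NormedSpace ℝ Y] [NormedAddCommGroup Z] [NormedSpace ℝ Z]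
  {W : Set Z}

lemma contDiffOn_inverse_apply [CompleteSpace X] {M : Z → X →L[ℝ] Y}
    (hM : ContDiffOn ℝ ∞ M W) (hinv : ∀ x ∈ W, ∃ e : X ≃L[ℝ] Y, (e : X →L[ℝ] Y) = M x) (y : Y) :
    ContDiffOn ℝ ∞ (fun x => (M x).inverse y) W := by
  intro x hx
  obtain ⟨e, he⟩ := hinv x hx
  have hinverse : ContDiffAt ℝ ∞ (ContinuousLinearMap.inverse : (X →L[ℝ] Y) → Y →L[ℝ] X) (M x) :=
    he ▸ contDiffAt_map_inverse e
  have hMinverse : ContDiffWithinAt ℝ ∞ (fun x => (M x).inverse) W x :=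
    hinverse.comp_contDiffWithinAt x (hM x hx)
  exact hMinverse.clm_apply contDiffWithinAt_const

section Projection

variable {V : Type*} [NormedAddCommGroup V] [NormedSpace ℝ V] [FiniteDimensional ℝ V]
  [FiniteDimensional ℝ X] {ι : X →L[ℝ] V} {ρ : V →L[ℝ] X}

instance conormalSpaceNormedAddCommGroup : NormedAddCommGroup (conormalSpace ι) :=
  Submodule.normedAddCommGroup _

instance conormalSpaceNormedSpace : NormedSpace ℝ (conormalSpace ι) :=
  Submodule.normedSpace _

/-- The sum map `(z, k) ↦ ι z + T k`, which is invertible if the image of `ι` is cosymplectic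
for `T`. -/
def conormalSum (T : (V →L[ℝ] ℝ) →L[ℝ] V) (ι : X →L[ℝ] V) : (X × conormalSpace ι) →L[ℝ] V :=
  ι.coprod (T.comp (conormalSpace ι).subtypeL)

lemma exists_equiv_eq_conormalSum {T : (V →L[ℝ] ℝ) →L[ℝ] V} (hρ : ∀ z, ρ (ι z) = z)
    (hspan : ι.range ⊔ (conormalSpace ι).map T.toLinearMap = ⊤) :
    ∃ e : (X × conormalSpace ι) ≃L[ℝ] V, (e : (X × conormalSpace ι) →L[ℝ] V) =
      conormalSum T ι := by
  have hdim : Module.finrank ℝ (X × conormalSpace ι) = Module.finrank ℝ V := by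
    rw [Module.finrank_prod, finrank_add_finrank_conormalSpace hρ]
  have hsurj : Function.Surjective (conormalSum T ι).toLinearMap := by
    intro v
    obtain ⟨_, ⟨z, rfl⟩, _, ⟨k, hk, rfl⟩, rfl⟩ :=
      Submodule.mem_sup.1 (hspan.ge (Submodule.mem_top (x := v)))
    exact ⟨(z, ⟨k, hk⟩), rfl⟩
  have hinj := (LinearMap.injective_iff_surjective_of_finrank_eq_finrank hdim).2 hsurj
  exact ⟨(LinearEquiv.ofBijective _ ⟨hinj, hsurj⟩).toContinuousLinearEquiv, by ext <;> rfl⟩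

lemma contDiffOn_cosymplecticProjection (hρ : ∀ z, ρ (ι z) = z)
    {T : Z → (V →L[ℝ] ℝ) →L[ℝ] V} (hT : ContDiffOn ℝ ∞ T W) {p : Z → V →L[ℝ] X}
    (hp : ∀ x ∈ W, IsCosymplecticProjection (T x) ι (p x))
    (hspan : ∀ x ∈ W, ι.range ⊔ (conormalSpace ι).map (T x).toLinearMap = ⊤) :
    ContDiffOn ℝ ∞ p W := by
  have : CompleteSpace X := FiniteDimensional.complete ℝ X
  have hinv x (hx : x ∈ W) := exists_equiv_eq_conormalSum hρ (hspan x hx)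
  have hsum : ContDiffOn ℝ ∞ (fun x => conormalSum (T x) ι) W := by
    refine contDiffOn_clm_apply.2 fun v => ?_
    exact contDiffOn_const.add (hT.clm_apply contDiffOn_const)
  refine contDiffOn_clm_apply.2 fun v => ?_
  refine (contDiffOn_inverse_apply hsum hinv v).fst.congr fun x hx => ?_
  obtain ⟨e, he⟩ := hinv x hx
  obtain ⟨⟨z, k⟩, rfl⟩ := e.surjective v
  have hzk : e (z, k) = ι z + T x k := congrArg (fun M => M (z, k)) he
  rw [← he, ContinuousLinearMap.inverse_equiv, ContinuousLinearEquiv.coe_coe,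
    ContinuousLinearEquiv.symm_apply_apply, hzk, map_add, (hp x hx).apply_inclusion,
    (hp x hx).apply_sharp k k.2, add_zero]

end Projection

section KernelFrame

variable [FiniteDimensional ℝ X]

lemma exists_equiv_range_prod_ker (B : X →L[ℝ] Y) :
    ∃ (r : Y →L[ℝ] B.range) (q : X →L[ℝ] B.ker) (e : X ≃L[ℝ] B.range × B.ker),
      (e : X →L[ℝ] B.range × B.ker) = (r.comp B).prod q := by
  obtain ⟨r, hr⟩ := Submodule.ClosedComplemented.of_finiteDimensional B.range
  obtain ⟨q, hq⟩ := Submodule.ClosedComplemented.of_finiteDimensional B.ker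
  have hinj : Function.Injective ((r.comp B).prod q).toLinearMap := by
    refine LinearMap.ker_eq_bot.1 (LinearMap.ker_eq_bot'.2 fun v hv => ?_)
    have hrBv : r (B v) = ⟨B v, v, rfl⟩ := hr ⟨B v, v, rfl⟩
    have hv_ker : v ∈ B.ker := congrArg Subtype.val (hrBv.symm.trans (congrArg Prod.fst hv))
    exact congrArg Subtype.val ((hq ⟨v, hv_ker⟩).symm.trans (congrArg Prod.snd hv))
  have hdim : Module.finrank ℝ X = Module.finrank ℝ (B.range × B.ker) := by
    rw [Module.finrank_prod]
    exact (LinearMap.finrank_range_add_finrank_ker B.toLinearMap).symm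
  exact ⟨r, q, (LinearEquiv.ofInjectiveOfFinrankEq _ hinj hdim).toContinuousLinearEquiv,
    by ext <;> rfl⟩

lemma linearIndependent_span_eq_ker {Y' K : Type*} [NormedAddCommGroup Y'] [NormedSpace ℝ Y']
    [NormedAddCommGroup K] [NormedSpace ℝ K] {B : X →L[ℝ] Y} {r : Y →L[ℝ] Y'} {q : X →L[ℝ] K}
    {e : X ≃L[ℝ] Y' × K} (he : (e : X →L[ℝ] Y' × K) = (r.comp B).prod q) {k : ℕ}
    (b : Module.Basis (Fin k) ℝ K) (hk : Module.finrank ℝ B.ker = k) :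
    LinearIndependent ℝ (fun i => e.symm (0, b i)) ∧
      Submodule.span ℝ (Set.range fun i => e.symm (0, b i)) = B.ker := by
  have hli : LinearIndependent ℝ fun i => e.symm (0, b i) :=
    b.linearIndependent.map' (e.symm.toLinearEquiv.toLinearMap ∘ₗ LinearMap.inr ℝ Y' K)
      (LinearMap.ker_eq_bot.2 (e.symm.injective.comp LinearMap.inr_injective))
  refine ⟨hli, (Submodule.eq_of_le_of_finrank_eq (fun v hv => ?_) ?_).symm⟩
  · have hev : e v = (0, q v) := by
      rw [← ContinuousLinearEquiv.coe_coe, he]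
      exact Prod.ext ((congrArg r hv).trans (map_zero r)) rfl
    have hv_sum : v = ∑ i, b.repr (q v) i • e.symm (0, b i) := by
      refine e.injective ?_
      simp only [hev, map_sum, map_smul, ContinuousLinearEquiv.apply_symm_apply, Prod.smul_mk,
        smul_zero]
      exact Prod.ext (by simp [Prod.fst_sum]) (by simp [Prod.snd_sum, b.sum_repr])
    rw [hv_sum]
    exact Submodule.sum_mem _ fun i _ => Submodule.smul_mem _ _ (Submodule.subset_span ⟨i, rfl⟩)
  · rw [hk]
    exact ((finrank_span_eq_card hli).trans (Fintype.card_fin k)).symm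

lemma exists_smooth_frame_ker (hW : IsOpen W) {B : Z → X →L[ℝ] Y} (hB : ContDiffOn ℝ ∞ B W)
    {k : ℕ} (hk : ∀ x ∈ W, Module.finrank ℝ (B x).ker = k) {z : Z} (hz : z ∈ W) :
    ∃ W' ⊆ W, IsOpen W' ∧ z ∈ W' ∧ ∃ s : Fin k → Z → X, (∀ i, ContDiffOn ℝ ∞ (s i) W') ∧
      ∀ x ∈ W', LinearIndependent ℝ (fun i => s i x) ∧
        Submodule.span ℝ (Set.range fun i => s i x) = (B x).ker := by
  have : CompleteSpace X := FiniteDimensional.complete ℝ X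
  obtain ⟨r, q, e₀, he₀⟩ := exists_equiv_range_prod_ker (B z)
  let M : Z → X →L[ℝ] (B z).range × (B z).ker := fun x => (r.comp (B x)).prod q
  have hM : ContDiffOn ℝ ∞ M W := contDiffOn_clm_apply.2 fun v =>
    ((contDiffOn_const.clm_comp hB).clm_apply contDiffOn_const).prodMk contDiffOn_const
  let W' := W ∩ M ⁻¹' Set.range ((↑) : (X ≃L[ℝ] (B z).range × (B z).ker) → _)
  have hW'W : W' ⊆ W := Set.inter_subset_left
  let b : Module.Basis (Fin k) ℝ (B z).ker := Module.finBasisOfFinrankEq ℝ _ (hk z hz)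
  refine ⟨W', hW'W, hM.continuousOn.isOpen_inter_preimage hW ContinuousLinearEquiv.isOpen,
    ⟨hz, e₀, he₀⟩, fun i x => (M x).inverse (0, b i),
    fun i => contDiffOn_inverse_apply (hM.mono hW'W) (fun x hx => hx.2) (0, b i), ?_⟩
  rintro x ⟨hxW, e, he⟩
  simpa only [← he, ContinuousLinearMap.inverse_equiv, ContinuousLinearEquiv.coe_coe] using
    linearIndependent_span_eq_ker he b (hk x hxW)

end KernelFrame

end SmoothFamilies

section Charts

variable {E : Type*} [NormedAddCommGroup E] [NormedSpace ℝ E]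
  {P : Type*} [TopologicalSpace P] [ChartedSpace E P]

/-- A covector `ξ` at a point, read in the dual of the model space, to which `Cot E x` is
definitionally equal. -/
def covectorToModel {x : P} (ξ : Cot E x) : E →L[ℝ] ℝ := ξ

/-- A contraction map `T*_xP → T_xP`, read on the model space. -/
def contractionToModel {x : P} (T : Cot E x →L[ℝ] Tan E x) : (E →L[ℝ] ℝ) →L[ℝ] E := T

/-- The differential of a chart `e` at `x`, read on the model space. -/
def chartDeriv (e : OpenPartialHomeomorph P E) (x : P) : E →L[ℝ] E :=
  mfderiv 𝓘(ℝ, E) 𝓘(ℝ, E) e x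

/-- The differential at `y` of the inverse of a chart `e`, read on the model space. -/
def chartDerivSymm (e : OpenPartialHomeomorph P E) (y : E) : E →L[ℝ] E :=
  mfderiv 𝓘(ℝ, E) 𝓘(ℝ, E) e.symm y

/-- The covector `ξ` at `x` expressed in the chart `e`, that is, pulled back along `e⁻¹`. -/
def covectorInChart (e : OpenPartialHomeomorph P E) {x : P} (ξ : Cot E x) : E →L[ℝ] ℝ :=
  (covectorToModel ξ).comp (chartDerivSymm e (e x))

/-- The covector at `x` whose expression in the chart `e` is `a`, that is, the pullback of `a`
along `e`. -/
def covectorOfChart (e : OpenPartialHomeomorph P E) (x : P) (a : E →L[ℝ] ℝ) : Cot E x :=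
  show E →L[ℝ] ℝ from a.comp (chartDeriv e x)

section Differential

variable {e : OpenPartialHomeomorph P E}

lemma mdifferentiable_of_mem_maximalAtlas (he : e ∈ IsManifold.maximalAtlas 𝓘(ℝ, E) ∞ P) :
    e.MDifferentiable 𝓘(ℝ, E) 𝓘(ℝ, E) :=
  ⟨(contMDiffOn_of_mem_maximalAtlas he).mdifferentiableOn (by simp),
    (contMDiffOn_symm_of_mem_maximalAtlas he).mdifferentiableOn (by simp)⟩

lemma chartDerivSymm_chartDeriv (he : e ∈ IsManifold.maximalAtlas 𝓘(ℝ, E) ∞ P) {x : P}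
    (hx : x ∈ e.source) (v : E) : chartDerivSymm e (e x) (chartDeriv e x v) = v :=
  congrArg (fun T : TangentSpace 𝓘(ℝ, E) x →L[ℝ] TangentSpace 𝓘(ℝ, E) x => T v)
    ((mdifferentiable_of_mem_maximalAtlas he).symm_comp_deriv hx)

lemma chartDeriv_symm_chartDerivSymm (he : e ∈ IsManifold.maximalAtlas 𝓘(ℝ, E) ∞ P) {y : E}
    (hy : y ∈ e.target) (v : E) : chartDeriv e (e.symm y) (chartDerivSymm e y v) = v :=
  congrArg (fun T : TangentSpace 𝓘(ℝ, E) y →L[ℝ] TangentSpace 𝓘(ℝ, E) y => T v)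
    ((mdifferentiable_of_mem_maximalAtlas he).comp_symm_deriv hy)

lemma chartDeriv_chartDerivSymm (he : e ∈ IsManifold.maximalAtlas 𝓘(ℝ, E) ∞ P) {x : P}
    (hx : x ∈ e.source) (v : E) : chartDeriv e x (chartDerivSymm e (e x) v) = v := by
  simpa only [e.left_inv hx] using chartDeriv_symm_chartDerivSymm he (e.map_source hx) v

lemma covectorInChart_chartDeriv (he : e ∈ IsManifold.maximalAtlas 𝓘(ℝ, E) ∞ P) {x : P}
    (hx : x ∈ e.source) (ξ : Cot E x) (v : Tan E x) :
    covectorInChart e ξ (chartDeriv e x v) = ξ v :=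
  congrArg (covectorToModel ξ) (chartDerivSymm_chartDeriv he hx v)

lemma covectorInChart_covectorOfChart (he : e ∈ IsManifold.maximalAtlas 𝓘(ℝ, E) ∞ P) {x : P}
    (hx : x ∈ e.source) (a : E →L[ℝ] ℝ) : covectorInChart e (covectorOfChart e x a) = a := by
  ext v
  exact congrArg a (chartDeriv_chartDerivSymm he hx v)

lemma covectorOfChart_covectorInChart (he : e ∈ IsManifold.maximalAtlas 𝓘(ℝ, E) ∞ P) {x : P}
    (hx : x ∈ e.source) (ξ : Cot E x) : covectorOfChart e x (covectorInChart e ξ) = ξ := by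
  ext v
  exact covectorInChart_chartDeriv he hx ξ v

lemma covectorInChart_injective (he : e ∈ IsManifold.maximalAtlas 𝓘(ℝ, E) ∞ P) {x : P}
    (hx : x ∈ e.source) : Function.Injective (covectorInChart e (x := x)) :=
  Function.LeftInverse.injective (covectorOfChart_covectorInChart he hx)

lemma covectorInChart_add {x : P} (ξ η : Cot E x) :
    covectorInChart e (ξ + η) = covectorInChart e ξ + covectorInChart e η :=
  rfl

lemma covectorInChart_neg {x : P} (ξ : Cot E x) :
    covectorInChart e (-ξ) = -covectorInChart e ξ :=
  rfl

lemma covectorInChart_smul {x : P} (a : ℝ) (ξ : Cot E x) :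
    covectorInChart e (a • ξ) = a • covectorInChart e ξ :=
  rfl

end Differential

section SectionsAlongMaps

variable {F : Type*} [NormedAddCommGroup F] [NormedSpace ℝ F]
  {C : Type*} [TopologicalSpace C] [ChartedSpace F C]

lemma contMDiffOn_clm_of_apply {W : Type*} [NormedAddCommGroup W] [NormedSpace ℝ W]
    {H : Type*} [NormedAddCommGroup H] [NormedSpace ℝ H] [FiniteDimensional ℝ H]
    {A : C → H →L[ℝ] W} {U : Set C}
    (hA : ∀ v, ContMDiffOn 𝓘(ℝ, F) 𝓘(ℝ, W) ∞ (fun c => A c v) U) :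
    ContMDiffOn 𝓘(ℝ, F) 𝓘(ℝ, H →L[ℝ] W) ∞ A U := by
  let coords : H ≃L[ℝ] (Fin (Module.finrank ℝ H) → ℝ) :=
    ContinuousLinearEquiv.ofFinrankEq (Module.finrank_fin_fun ℝ).symm
  let values : (H →L[ℝ] W) ≃L[ℝ] (Fin (Module.finrank ℝ H) → W) :=
    (coords.arrowCongr (1 : W ≃L[ℝ] W)).trans (ContinuousLinearEquiv.piRing _)
  have hvalues : ContMDiffOn 𝓘(ℝ, F) 𝓘(ℝ, Fin (Module.finrank ℝ H) → W) ∞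
      (fun c => values (A c)) U := contMDiffOn_pi_space.2 fun i => hA _
  refine (values.symm.contDiff.contMDiff.comp_contMDiffOn hvalues).congr fun c _ => ?_
  exact (values.symm_apply_apply (A c)).symm

variable [IsManifold 𝓘(ℝ, E) ∞ P]

variable (F) in
/-- Smoothness on `U` of a vector field along `f : C → P`, the analogue for vectors of
`SmoothAlongOn`. -/
def SmoothFieldAlongOn (f : C → P) (X : ∀ c, Tan E (f c)) (U : Set C) : Prop :=
  ContMDiffOn 𝓘(ℝ, F) (𝓘(ℝ, E).prod 𝓘(ℝ, E)) ∞
    (fun c => (⟨f c, X c⟩ : TangentBundle 𝓘(ℝ, E) P)) U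

variable {e : OpenPartialHomeomorph P E} {f : C → P} {X : ∀ c, Tan E (f c)}
  {σ : ∀ c, Cot E (f c)} {U : Set C}

lemma SmoothFieldAlongOn.tangentMap {H : Type*} [NormedAddCommGroup H] [NormedSpace ℝ H]
    {Q : Type*} [TopologicalSpace Q] [ChartedSpace H Q] [IsManifold 𝓘(ℝ, H) ∞ Q]
    {r : P → Q} {O : Set P} (hO : IsOpen O)
    (hr : ContMDiffOn 𝓘(ℝ, E) 𝓘(ℝ, H) ∞ r O) (hX : SmoothFieldAlongOn F f X U)
    (hfU : Set.MapsTo f U O) :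
    SmoothFieldAlongOn F (fun c => r (f c))
      (fun c => mfderiv 𝓘(ℝ, E) 𝓘(ℝ, H) r (f c) (X c)) U := by
  have htangentMap := hr.contMDiffOn_tangentMapWithin (m := ∞) le_rfl hO.uniqueMDiffOn
  refine (ContMDiffOn.comp htangentMap hX fun c hc => hfU hc).congr fun c hc => ?_
  simp only [Function.comp, tangentMapWithin]
  rw [mfderivWithin_of_isOpen hO (hfU hc)]

lemma SmoothFieldAlongOn.contMDiffOn_base (hX : SmoothFieldAlongOn F f X U) :
    ContMDiffOn 𝓘(ℝ, F) 𝓘(ℝ, E) ∞ f U :=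
  (Bundle.contMDiff_proj (IB := 𝓘(ℝ, E)) (F := E)
    (TangentSpace 𝓘(ℝ, E) : P → Type _)).comp_contMDiffOn hX

lemma smoothFieldAlongOn_vectorSpace {f X : C → E} :
    SmoothFieldAlongOn (P := E) (E := E) F f X U ↔
      ContMDiffOn 𝓘(ℝ, F) 𝓘(ℝ, E) ∞ f U ∧ ContMDiffOn 𝓘(ℝ, F) 𝓘(ℝ, E) ∞ X U := by
  constructor
  · intro h
    exact ⟨h.contMDiffOn_base,
      (contMDiff_snd_tangentBundle_modelSpace E 𝓘(ℝ, E)).comp_contMDiffOn h⟩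
  · rintro ⟨hf, hX⟩ c hc
    refine Bundle.contMDiffWithinAt_totalSpace.2 ⟨hf c hc, ?_⟩
    convert! hX c hc with y
    simp

lemma smoothFieldAlongOn_iff (he : e ∈ IsManifold.maximalAtlas 𝓘(ℝ, E) ∞ P)
    (hf : ContMDiffOn 𝓘(ℝ, F) 𝓘(ℝ, E) ∞ f U) (hfU : Set.MapsTo f U e.source) :
    SmoothFieldAlongOn F f X U ↔
      ContMDiffOn 𝓘(ℝ, F) 𝓘(ℝ, E) ∞ (fun c => chartDeriv e (f c) (X c)) U := by
  constructor
  · intro h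
    exact (smoothFieldAlongOn_vectorSpace.1
      (h.tangentMap e.open_source (contMDiffOn_of_mem_maximalAtlas he) hfU)).2
  · intro h
    have hchart : SmoothFieldAlongOn (P := E) (E := E) F (fun c => e (f c))
        (fun c => chartDeriv e (f c) (X c)) U :=
      smoothFieldAlongOn_vectorSpace.2 ⟨(contMDiffOn_of_mem_maximalAtlas he).comp hf hfU, h⟩
    have hback := hchart.tangentMap e.open_target (contMDiffOn_symm_of_mem_maximalAtlas he)
      (fun c hc => e.map_source (hfU hc))
    refine ContMDiffOn.congr hback fun c hc => ?_
    rw [Bundle.TotalSpace.mk.injEq]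
    exact ⟨(e.left_inv (hfU hc)).symm,
      heq_of_eq (chartDerivSymm_chartDeriv he (hfU hc) (X c)).symm⟩

lemma SmoothAlongOn.apply (hσ : SmoothAlongOn F f σ U) (hX : SmoothFieldAlongOn F f X U) :
    ContMDiffOn 𝓘(ℝ, F) 𝓘(ℝ, ℝ) ∞ (fun c => σ c (X c)) U := fun c hc =>
  (Bundle.contMDiffWithinAt_totalSpace.1 (ContMDiffOn.clm_bundle_apply
    (E₁ := fun x : P => TangentSpace 𝓘(ℝ, E) x) (E₂ := Bundle.Trivial P ℝ) hσ hX c hc)).2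

lemma SmoothAlongOn.contMDiffOn_base (hσ : SmoothAlongOn F f σ U) :
    ContMDiffOn 𝓘(ℝ, F) 𝓘(ℝ, E) ∞ f U := fun c hc =>
  (Bundle.contMDiffWithinAt_totalSpace.1 (hσ c hc)).1

lemma SmoothAlongOn.mono {V : Set C} (hσ : SmoothAlongOn F f σ U) (hVU : V ⊆ U) :
    SmoothAlongOn F f σ V :=
  ContMDiffOn.mono hσ hVU

lemma smoothFieldOn_trivialization_symmL (x₀ : P) (v : E) :
    SmoothFieldOn
      (fun x : P => (trivializationAt E (TangentSpace 𝓘(ℝ, E) : P → Type _) x₀).symmL ℝ x v)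
      (trivializationAt E (TangentSpace 𝓘(ℝ, E) : P → Type _) x₀).baseSet := by
  let t := trivializationAt E (TangentSpace 𝓘(ℝ, E) : P → Type _) x₀
  refine (t.contMDiffOn_iff fun x hx => t.mem_source.2 hx).2 ⟨contMDiffOn_id, ?_⟩
  refine (contMDiffOn_const (c := v)).congr fun x (hx : x ∈ t.baseSet) => ?_
  change (t ⟨x, t.symmL ℝ x v⟩).2 = v
  rw [t.symmL_apply hx, t.apply_mk_symm hx]

lemma smoothAlongOn_of_apply [FiniteDimensional ℝ E] (hf : ContMDiffOn 𝓘(ℝ, F) 𝓘(ℝ, E) ∞ f U)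
    (hσ : ∀ V ⊆ U, ∀ X : ∀ c, Tan E (f c), SmoothFieldAlongOn F f X V →
      ContMDiffOn 𝓘(ℝ, F) 𝓘(ℝ, ℝ) ∞ (fun c => σ c (X c)) V) :
    SmoothAlongOn F f σ U := by
  intro c₀ hc₀
  rw [contMDiffWithinAt_hom_bundle]
  refine ⟨hf c₀ hc₀, ?_⟩
  let t := trivializationAt E (TangentSpace 𝓘(ℝ, E) : P → Type _) (f c₀)
  have hc₀t : f c₀ ∈ t.baseSet := FiberBundle.mem_baseSet_trivializationAt' (f c₀)
  have hcoordinates : ContMDiffOn 𝓘(ℝ, F) 𝓘(ℝ, E →L[ℝ] ℝ) ∞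
      (fun c => ContinuousLinearMap.inCoordinates E (TangentSpace 𝓘(ℝ, E) : P → Type _) ℝ
        (Bundle.Trivial P ℝ) (f c₀) (f c) (f c₀) (f c) (σ c)) (U ∩ f ⁻¹' t.baseSet) := by
    refine contMDiffOn_clm_of_apply fun v => ?_
    have hv : SmoothFieldAlongOn F f (fun c => t.symmL ℝ (f c) v) (U ∩ f ⁻¹' t.baseSet) :=
      ContMDiffOn.comp (smoothFieldOn_trivialization_symmL (f c₀) v)
        (hf.mono Set.inter_subset_left) fun c hc => hc.2
    refine (hσ _ Set.inter_subset_left _ hv).congr fun c _ => ?_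
    exact congrArg (fun T : ℝ →L[ℝ] ℝ => T (σ c (t.symmL ℝ (f c) v)))
      (Bundle.Trivial.continuousLinearMapAt_trivialization ℝ P ℝ (f c))
  have ht : f ⁻¹' t.baseSet ∈ 𝓝[U] c₀ :=
    (hf c₀ hc₀).continuousWithinAt (t.open_baseSet.mem_nhds hc₀t)
  exact (hcoordinates c₀ ⟨hc₀, hc₀t⟩).mono_of_mem_nhdsWithin
    (Filter.inter_mem self_mem_nhdsWithin ht)

lemma smoothAlongOn_iff [FiniteDimensional ℝ E] (he : e ∈ IsManifold.maximalAtlas 𝓘(ℝ, E) ∞ P)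
    (hf : ContMDiffOn 𝓘(ℝ, F) 𝓘(ℝ, E) ∞ f U) (hfU : Set.MapsTo f U e.source) :
    SmoothAlongOn F f σ U ↔
      ContMDiffOn 𝓘(ℝ, F) 𝓘(ℝ, E →L[ℝ] ℝ) ∞ (fun c => covectorInChart e (σ c)) U := by
  constructor
  · intro h
    refine contMDiffOn_clm_of_apply fun v => h.apply ((smoothFieldAlongOn_iff he hf hfU).2 ?_)
    exact (contMDiffOn_const (c := v)).congr fun c hc => chartDeriv_chartDerivSymm he (hfU hc) v
  · intro h
    refine smoothAlongOn_of_apply hf fun V hV X hX => ?_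
    have hXchart := (smoothFieldAlongOn_iff he (hf.mono hV) (hfU.mono_left hV)).1 hX
    refine ((h.mono hV).clm_apply hXchart).congr fun c hc => ?_
    exact (congrArg (covectorToModel (σ c))
      (chartDerivSymm_chartDeriv he (hfU (hV hc)) (X c))).symm

/-- Smoothness of a contraction map `sharp : T*P → TP`, as a section of the bundle of
homomorphisms. -/
def SmoothContraction (sharp : ∀ x : P, Cot E x →L[ℝ] Tan E x) : Prop :=
  ContMDiff 𝓘(ℝ, E) (𝓘(ℝ, E).prod 𝓘(ℝ, (E →L[ℝ] ℝ) →L[ℝ] E)) ∞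
    (fun x => Bundle.TotalSpace.mk' ((E →L[ℝ] ℝ) →L[ℝ] E)
      (E := fun x : P => Cot E x →L[ℝ] Tan E x) x (sharp x))

lemma SmoothAlongOn.sharp {sharp : ∀ x : P, Cot E x →L[ℝ] Tan E x}
    (hσ : SmoothAlongOn F f σ U) (hs : SmoothContraction sharp) :
    SmoothFieldAlongOn F f (fun c => sharp (f c) (σ c)) U :=
  ContMDiffOn.clm_bundle_apply (E₁ := fun x : P => Cot E x)
    (E₂ := fun x : P => TangentSpace 𝓘(ℝ, E) x) (hs.comp_contMDiffOn hσ.contMDiffOn_base) hσ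

end SectionsAlongMaps

section ChartExpressions

/-- The expression of a one-form in the chart `e`. (Junk outside `e.target`.) -/
def formInChart (e : OpenPartialHomeomorph P E) (α : ∀ x : P, Cot E x) (y : E) : E →L[ℝ] ℝ :=
  (covectorToModel (α (e.symm y))).comp (chartDerivSymm e y)

/-- The expression of a vector field in the chart `e`. (Junk outside `e.target`.) -/
def fieldInChart (e : OpenPartialHomeomorph P E) (Z : ∀ x : P, Tan E x) (y : E) : E :=
  chartDeriv e (e.symm y) (Z (e.symm y))

/-- The expression of a contraction map in the chart `e`. (Junk outside `e.target`.) -/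
def contractionInChart (e : OpenPartialHomeomorph P E) (sharp : ∀ x : P, Cot E x →L[ℝ] Tan E x)
    (y : E) : (E →L[ℝ] ℝ) →L[ℝ] E :=
  (chartDeriv e (e.symm y)).comp ((contractionToModel (sharp (e.symm y))).comp
    (ContinuousLinearMap.precomp ℝ (chartDeriv e (e.symm y))))

variable {e : OpenPartialHomeomorph P E} {sharp : ∀ x : P, Cot E x →L[ℝ] Tan E x}

lemma formInChart_apply {x : P} (hx : x ∈ e.source) (α : ∀ x : P, Cot E x) :
    formInChart e α (e x) = covectorInChart e (α x) := by
  rw [formInChart, covectorInChart, e.left_inv hx]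

lemma fieldInChart_apply {x : P} (hx : x ∈ e.source) (Z : ∀ x : P, Tan E x) :
    fieldInChart e Z (e x) = chartDeriv e x (Z x) := by
  rw [fieldInChart, e.left_inv hx]

lemma contractionInChart_apply {x : P} (hx : x ∈ e.source)
    (sharp : ∀ x : P, Cot E x →L[ℝ] Tan E x) (a : E →L[ℝ] ℝ) :
    contractionInChart e sharp (e x) a =
      chartDeriv e x (sharp x (covectorOfChart e x a)) := by
  rw [contractionInChart, e.left_inv hx]
  rfl

lemma isSkew_contractionInChart
    (hskew : ∀ (x : P) (α β : Cot E x), β (sharp x α) = -α (sharp x β)) (y : E) :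
    IsSkew (contractionInChart e sharp y) := fun a b =>
  hskew (e.symm y) (covectorOfChart e _ a) (covectorOfChart e _ b)

variable (he : e ∈ IsManifold.maximalAtlas 𝓘(ℝ, E) ∞ P)
include he

lemma contractionInChart_covectorInChart {x : P} (hx : x ∈ e.source)
    (sharp : ∀ x : P, Cot E x →L[ℝ] Tan E x) (ξ : Cot E x) :
    contractionInChart e sharp (e x) (covectorInChart e ξ) = chartDeriv e x (sharp x ξ) := by
  rw [contractionInChart_apply hx, covectorOfChart_covectorInChart he hx]

lemma contDiffOn_comp_chart_symm {W : Type*} [NormedAddCommGroup W] [NormedSpace ℝ W]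
    {A : P → W} {U : Set P} (hA : ContMDiffOn 𝓘(ℝ, E) 𝓘(ℝ, W) ∞ A U) :
    ContDiffOn ℝ ∞ (fun y => A (e.symm y)) (e.target ∩ e.symm ⁻¹' U) :=
  contMDiffOn_iff_contDiffOn.1 (hA.comp
    ((contMDiffOn_symm_of_mem_maximalAtlas he).mono Set.inter_subset_left) fun _ hy => hy.2)

variable [IsManifold 𝓘(ℝ, E) ∞ P]

lemma contDiffOn_fieldInChart {Z : ∀ x : P, Tan E x} {U : Set P} (hZ : SmoothFieldOn Z U) :
    ContDiffOn ℝ ∞ (fieldInChart e Z) (e.target ∩ e.symm ⁻¹' U) := by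
  have hZ' : SmoothFieldAlongOn E (fun x => x) Z (e.source ∩ U) := hZ.mono Set.inter_subset_right
  have hchart := (smoothFieldAlongOn_iff he contMDiffOn_id fun x hx => hx.1).1 hZ'
  exact (contDiffOn_comp_chart_symm he hchart).mono fun y hy => ⟨hy.1, e.map_target hy.1, hy.2⟩

lemma smoothFieldOn_chartDerivSymm (v : E) :
    SmoothFieldOn (fun x : P => (chartDerivSymm e (e x) v : E)) e.source := by
  refine (smoothFieldAlongOn_iff (f := fun x => x) he contMDiffOn_id fun x hx => hx).2 ?_
  exact (contMDiffOn_const (c := v)).congr fun x hx => chartDeriv_chartDerivSymm he hx v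

variable [FiniteDimensional ℝ E]

lemma contDiffOn_formInChart {α : ∀ x : P, Cot E x} {U : Set P} (hα : SmoothFormOn α U) :
    ContDiffOn ℝ ∞ (formInChart e α) (e.target ∩ e.symm ⁻¹' U) := by
  have hα' : SmoothAlongOn E (fun x => x) α (e.source ∩ U) := hα.mono Set.inter_subset_right
  have hchart := (smoothAlongOn_iff he contMDiffOn_id fun x hx => hx.1).1 hα'
  refine ((contDiffOn_comp_chart_symm he hchart).mono
    fun y hy => ⟨hy.1, e.map_target hy.1, hy.2⟩).congr fun y hy => ?_
  rw [← formInChart_apply (e.map_target hy.1), e.right_inv hy.1]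

lemma smoothFormOn_of_contDiffOn {A : E → E →L[ℝ] ℝ} {W : Set E} (hA : ContDiffOn ℝ ∞ A W) :
    SmoothFormOn (fun x : P => covectorOfChart e x (A (e x))) (e.source ∩ e ⁻¹' W) := by
  refine (smoothAlongOn_iff (f := fun x => x) he contMDiffOn_id fun x hx => hx.1).2 ?_
  refine (hA.contMDiffOn.comp
    ((contMDiffOn_of_mem_maximalAtlas he).mono Set.inter_subset_left) fun x hx => hx.2).congr
    fun x hx => covectorInChart_covectorOfChart he hx.1 (A (e x))

lemma contDiffOn_contractionInChart (hs : SmoothContraction sharp) :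
    ContDiffOn ℝ ∞ (contractionInChart e sharp) e.target := by
  refine contDiffOn_clm_apply.2 fun a => ?_
  have ha : SmoothAlongOn E (fun x => x)
      (fun x : P => covectorOfChart e x a) e.source :=
    (smoothFormOn_of_contDiffOn (W := Set.univ) he (contDiffOn_const (c := a))).mono
      fun x hx => ⟨hx, Set.mem_univ _⟩
  have hsharp : SmoothFieldOn _ e.source := ha.sharp hs
  exact (contDiffOn_fieldInChart he hsharp).mono fun y hy => ⟨hy, e.map_target hy⟩

end ChartExpressions

end Charts

section KoszulInChart

variable {E : Type*} [NormedAddCommGroup E] [NormedSpace ℝ E]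
  {P : Type*} [TopologicalSpace P] [ChartedSpace E P]
  {e : OpenPartialHomeomorph P E} (he : e ∈ IsManifold.maximalAtlas 𝓘(ℝ, E) ∞ P) {x : P}
  {sharp : ∀ x : P, Cot E x →L[ℝ] Tan E x} {α β : ∀ x : P, Cot E x} {X Z : ∀ x : P, Tan E x}
  {U : Set P}
include he

section Pointwise

lemma dfun_eq_fderiv (hx : x ∈ e.source) {h : P → ℝ}
    (hh : MDifferentiableAt 𝓘(ℝ, E) 𝓘(ℝ, ℝ) h x) (v : Tan E x) :
    dfun (E := E) h x v = fderiv ℝ (fun y => h (e.symm y)) (e x) (chartDeriv e x v) := by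
  have hsymm : MDifferentiableAt 𝓘(ℝ, E) 𝓘(ℝ, E) e.symm (e x) :=
    (mdifferentiable_of_mem_maximalAtlas he).mdifferentiableAt_symm (e.map_source hx)
  have hchain := mfderiv_comp_of_eq (I'' := 𝓘(ℝ, ℝ)) hh hsymm (e.left_inv hx)
  rw [mfderiv_eq_fderiv] at hchain
  have hbase : ∀ x' : P, x' = x → (mfderiv 𝓘(ℝ, E) 𝓘(ℝ, ℝ) h x' : E → ℝ)
      (chartDerivSymm e (e x) (chartDeriv e x v)) = covectorToModel (dfun (E := E) h x) v := by
    rintro _ rfl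
    exact congrArg (covectorToModel (dfun (E := E) h _)) (chartDerivSymm_chartDeriv he hx v)
  exact (hbase _ (e.left_inv hx)).symm.trans
    (congrArg (fun T : E →L[ℝ] ℝ => T (chartDeriv e x v)) hchain).symm

lemma formInChart_fieldInChart {y : E} (hy : y ∈ e.target) (β : ∀ x : P, Cot E x)
    (Z : ∀ x : P, Tan E x) :
    formInChart e β y (fieldInChart e Z y) = β (e.symm y) (Z (e.symm y)) := by
  rw [← covectorInChart_chartDeriv he (e.map_target hy), ← formInChart_apply (e.map_target hy),
    e.right_inv hy]
  rfl

lemma fieldInChart_sharp {y : E} (hy : y ∈ e.target) (sharp : ∀ x : P, Cot E x →L[ℝ] Tan E x)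
    (α : ∀ x : P, Cot E x) :
    fieldInChart e (fun x => sharp x (α x)) y =
      contractionInChart e sharp y (formInChart e α y) := by
  rw [← e.right_inv hy, fieldInChart_apply (e.map_target hy),
    formInChart_apply (e.map_target hy), contractionInChart_covectorInChart he (e.map_target hy)]

lemma fieldInChart_sharp_eventuallyEq (hx : x ∈ e.source)
    (sharp : ∀ x : P, Cot E x →L[ℝ] Tan E x) (α : ∀ x : P, Cot E x) :
    fieldInChart e (fun x => sharp x (α x)) =ᶠ[𝓝 (e x)]
      fun y => contractionInChart e sharp y (formInChart e α y) := by
  filter_upwards [e.open_target.mem_nhds (e.map_source hx)] with y hy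
    using fieldInChart_sharp he hy sharp α

lemma mpullback_symm_eq_fieldInChart (X : ∀ x : P, Tan E x) {y : E} (hy : y ∈ e.target) :
    VectorField.mpullback 𝓘(ℝ, E) 𝓘(ℝ, E) e.symm X y = fieldInChart e X y := by
  have hinverse : (mfderiv 𝓘(ℝ, E) 𝓘(ℝ, E) e.symm y).inverse =
      mfderiv 𝓘(ℝ, E) 𝓘(ℝ, E) e (e.symm y) := by
    refine ContinuousLinearMap.inverse_eq ?_ ?_
    · have h := (mdifferentiable_of_mem_maximalAtlas he).symm_comp_deriv (e.map_target hy)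
      rwa [e.right_inv hy] at h
    · exact (mdifferentiable_of_mem_maximalAtlas he).comp_symm_deriv hy
  rw [VectorField.mpullback_apply, hinverse]
  rfl

end Pointwise

section Brackets

variable [IsManifold 𝓘(ℝ, E) ∞ P] (hx : x ∈ e.source) (hU : IsOpen U) (hxU : x ∈ U)
include hx hU hxU

lemma dfun_pairing_eq_fderiv (hβ : SmoothFormOn β U) (hZ : SmoothFieldOn Z U) (v : Tan E x) :
    dfun (E := E) (fun y => β y (Z y)) x v =
      fderiv ℝ (fun y => formInChart e β y (fieldInChart e Z y)) (e x) (chartDeriv e x v) := by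
  have hsmooth : ContMDiffOn 𝓘(ℝ, E) 𝓘(ℝ, ℝ) ∞ (fun y => β y (Z y)) U :=
    SmoothAlongOn.apply (f := fun x => x) hβ hZ
  have hpairing : (fun y => formInChart e β y (fieldInChart e Z y)) =ᶠ[𝓝 (e x)]
      fun y => β (e.symm y) (Z (e.symm y)) := by
    filter_upwards [e.open_target.mem_nhds (e.map_source hx)] with y hy
      using formInChart_fieldInChart he hy β Z
  rw [hpairing.fderiv_eq]
  exact dfun_eq_fderiv he hx
    ((hsmooth.contMDiffAt (hU.mem_nhds hxU)).mdifferentiableAt (by simp)) v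

lemma differentiableAt_fieldInChart (hZ : SmoothFieldOn Z U) :
    DifferentiableAt ℝ (fieldInChart e Z) (e x) :=
  ((contDiffOn_fieldInChart he hZ).contDiffAt ((e.isOpen_inter_preimage_symm hU).mem_nhds
    ⟨e.map_source hx, by rwa [Set.mem_preimage, e.left_inv hx]⟩)).differentiableAt (by simp)

variable [FiniteDimensional ℝ E]

lemma differentiableAt_formInChart (hβ : SmoothFormOn β U) :
    DifferentiableAt ℝ (formInChart e β) (e x) :=
  ((contDiffOn_formInChart he hβ).contDiffAt ((e.isOpen_inter_preimage_symm hU).mem_nhds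
    ⟨e.map_source hx, by rwa [Set.mem_preimage, e.left_inv hx]⟩)).differentiableAt (by simp)

lemma chartDeriv_mlieBracket (hX : SmoothFieldOn X U) (hZ : SmoothFieldOn Z U) :
    chartDeriv e x (VectorField.mlieBracket 𝓘(ℝ, E) X Z x) =
      VectorField.lieBracket ℝ (fieldInChart e X) (fieldInChart e Z) (e x) := by
  have : CompleteSpace E := FiniteDimensional.complete ℝ E
  have hminSmoothness : ∀ n : ℕ, minSmoothness ℝ n ≤ ∞ := fun n => by
    rw [minSmoothness_of_isRCLikeNormedField]
    exact WithTop.coe_le_coe.2 le_top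
  have : IsManifold 𝓘(ℝ, E) (minSmoothness ℝ 3) P := IsManifold.of_le (hminSmoothness 3)
  have hdiff : ∀ {Y : ∀ x : P, Tan E x}, SmoothFieldOn Y U →
      MDifferentiableAt 𝓘(ℝ, E) (𝓘(ℝ, E).prod 𝓘(ℝ, E))
        (fun x => (⟨x, Y x⟩ : TangentBundle 𝓘(ℝ, E) P)) (e.symm (e x)) := fun hY => by
    rw [e.left_inv hx]
    exact (hY.contMDiffAt (hU.mem_nhds hxU)).mdifferentiableAt (by simp)
  have hpullback : ∀ Y : ∀ x : P, Tan E x,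
      VectorField.mpullback 𝓘(ℝ, E) 𝓘(ℝ, E) e.symm Y =ᶠ[𝓝 (e x)] fieldInChart e Y := fun Y => by
    filter_upwards [e.open_target.mem_nhds (e.map_source hx)] with y hy
      using mpullback_symm_eq_fieldInChart he Y hy
  have hbracket := VectorField.mpullback_mlieBracket (n := ∞) (hdiff hX) (hdiff hZ)
    (contMDiffAt_symm_of_mem_maximalAtlas he (e.map_source hx)) (hminSmoothness 2)
  rw [mpullback_symm_eq_fieldInChart he _ (e.map_source hx),
    (hpullback X).mlieBracket_vectorField_eq (hpullback Z)] at hbracket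
  exact (fieldInChart_apply hx _).symm.trans (hbracket.trans (mlieBracket_vectorSpace _ _ _))

lemma lieDerivForm_eq_inChart (hX : SmoothFieldOn X U) (hβ : SmoothFormOn β U)
    (hZ : SmoothFieldOn Z U) :
    lieDerivForm X β Z x =
      fderiv ℝ (formInChart e β) (e x) (fieldInChart e X (e x)) (fieldInChart e Z (e x))
        + formInChart e β (e x) (fderiv ℝ (fieldInChart e X) (e x) (fieldInChart e Z (e x))) := by
  have hbracket := covectorInChart_chartDeriv he hx (β x)
    (VectorField.mlieBracket 𝓘(ℝ, E) X Z x)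
  rw [chartDeriv_mlieBracket he hx hU hxU hX hZ, ← formInChart_apply hx] at hbracket
  rw [lieDerivForm, dfun_pairing_eq_fderiv he hx hU hxU hβ hZ, ← hbracket,
    ← fieldInChart_apply hx, fderiv_clm_apply_apply
      (differentiableAt_formInChart he hx hU hxU hβ)
      (differentiableAt_fieldInChart he hx hU hxU hZ), VectorField.lieBracket, map_sub]
  ring

lemma koszul_eq_koszulForm_inChart
    (hskew : ∀ (x : P) (α β : Cot E x), β (sharp x α) = -α (sharp x β))
    (hS : DifferentiableAt ℝ (contractionInChart e sharp) (e x))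
    (hα : SmoothFormOn α U) (hβ : SmoothFormOn β U) (hZ : SmoothFieldOn Z U)
    (hsα : SmoothFieldOn (fun y => sharp y (α y)) U)
    (hsβ : SmoothFieldOn (fun y => sharp y (β y)) U) :
    koszul sharp α β Z x = koszulForm (contractionInChart e sharp) (formInChart e α)
      (formInChart e β) (e x) (chartDeriv e x (Z x)) := by
  have hαchart := differentiableAt_formInChart he hx hU hxU hα
  have hβchart := differentiableAt_formInChart he hx hU hxU hβ
  have hZchart := differentiableAt_fieldInChart he hx hU hxU hZ
  have hfield := fieldInChart_sharp_eventuallyEq he hx sharp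
  have hpairing : (fun y => formInChart e β y (fieldInChart e (fun x => sharp x (α x)) y))
      =ᶠ[𝓝 (e x)] fun y => formInChart e β y
        (contractionInChart e sharp y (formInChart e α y)) :=
    (hfield α).mono fun y hy => congrArg (formInChart e β y) hy
  rw [koszul, lieDerivForm_eq_inChart he hx hU hxU hsα hβ hZ,
    lieDerivForm_eq_inChart he hx hU hxU hsβ hα hZ, dfun_pairing_eq_fderiv he hx hU hxU hβ hsα,
    hpairing.fderiv_eq, (hfield α).fderiv_eq, (hfield β).fderiv_eq, (hfield α).self_of_nhds,
    (hfield β).self_of_nhds, ← fieldInChart_apply hx,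
    ← lieDerivForm_vectorSpace (fun y => contractionInChart e sharp y (formInChart e α y))
      hβchart hZchart,
    ← lieDerivForm_vectorSpace (fun y => contractionInChart e sharp y (formInChart e β y))
      hαchart hZchart,
    ← koszul_eq_koszulForm hS (.of_forall fun y => isSkew_contractionInChart hskew y)
      hαchart hβchart hZchart, ← mfderiv_eq_fderiv]
  rfl

end Brackets

section Jacobi

lemma contMDiffOn_clm_comp_chart (a : E →L[ℝ] ℝ) :
    ContMDiffOn 𝓘(ℝ, E) 𝓘(ℝ, ℝ) ∞ (fun x => a (e x)) e.source :=
  a.contMDiff.comp_contMDiffOn (contMDiffOn_of_mem_maximalAtlas he)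

lemma dfun_clm_comp_chart (a : E →L[ℝ] ℝ) (hx : x ∈ e.source) :
    dfun (E := E) (fun x => a (e x)) x = covectorOfChart e x a := by
  have hexpression : (fun y => a (e (e.symm y))) =ᶠ[𝓝 (e x)] a := by
    filter_upwards [e.open_target.mem_nhds (e.map_source hx)] with y hy
    rw [e.right_inv hy]
  ext v
  rw [dfun_eq_fderiv he hx (((contMDiffOn_clm_comp_chart he a).contMDiffAt
    (e.open_source.mem_nhds hx)).mdifferentiableAt (by simp)), hexpression.fderiv_eq, a.fderiv]
  rfl

lemma poissonBracket_clm_comp_chart (a b : E →L[ℝ] ℝ) (hx : x ∈ e.source) :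
    poissonBracket sharp (fun x => a (e x)) (fun x => b (e x)) x =
      b (contractionInChart e sharp (e x) a) := by
  rw [poissonBracket, dfun_clm_comp_chart he a hx, dfun_clm_comp_chart he b hx,
    contractionInChart_apply hx]
  rfl

lemma poissonBracket_poissonBracket_clm_comp_chart
    (hS : ContDiffOn ℝ ∞ (contractionInChart e sharp) e.target) (a b c : E →L[ℝ] ℝ) {y : E}
    (hy : y ∈ e.target) :
    poissonBracket sharp (fun x => a (e x))
        (poissonBracket sharp (fun x => b (e x)) (fun x => c (e x))) (e.symm y) =
      c (fderiv ℝ (contractionInChart e sharp) y (contractionInChart e sharp y a) b) := by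
  have hx := e.map_target hy
  have hSy : DifferentiableAt ℝ (contractionInChart e sharp) y :=
    (hS.contDiffAt (e.open_target.mem_nhds hy)).differentiableAt (by simp)
  have hinner : poissonBracket sharp (fun x => b (e x)) (fun x => c (e x)) =ᶠ[𝓝 (e.symm y)]
      fun x => c (contractionInChart e sharp (e x) b) := by
    filter_upwards [e.open_source.mem_nhds hx] with x hx
      using poissonBracket_clm_comp_chart he b c hx
  have hinnerDfun : dfun (E := E) (poissonBracket sharp (fun x => b (e x)) (fun x => c (e x)))
      (e.symm y) = dfun (E := E) (fun x => c (contractionInChart e sharp (e x) b)) (e.symm y) :=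
    hinner.mfderiv_eq
  have hsmooth : ContMDiffOn 𝓘(ℝ, E) 𝓘(ℝ, ℝ) ∞
      (fun x => c (contractionInChart e sharp (e x) b)) e.source := by
    have h : ContDiffOn ℝ ∞ (fun y => c (contractionInChart e sharp y b)) e.target :=
      contDiffOn_const.clm_apply (hS.clm_apply contDiffOn_const)
    exact h.contMDiffOn.comp (contMDiffOn_of_mem_maximalAtlas he) fun x hx => e.map_source hx
  have hexpression : (fun z => c (contractionInChart e sharp (e (e.symm z)) b)) =ᶠ[𝓝 y]
      fun z => c (contractionInChart e sharp z b) := by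
    filter_upwards [e.open_target.mem_nhds hy] with z hz
    rw [e.right_inv hz]
  rw [poissonBracket, hinnerDfun, dfun_clm_comp_chart he a hx, dfun_eq_fderiv he hx
    ((hsmooth.contMDiffAt (e.open_source.mem_nhds hx)).mdifferentiableAt (by simp)),
    ← contractionInChart_apply hx, e.right_inv hy, hexpression.fderiv_eq,
    fderiv_const_clm_apply (hSy.clm_apply (differentiableAt_const b)),
    fderiv_clm_apply_const hSy]

lemma IsPoisson.jacobiAt_contractionInChart [IsManifold 𝓘(ℝ, E) ∞ P] [FiniteDimensional ℝ E]
    (hP : IsPoisson sharp) {y : E} (hy : y ∈ e.target) :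
    JacobiAt (contractionInChart e sharp) y := fun a b c => by
  have hS := contDiffOn_contractionInChart he hP.smooth
  have h := hP.jacobi e.source _ _ _ e.open_source (contMDiffOn_clm_comp_chart he a)
    (contMDiffOn_clm_comp_chart he b) (contMDiffOn_clm_comp_chart he c) _ (e.map_target hy)
  rwa [poissonBracket_poissonBracket_clm_comp_chart he hS a b c hy,
    poissonBracket_poissonBracket_clm_comp_chart he hS b c a hy,
    poissonBracket_poissonBracket_clm_comp_chart he hS c a b hy] at h

end Jacobi

end KoszulInChart

section AdaptedCharts

variable {E : Type*} [NormedAddCommGroup E] [NormedSpace ℝ E]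
  {P : Type*} [TopologicalSpace P] [ChartedSpace E P]
  {F : Type*} [NormedAddCommGroup F] [NormedSpace ℝ F]
  {C : Type*} [TopologicalSpace C] [ChartedSpace F C]

/-- A chart `e` of `P` and a chart `d` of `C` in which `f : C → P` is the linear inclusion `ι`, with
a chosen left inverse `ρ` of `ι`. -/
structure AdaptedChart (f : C → P) where
  e : OpenPartialHomeomorph P E
  d : OpenPartialHomeomorph C F
  ι : F →L[ℝ] E
  ρ : E →L[ℝ] F
  e_mem : e ∈ IsManifold.maximalAtlas 𝓘(ℝ, E) ∞ P
  d_mem : d ∈ IsManifold.maximalAtlas 𝓘(ℝ, F) ∞ C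
  ρ_ι : ∀ z, ρ (ι z) = z
  mapsTo : ∀ c ∈ d.source, f c ∈ e.source
  apply_eq : ∀ c ∈ d.source, e (f c) = ι (d c)

lemma exists_adaptedChart {f : C → P} (hf : IsImmersion 𝓘(ℝ, F) 𝓘(ℝ, E) ∞ f) (c : C) :
    ∃ A : AdaptedChart (E := E) (F := F) f, c ∈ A.d.source := by
  have h := hf.isImmersionAt c
  refine ⟨⟨h.codChart, h.domChart,
    (h.equiv : (F × h.complement) →L[ℝ] E).comp (ContinuousLinearMap.inl ℝ F h.complement),
    (ContinuousLinearMap.fst ℝ F h.complement).comp (h.equiv.symm : E →L[ℝ] (F × h.complement)),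
    h.codChart_mem_maximalAtlas, h.domChart_mem_maximalAtlas, fun z => by simp,
    fun c hc => h.source_subset_preimage_source hc, fun c hc => ?_⟩, h.mem_domChart_source⟩
  simpa [h.domChart.left_inv hc] using
    h.writtenInCharts (show h.domChart c ∈ _ by simpa using h.domChart.map_source hc)

namespace AdaptedChart

variable {f : C → P} (A : AdaptedChart (E := E) (F := F) f)

lemma ι_mem_target {u : F} (hu : u ∈ A.d.target) : A.ι u ∈ A.e.target := by
  rw [← A.d.right_inv hu, ← A.apply_eq _ (A.d.map_target hu)]
  exact A.e.map_source (A.mapsTo _ (A.d.map_target hu))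

lemma symm_ι_apply {c : C} (hc : c ∈ A.d.source) : A.e.symm (A.ι (A.d c)) = f c := by
  rw [← A.apply_eq c hc, A.e.left_inv (A.mapsTo c hc)]

include A in
lemma finiteDimensional_source [FiniteDimensional ℝ E] : FiniteDimensional ℝ F :=
  FiniteDimensional.of_injective A.ι.toLinearMap (Function.LeftInverse.injective A.ρ_ι)

lemma contMDiffOn : ContMDiffOn 𝓘(ℝ, F) 𝓘(ℝ, E) ∞ f A.d.source := by
  have hι : ContMDiffOn 𝓘(ℝ, F) 𝓘(ℝ, E) ∞ (fun c => A.ι (A.d c)) A.d.source :=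
    A.ι.contMDiff.comp_contMDiffOn (contMDiffOn_of_mem_maximalAtlas A.d_mem)
  exact ((contMDiffOn_symm_of_mem_maximalAtlas A.e_mem).comp hι
    fun c hc => A.ι_mem_target (A.d.map_source hc)).congr fun c hc => (A.symm_ι_apply hc).symm

lemma chartDeriv_mfderiv {c : C} (hc : c ∈ A.d.source) (w : Tan F c) :
    chartDeriv A.e (f c) (mfderiv 𝓘(ℝ, F) 𝓘(ℝ, E) f c w) = A.ι (chartDeriv A.d c w) := by
  have hsource : A.d.source ∈ 𝓝 c := A.d.open_source.mem_nhds hc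
  have hleft := mfderiv_comp c
    ((mdifferentiable_of_mem_maximalAtlas A.e_mem).mdifferentiableAt (A.mapsTo c hc))
    ((A.contMDiffOn.contMDiffAt hsource).mdifferentiableAt (by simp))
  have hright := mfderiv_comp c (I' := 𝓘(ℝ, F)) (I'' := 𝓘(ℝ, E)) (g := A.ι)
    (A.ι.contMDiff.mdifferentiableAt (n := 1) one_ne_zero)
    ((mdifferentiable_of_mem_maximalAtlas A.d_mem).mdifferentiableAt hc)
  have heq : (A.e ∘ f) =ᶠ[𝓝 c] (A.ι ∘ A.d) := Filter.eventually_of_mem hsource A.apply_eq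
  have hι : (mfderiv 𝓘(ℝ, F) 𝓘(ℝ, E) A.ι (A.d c) : F →L[ℝ] E) = A.ι := by
    rw [mfderiv_eq_fderiv]
    exact A.ι.fderiv
  exact (congrArg (fun T : F →L[ℝ] E => T w)
    (hleft.symm.trans (heq.mfderiv_eq (I := 𝓘(ℝ, F)) (I' := 𝓘(ℝ, E))))).trans
    ((congrArg (fun T : F →L[ℝ] E => T w) hright).trans
      (congrArg (fun T : F →L[ℝ] E => T (chartDeriv A.d c w)) hι))

lemma mfderiv_eq {c : C} (hc : c ∈ A.d.source) (w : Tan F c) :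
    mfderiv 𝓘(ℝ, F) 𝓘(ℝ, E) f c w = chartDerivSymm A.e (A.e (f c)) (A.ι (chartDeriv A.d c w)) := by
  rw [← A.chartDeriv_mfderiv hc]
  exact (chartDerivSymm_chartDeriv A.e_mem (A.mapsTo c hc) _).symm

lemma mfderiv_chartDerivSymm {c : C} (hc : c ∈ A.d.source) (z : F) :
    mfderiv 𝓘(ℝ, F) 𝓘(ℝ, E) f c (chartDerivSymm A.d (A.d c) z) =
      chartDerivSymm A.e (A.e (f c)) (A.ι z) := by
  have h := A.mfderiv_eq hc (chartDerivSymm A.d (A.d c) z)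
  rwa [chartDeriv_chartDerivSymm A.d_mem hc] at h

lemma mfderiv_injective {c : C} (hc : c ∈ A.d.source) :
    Function.Injective (mfderiv 𝓘(ℝ, F) 𝓘(ℝ, E) f c) := by
  have hleft : ∀ w : Tan F c, chartDerivSymm A.d (A.d c)
      (A.ρ (chartDeriv A.e (f c) (mfderiv 𝓘(ℝ, F) 𝓘(ℝ, E) f c w))) = w := fun w => by
    rw [A.chartDeriv_mfderiv hc, A.ρ_ι]
    exact chartDerivSymm_chartDeriv A.d_mem hc w
  exact Function.LeftInverse.injective
    (g := fun v => chartDerivSymm A.d (A.d c) (A.ρ (chartDeriv A.e (f c) v))) hleft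

lemma mem_tangentAlong_iff {c : C} (hc : c ∈ A.d.source) (v : Tan E (f c)) :
    v ∈ tangentAlong F f c ↔ ∃ z, A.ι z = chartDeriv A.e (f c) v := by
  constructor
  · rintro ⟨w, rfl⟩
    exact ⟨chartDeriv A.d c w, (A.chartDeriv_mfderiv hc w).symm⟩
  · rintro ⟨z, hz⟩
    refine ⟨chartDerivSymm A.d (A.d c) z, (A.mfderiv_chartDerivSymm hc z).trans ?_⟩
    rw [hz]
    exact chartDerivSymm_chartDeriv A.e_mem (A.mapsTo c hc) v

lemma mem_conormal_iff {c : C} (hc : c ∈ A.d.source) (ξ : Cot E (f c)) :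
    ξ ∈ conormal F f c ↔ covectorInChart A.e ξ ∈ conormalSpace A.ι := by
  rw [mem_conormalSpace]
  constructor
  · intro h z
    exact (congrArg (covectorToModel ξ) (A.mfderiv_chartDerivSymm hc z)).symm.trans
      (h _ ⟨chartDerivSymm A.d (A.d c) z, rfl⟩)
  · rintro h _ ⟨w, rfl⟩
    exact (congrArg (covectorToModel ξ) (A.mfderiv_eq hc w)).trans (h _)

lemma mem_charConormal_iff (sharp : ∀ x : P, Cot E x →L[ℝ] Tan E x) {c : C} (hc : c ∈ A.d.source)
    (ξ : Cot E (f c)) : ξ ∈ charConormal F sharp f c ↔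
      covectorInChart A.e ξ ∈ charCovectors (contractionInChart A.e sharp (A.ι (A.d c))) A.ι := by
  rw [mem_charCovectors, ← A.apply_eq c hc,
    contractionInChart_covectorInChart A.e_mem (A.mapsTo c hc)]
  exact and_congr (A.mem_conormal_iff hc ξ) (A.mem_tangentAlong_iff hc _)

/-- The expression in an adapted chart of a section of `T*P|_C`. -/
def sectionInChart (σ : ∀ c, Cot E (f c)) (u : F) : E →L[ℝ] ℝ :=
  covectorInChart A.e (σ (A.d.symm u))

lemma sectionInChart_apply (σ : ∀ c, Cot E (f c)) {c : C} (hc : c ∈ A.d.source) :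
    A.sectionInChart σ (A.d c) = covectorInChart A.e (σ c) := by
  rw [sectionInChart, A.d.left_inv hc]

/-- The section of `T*P|_C` whose expression in an adapted chart is `s`. -/
def sectionOfChart (s : F → E →L[ℝ] ℝ) (c : C) : Cot E (f c) :=
  covectorOfChart A.e (f c) (s (A.d c))

lemma covectorInChart_sectionOfChart (s : F → E →L[ℝ] ℝ) {c : C} (hc : c ∈ A.d.source) :
    covectorInChart A.e (A.sectionOfChart s c) = s (A.d c) :=
  covectorInChart_covectorOfChart A.e_mem (A.mapsTo c hc) _

/-- The extension to `P` of a section of `T*P|_C`, constant in the normal directions of an adapted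
chart. -/
def extend (s : F → E →L[ℝ] ℝ) (x : P) : Cot E x :=
  covectorOfChart A.e x (s (A.ρ (A.e x)))

lemma extend_apply (s : F → E →L[ℝ] ℝ) {c : C} (hc : c ∈ A.d.source) :
    A.extend s (f c) = A.sectionOfChart s c := by
  rw [extend, sectionOfChart, A.apply_eq c hc, A.ρ_ι]

variable [IsManifold 𝓘(ℝ, E) ∞ P]

lemma smoothFieldOn_of_mfderiv [IsManifold 𝓘(ℝ, F) ∞ C] {X : ∀ c, Tan F c} {U : Set C}
    (hU : U ⊆ A.d.source)
    (hX : SmoothFieldAlongOn F f (fun c => mfderiv 𝓘(ℝ, F) 𝓘(ℝ, E) f c (X c)) U) :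
    SmoothFieldOn X U := by
  refine (smoothFieldAlongOn_iff (f := fun c => c) A.d_mem contMDiffOn_id fun c hc => hU hc).2 ?_
  have hchart := (smoothFieldAlongOn_iff A.e_mem (A.contMDiffOn.mono hU)
    fun c hc => A.mapsTo c (hU hc)).1 hX
  refine (A.ρ.contMDiff.comp_contMDiffOn hchart).congr fun c hc => ?_
  exact ((congrArg A.ρ (A.chartDeriv_mfderiv (hU hc) (X c))).trans (A.ρ_ι _)).symm

variable [FiniteDimensional ℝ E]

lemma smoothFormOn_extend {s : F → E →L[ℝ] ℝ} {W : Set F} (hs : ContDiffOn ℝ ∞ s W) :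
    SmoothFormOn (A.extend s) (A.e.source ∩ A.e ⁻¹' (A.ρ ⁻¹' W)) :=
  smoothFormOn_of_contDiffOn (A := fun y => s (A.ρ y)) A.e_mem
    (hs.comp A.ρ.contDiff.contDiffOn fun _ h => h)

lemma smoothAlongOn_sectionOfChart {s : F → E →L[ℝ] ℝ} {W : Set F} (hs : ContDiffOn ℝ ∞ s W) :
    SmoothAlongOn F f (A.sectionOfChart s) (A.d.source ∩ A.d ⁻¹' W) := by
  refine (smoothAlongOn_iff A.e_mem (A.contMDiffOn.mono Set.inter_subset_left)
    fun c hc => A.mapsTo c hc.1).2 ?_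
  exact (hs.contMDiffOn.comp
    ((contMDiffOn_of_mem_maximalAtlas A.d_mem).mono Set.inter_subset_left)
    fun c hc => hc.2).congr fun c hc => A.covectorInChart_sectionOfChart s hc.1

lemma contDiffOn_sectionInChart {σ : ∀ c, Cot E (f c)} {U : Set C} (hσ : SmoothAlongOn F f σ U) :
    ContDiffOn ℝ ∞ (A.sectionInChart σ) (A.d.target ∩ A.d.symm ⁻¹' U) := by
  have hchart := (smoothAlongOn_iff A.e_mem (A.contMDiffOn.mono (Set.inter_subset_left (t := U)))
    fun c hc => A.mapsTo c hc.1).1 (hσ.mono Set.inter_subset_right)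
  exact (contDiffOn_comp_chart_symm A.d_mem hchart).mono
    fun u hu => ⟨hu.1, A.d.map_target hu.1, hu.2⟩

end AdaptedChart

end AdaptedCharts

section CharAlgebroid

variable {E : Type*} [NormedAddCommGroup E] [NormedSpace ℝ E]
  {P : Type*} [TopologicalSpace P] [ChartedSpace E P]
  {F : Type*} [NormedAddCommGroup F] [NormedSpace ℝ F]
  {C : Type*} [TopologicalSpace C] [ChartedSpace F C]
  {sharp : ∀ x : P, Cot E x →L[ℝ] Tan E x} {f : C → P} {σ τ υ : ∀ c, Cot E (f c)}

namespace AdaptedChart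

variable (A : AdaptedChart (E := E) (F := F) f) {c : C} {u : F}

/-- The expression in an adapted chart of a section of `T*P|_C`, extended to the ambient model
space so as to be constant in the normal directions. -/
def liftInChart (σ : ∀ c, Cot E (f c)) (y : E) : E →L[ℝ] ℝ := A.sectionInChart σ (A.ρ y)

lemma liftInChart_ι (σ : ∀ c, Cot E (f c)) (u : F) :
    A.liftInChart σ (A.ι u) = A.sectionInChart σ u := by
  rw [liftInChart, A.ρ_ι]

lemma isOpen_target_inter_preimage_ρ : IsOpen (A.e.target ∩ A.ρ ⁻¹' A.d.target) :=
  A.e.open_target.inter (A.d.open_target.preimage A.ρ.continuous)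

lemma ι_mem_target_inter_preimage_ρ (hu : u ∈ A.d.target) :
    A.ι u ∈ A.e.target ∩ A.ρ ⁻¹' A.d.target :=
  ⟨A.ι_mem_target hu, by rwa [Set.mem_preimage, A.ρ_ι]⟩

lemma formInChart_ι_eventuallyEq (hc : c ∈ A.d.source) {α : ∀ x : P, Cot E x}
    (hα : ∀ᶠ c' in 𝓝 c, α (f c') = σ c') :
    ∀ᶠ u in 𝓝 (A.d c), formInChart A.e α (A.ι u) = A.sectionInChart σ u := by
  filter_upwards [(A.d.tendsto_symm hc).eventually hα,
    A.d.open_target.mem_nhds (A.d.map_source hc)] with u hu hu_target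
  have hι : A.e (f (A.d.symm u)) = A.ι u := by
    rw [A.apply_eq _ (A.d.map_target hu_target), A.d.right_inv hu_target]
  rw [← hι, formInChart_apply (A.mapsTo _ (A.d.map_target hu_target)), hu, sectionInChart]

variable (sharp) in
/-- The bracket of two sections of `N*C ∩ ♯⁻¹TC` in an adapted chart, computed with the extensions
`liftInChart`. -/
def bracketInChart (σ τ : ∀ c, Cot E (f c)) (u : F) : E →L[ℝ] ℝ :=
  koszulForm (contractionInChart A.e sharp) (A.liftInChart σ) (A.liftInChart τ) (A.ι u)

lemma differentiableAt_comp_symm_ρ {h : C → ℝ} (hh : SmoothFunOn F h Set.univ)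
    (hc : c ∈ A.d.source) :
    DifferentiableAt ℝ (fun y => h (A.d.symm (A.ρ y))) (A.ι (A.d c)) := by
  have hd : ContDiffAt ℝ ∞ (fun u => h (A.d.symm u)) (A.ρ (A.ι (A.d c))) := by
    rw [A.ρ_ι]
    exact (contDiffOn_comp_chart_symm A.d_mem hh).contDiffAt
      ((A.d.open_target.inter (by simp)).mem_nhds ⟨A.d.map_source hc, Set.mem_univ _⟩)
  exact (hd.differentiableAt (by simp)).comp _ A.ρ.differentiableAt

lemma fderiv_comp_symm_ρ {h : C → ℝ} (hh : SmoothFunOn F h Set.univ) (hc : c ∈ A.d.source)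
    (w : Tan F c) :
    fderiv ℝ (fun y => h (A.d.symm (A.ρ y))) (A.ι (A.d c)) (A.ι (chartDeriv A.d c w)) =
      dfun (E := F) h c w := by
  rw [← fderiv_comp_clm_apply (A.differentiableAt_comp_symm_ρ hh hc), dfun_eq_fderiv A.d_mem hc
    ((hh.contMDiffAt Filter.univ_mem).mdifferentiableAt (by simp))]
  simp only [A.ρ_ι]

lemma liftInChart_mem_charCovectors (hσ : ∀ c, σ c ∈ charConormal F sharp f c)
    (hu : u ∈ A.d.target) :
    A.liftInChart σ (A.ι u) ∈ charCovectors (contractionInChart A.e sharp (A.ι u)) A.ι := by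
  have h := (A.mem_charConormal_iff sharp (A.d.map_target hu) _).1 (hσ (A.d.symm u))
  rw [A.d.right_inv hu] at h
  rwa [A.liftInChart_ι]

end AdaptedChart

section Anchor

lemma mfderiv_injective_of_isImmersion (hf : IsImmersion 𝓘(ℝ, F) 𝓘(ℝ, E) ∞ f) (c : C) :
    Function.Injective (mfderiv 𝓘(ℝ, F) 𝓘(ℝ, E) f c).toLinearMap := by
  obtain ⟨A, hc⟩ := exists_adaptedChart hf c
  exact A.mfderiv_injective hc

variable (sharp) in
/-- The restriction of `♯` to `N*C ∩ ♯⁻¹TC`, with values in `TC`. -/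
def charAnchor (hf : IsImmersion 𝓘(ℝ, F) 𝓘(ℝ, E) ∞ f) (c : C) :
    charConormal F sharp f c →ₗ[ℝ] Tan F c :=
  (LinearEquiv.ofInjective _ (mfderiv_injective_of_isImmersion hf c)).symm.toLinearMap ∘ₗ
    ((sharp (f c)).toLinearMap ∘ₗ (charConormal F sharp f c).subtype).codRestrict
      (tangentAlong F f c) fun ξ => ξ.2.2

lemma mfderiv_charAnchor (hf : IsImmersion 𝓘(ℝ, F) 𝓘(ℝ, E) ∞ f) (c : C)
    (ξ : charConormal F sharp f c) :
    mfderiv 𝓘(ℝ, F) 𝓘(ℝ, E) f c (charAnchor sharp hf c ξ) = sharp (f c) (ξ : Cot E (f c)) :=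
  congrArg Subtype.val
    ((LinearEquiv.ofInjective _ (mfderiv_injective_of_isImmersion hf c)).apply_symm_apply
      (((sharp (f c)).toLinearMap ∘ₗ (charConormal F sharp f c).subtype).codRestrict
        (tangentAlong F f c) (fun ξ => ξ.2.2) ξ))

lemma AdaptedChart.contractionInChart_liftInChart (A : AdaptedChart (E := E) (F := F) f)
    (hf : IsImmersion 𝓘(ℝ, F) 𝓘(ℝ, E) ∞ f)
    (hσ : ∀ c, σ c ∈ charConormal F sharp f c) {c : C} (hc : c ∈ A.d.source) :
    contractionInChart A.e sharp (A.ι (A.d c)) (A.liftInChart σ (A.ι (A.d c))) =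
      A.ι (chartDeriv A.d c (charAnchor sharp hf c ⟨σ c, hσ c⟩)) := by
  rw [A.liftInChart_ι, A.sectionInChart_apply _ hc, ← A.apply_eq c hc,
    contractionInChart_covectorInChart A.e_mem (A.mapsTo c hc), ← A.chartDeriv_mfderiv hc]
  exact congrArg (chartDeriv A.e (f c)) (mfderiv_charAnchor hf c ⟨σ c, hσ c⟩).symm

variable [IsManifold 𝓘(ℝ, E) ∞ P] [IsManifold 𝓘(ℝ, F) ∞ C]

lemma smoothFieldOn_charAnchor (hf : IsImmersion 𝓘(ℝ, F) 𝓘(ℝ, E) ∞ f)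
    (hs : SmoothContraction sharp) (hσ : IsSection F f (charConormal F sharp f) σ) :
    SmoothFieldOn (fun c => charAnchor sharp hf c ⟨σ c, hσ.mem c⟩) Set.univ := by
  intro c _
  obtain ⟨A, hc⟩ := exists_adaptedChart hf c
  have hanchor : SmoothFieldAlongOn F f (fun c => mfderiv 𝓘(ℝ, F) 𝓘(ℝ, E) f c
      (charAnchor sharp hf c ⟨σ c, hσ.mem c⟩)) A.d.source := by
    refine ContMDiffOn.congr ((hσ.smooth.sharp hs).mono (Set.subset_univ A.d.source))
      fun c _ => ?_
    congr 1
    exact mfderiv_charAnchor hf c _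
  exact ((A.smoothFieldOn_of_mfderiv subset_rfl hanchor).contMDiffAt
    (A.d.open_source.mem_nhds hc)).contMDiffWithinAt

end Anchor

variable [IsManifold 𝓘(ℝ, E) ∞ P]

variable [FiniteDimensional ℝ E]

/-- The one-form `α` is smooth around `f c` and extends `σ` around `c`. -/
def IsLocalExtension (f : C → P) (σ : ∀ c, Cot E (f c)) (c : C) (α : ∀ x : P, Cot E x) : Prop :=
  (∃ U : Set P, IsOpen U ∧ f c ∈ U ∧ SmoothFormOn α U) ∧ ∀ᶠ c' in 𝓝 c, α (f c') = σ c'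

lemma SmoothAlongOn.smul_fun {h : C → ℝ} {U : Set C} (hσ : SmoothAlongOn F f σ U)
    (hh : SmoothFunOn F h U) : SmoothAlongOn F f (fun c => h c • σ c) U :=
  smoothAlongOn_of_apply hσ.contMDiffOn_base fun _ hV _ hX =>
    (ContMDiffOn.mul (hh.mono hV) ((hσ.mono hV).apply hX) :)

lemma SmoothAlongOn.add {U : Set C} (hσ : SmoothAlongOn F f σ U) (hτ : SmoothAlongOn F f τ U) :
    SmoothAlongOn F f (σ + τ) U :=
  smoothAlongOn_of_apply hσ.contMDiffOn_base fun _ hV _ hX =>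
    (ContMDiffOn.add ((hσ.mono hV).apply hX) ((hτ.mono hV).apply hX) :)

lemma IsSection.add {B : ∀ c, Submodule ℝ (Cot E (f c))} (hσ : IsSection F f B σ)
    (hτ : IsSection F f B τ) : IsSection F f B (σ + τ) :=
  ⟨fun c => (B c).add_mem (hσ.mem c) (hτ.mem c), hσ.smooth.add hτ.smooth⟩

lemma IsSection.smul_fun {B : ∀ c, Submodule ℝ (Cot E (f c))} {h : C → ℝ}
    (hσ : IsSection F f B σ) (hh : SmoothFunOn F h Set.univ) :
    IsSection F f B (fun c => h c • σ c) :=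
  ⟨fun c => (B c).smul_mem _ (hσ.mem c), hσ.smooth.smul_fun hh⟩

namespace AdaptedChart

variable (A : AdaptedChart (E := E) (F := F) f) {c : C} {u : F}

lemma contDiffOn_liftInChart (hσ : SmoothAlongOn F f σ Set.univ) :
    ContDiffOn ℝ ∞ (A.liftInChart σ) (A.e.target ∩ A.ρ ⁻¹' A.d.target) :=
  (A.contDiffOn_sectionInChart hσ).comp A.ρ.contDiff.contDiffOn fun _ hy => ⟨hy.2, Set.mem_univ _⟩

lemma contDiffAt_liftInChart (hσ : SmoothAlongOn F f σ Set.univ) (hu : u ∈ A.d.target) :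
    ContDiffAt ℝ ∞ (A.liftInChart σ) (A.ι u) :=
  (A.contDiffOn_liftInChart hσ).contDiffAt
    (A.isOpen_target_inter_preimage_ρ.mem_nhds (A.ι_mem_target_inter_preimage_ρ hu))

lemma differentiableAt_liftInChart (hσ : SmoothAlongOn F f σ Set.univ) (hu : u ∈ A.d.target) :
    DifferentiableAt ℝ (A.liftInChart σ) (A.ι u) :=
  (A.contDiffAt_liftInChart hσ hu).differentiableAt (by simp)

lemma contDiffAt_contractionInChart (hs : SmoothContraction sharp) (hu : u ∈ A.d.target) :
    ContDiffAt ℝ ∞ (contractionInChart A.e sharp) (A.ι u) :=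
  (contDiffOn_contractionInChart A.e_mem hs).contDiffAt
    (A.e.open_target.mem_nhds (A.ι_mem_target hu))

lemma differentiableAt_contractionInChart (hs : SmoothContraction sharp) (hu : u ∈ A.d.target) :
    DifferentiableAt ℝ (contractionInChart A.e sharp) (A.ι u) :=
  (A.contDiffAt_contractionInChart hs hu).differentiableAt (by simp)

lemma isLocalExtension_extend {U : Set C} (hU : IsOpen U) (hcU : c ∈ U)
    (hσ : SmoothAlongOn F f σ U) (hc : c ∈ A.d.source) :
    IsLocalExtension f σ c (A.extend (A.sectionInChart σ)) := by
  have hW : IsOpen (A.d.target ∩ A.d.symm ⁻¹' U) := A.d.isOpen_inter_preimage_symm hU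
  refine ⟨⟨_, A.e.isOpen_inter_preimage (hW.preimage A.ρ.continuous), ⟨A.mapsTo c hc, ?_⟩,
    A.smoothFormOn_extend (A.contDiffOn_sectionInChart hσ)⟩, ?_⟩
  · change A.ρ (A.e (f c)) ∈ A.d.target ∩ A.d.symm ⁻¹' U
    rw [A.apply_eq c hc, A.ρ_ι]
    exact ⟨A.d.map_source hc, by rwa [Set.mem_preimage, A.d.left_inv hc]⟩
  · filter_upwards [A.d.open_source.mem_nhds hc] with c' hc'
    refine covectorInChart_injective A.e_mem (A.mapsTo c' hc') ?_
    rw [A.extend_apply _ hc', A.covectorInChart_sectionOfChart _ hc', A.sectionInChart_apply _ hc']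

lemma differentiableAt_formInChart_of_isLocalExtension (hc : c ∈ A.d.source)
    {α : ∀ x : P, Cot E x} (hα : IsLocalExtension f σ c α) :
    DifferentiableAt ℝ (formInChart A.e α) (A.ι (A.d c)) := by
  obtain ⟨⟨U, hU, hcU, hαU⟩, -⟩ := hα
  rw [← A.apply_eq c hc]
  exact differentiableAt_formInChart A.e_mem (A.mapsTo c hc) hU hcU hαU

lemma koszul_eq_koszulForm_of_isLocalExtension
    (hskew : ∀ (x : P) (α β : Cot E x), β (sharp x α) = -α (sharp x β))
    (hs : SmoothContraction sharp) (hc : c ∈ A.d.source)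
    {α β : ∀ x : P, Cot E x} (hα : IsLocalExtension f σ c α) (hβ : IsLocalExtension f τ c β)
    {Z : ∀ x : P, Tan E x} {O : Set P} (hO : IsOpen O) (hcO : f c ∈ O) (hZ : SmoothFieldOn Z O) :
    koszul sharp α β Z (f c) = koszulForm (contractionInChart A.e sharp) (formInChart A.e α)
      (formInChart A.e β) (A.ι (A.d c)) (chartDeriv A.e (f c) (Z (f c))) := by
  obtain ⟨⟨U, hU, hcU, hαU⟩, -⟩ := hα
  obtain ⟨⟨V, hV, hcV, hβV⟩, -⟩ := hβ
  have hα : SmoothFormOn α (O ∩ (U ∩ V)) := ContMDiffOn.mono hαU fun x hx => hx.2.1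
  have hβ : SmoothFormOn β (O ∩ (U ∩ V)) := ContMDiffOn.mono hβV fun x hx => hx.2.2
  have hS := A.differentiableAt_contractionInChart hs (A.d.map_source hc)
  rw [← A.apply_eq c hc] at hS ⊢
  exact koszul_eq_koszulForm_inChart A.e_mem (A.mapsTo c hc) (hO.inter (hU.inter hV))
    ⟨hcO, hcU, hcV⟩ hskew hS hα hβ (ContMDiffOn.mono hZ Set.inter_subset_left)
    (SmoothAlongOn.sharp (f := fun x => x) hα hs) (SmoothAlongOn.sharp (f := fun x => x) hβ hs)

lemma contDiffOn_koszulForm_liftInChart (hs : SmoothContraction sharp)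
    (hσ : SmoothAlongOn F f σ Set.univ) (hτ : SmoothAlongOn F f τ Set.univ) :
    ContDiffOn ℝ ∞
      (koszulForm (contractionInChart A.e sharp) (A.liftInChart σ) (A.liftInChart τ))
      (A.e.target ∩ A.ρ ⁻¹' A.d.target) :=
  contDiffOn_koszulForm A.isOpen_target_inter_preimage_ρ
    ((contDiffOn_contractionInChart A.e_mem hs).mono Set.inter_subset_left)
    (A.contDiffOn_liftInChart hσ) (A.contDiffOn_liftInChart hτ)

lemma contDiffOn_bracketInChart (hs : SmoothContraction sharp)
    (hσ : SmoothAlongOn F f σ Set.univ) (hτ : SmoothAlongOn F f τ Set.univ) :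
    ContDiffOn ℝ ∞ (A.bracketInChart sharp σ τ) A.d.target :=
  (A.contDiffOn_koszulForm_liftInChart hs hσ hτ).comp A.ι.contDiff.contDiffOn
    fun _ hu => A.ι_mem_target_inter_preimage_ρ hu

lemma bracketInChart_mem_charCovectors (hP : IsPoisson sharp)
    (hσ : IsSection F f (charConormal F sharp f) σ)
    (hτ : IsSection F f (charConormal F sharp f) τ) (hu : u ∈ A.d.target) :
    A.bracketInChart sharp σ τ u ∈ charCovectors (contractionInChart A.e sharp (A.ι u)) A.ι :=
  koszulForm_mem_charCovectors A.ρ_ι (A.differentiableAt_contractionInChart hP.smooth hu)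
    (.of_forall (isSkew_contractionInChart hP.skew))
    (hP.jacobiAt_contractionInChart A.e_mem (A.ι_mem_target hu))
    (A.differentiableAt_liftInChart hσ.smooth hu) (A.differentiableAt_liftInChart hτ.smooth hu)
    (Filter.eventually_of_mem (A.d.open_target.mem_nhds hu)
      fun _ hx => A.liftInChart_mem_charCovectors hσ.mem hx)
    (Filter.eventually_of_mem (A.d.open_target.mem_nhds hu)
      fun _ hx => A.liftInChart_mem_charCovectors hτ.mem hx)

lemma bracketInChart_eq_koszulForm (hσ : IsSection F f (charConormal F sharp f) σ)
    (hτ : IsSection F f (charConormal F sharp f) τ) (hu : u ∈ A.d.target)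
    {a b : E → E →L[ℝ] ℝ} (ha : DifferentiableAt ℝ a (A.ι u)) (hb : DifferentiableAt ℝ b (A.ι u))
    (haσ : ∀ᶠ x in 𝓝 u, a (A.ι x) = A.sectionInChart σ x)
    (hbτ : ∀ᶠ x in 𝓝 u, b (A.ι x) = A.sectionInChart τ x) :
    A.bracketInChart sharp σ τ u = koszulForm (contractionInChart A.e sharp) a b (A.ι u) :=
  koszulForm_congr_of_tangent (A.differentiableAt_liftInChart hσ.smooth hu)
    (A.differentiableAt_liftInChart hτ.smooth hu) ha hb
    (haσ.mono fun x hx => (A.liftInChart_ι σ x).trans hx.symm)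
    (hbτ.mono fun x hx => (A.liftInChart_ι τ x).trans hx.symm)
    (mem_charCovectors.1 (A.liftInChart_mem_charCovectors hσ.mem hu)).2
    (mem_charCovectors.1 (A.liftInChart_mem_charCovectors hτ.mem hu)).2

lemma bracketInChart_apply_eq_koszul (hP : IsPoisson sharp)
    (hσ : IsSection F f (charConormal F sharp f) σ)
    (hτ : IsSection F f (charConormal F sharp f) τ) (hc : c ∈ A.d.source)
    {α β : ∀ x : P, Cot E x} (hα : IsLocalExtension f σ c α) (hβ : IsLocalExtension f τ c β)
    {Z : ∀ x : P, Tan E x} {O : Set P} (hO : IsOpen O) (hcO : f c ∈ O) (hZ : SmoothFieldOn Z O) :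
    A.bracketInChart sharp σ τ (A.d c) (chartDeriv A.e (f c) (Z (f c))) =
      koszul sharp α β Z (f c) := by
  rw [A.koszul_eq_koszulForm_of_isLocalExtension hP.skew hP.smooth hc hα hβ hO hcO hZ,
    A.bracketInChart_eq_koszulForm hσ hτ (A.d.map_source hc)
      (A.differentiableAt_formInChart_of_isLocalExtension hc hα)
      (A.differentiableAt_formInChart_of_isLocalExtension hc hβ)
      (A.formInChart_ι_eventuallyEq hc hα.2) (A.formInChart_ι_eventuallyEq hc hβ.2)]

end AdaptedChart

variable (sharp) in
/-- The bracket of two sections of `N*C ∩ ♯⁻¹TC`, computed in an arbitrary adapted chart around each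
point. -/
def charBracket (hf : IsImmersion 𝓘(ℝ, F) 𝓘(ℝ, E) ∞ f) (σ τ : ∀ c, Cot E (f c)) (c : C) :
    Cot E (f c) :=
  (exists_adaptedChart hf c).choose.sectionOfChart
    ((exists_adaptedChart hf c).choose.bracketInChart sharp σ τ) c

section BracketLaws

variable (hf : IsImmersion 𝓘(ℝ, F) 𝓘(ℝ, E) ∞ f) (hP : IsPoisson sharp)
  (hσ : IsSection F f (charConormal F sharp f) σ) (hτ : IsSection F f (charConormal F sharp f) τ)
include hP hσ hτ

lemma charBracket_apply_eq_koszul {c : C} {α β : ∀ x : P, Cot E x}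
    (hα : IsLocalExtension f σ c α) (hβ : IsLocalExtension f τ c β)
    {Z : ∀ x : P, Tan E x} {O : Set P} (hO : IsOpen O) (hcO : f c ∈ O) (hZ : SmoothFieldOn Z O) :
    charBracket sharp hf σ τ c (Z (f c)) = koszul sharp α β Z (f c) :=
  (exists_adaptedChart hf c).choose.bracketInChart_apply_eq_koszul hP hσ hτ
    (exists_adaptedChart hf c).choose_spec hα hβ hO hcO hZ

lemma covectorInChart_charBracket (A : AdaptedChart (E := E) (F := F) f) {c : C}
    (hc : c ∈ A.d.source) :
    covectorInChart A.e (charBracket sharp hf σ τ c) = A.bracketInChart sharp σ τ (A.d c) := by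
  ext v
  have hZ := smoothFieldOn_chartDerivSymm A.e_mem v
  have hα := A.isLocalExtension_extend isOpen_univ (Set.mem_univ c) hσ.smooth hc
  have hβ := A.isLocalExtension_extend isOpen_univ (Set.mem_univ c) hτ.smooth hc
  have hcharBracket := charBracket_apply_eq_koszul hf hP hσ hτ hα hβ A.e.open_source
    (A.mapsTo c hc) hZ
  have hbracketInChart := A.bracketInChart_apply_eq_koszul hP hσ hτ hc hα hβ A.e.open_source
    (A.mapsTo c hc) hZ
  rw [chartDeriv_chartDerivSymm A.e_mem (A.mapsTo c hc)] at hbracketInChart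
  exact hcharBracket.trans hbracketInChart.symm

lemma sectionInChart_charBracket (A : AdaptedChart (E := E) (F := F) f) {u : F}
    (hu : u ∈ A.d.target) :
    A.sectionInChart (charBracket sharp hf σ τ) u = A.bracketInChart sharp σ τ u := by
  rw [AdaptedChart.sectionInChart, covectorInChart_charBracket hf hP hσ hτ A (A.d.map_target hu),
    A.d.right_inv hu]

lemma isSection_charBracket :
    IsSection F f (charConormal F sharp f) (charBracket sharp hf σ τ) := by
  refine ⟨fun c => ?_, fun c _ => ?_⟩
  · obtain ⟨A, hc⟩ := exists_adaptedChart hf c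
    rw [A.mem_charConormal_iff sharp hc, covectorInChart_charBracket hf hP hσ hτ A hc]
    exact A.bracketInChart_mem_charCovectors hP hσ hτ (A.d.map_source hc)
  · obtain ⟨A, hc⟩ := exists_adaptedChart hf c
    have hchart : ∀ c' ∈ A.d.source, charBracket sharp hf σ τ c' =
        A.sectionOfChart (A.bracketInChart sharp σ τ) c' := fun c' hc' => by
      refine covectorInChart_injective A.e_mem (A.mapsTo c' hc') ?_
      rw [covectorInChart_charBracket hf hP hσ hτ A hc', A.covectorInChart_sectionOfChart _ hc']
    have hsmooth : SmoothAlongOn F f (charBracket sharp hf σ τ)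
        (A.d.source ∩ A.d ⁻¹' A.d.target) :=
      ContMDiffOn.congr (A.smoothAlongOn_sectionOfChart
        (A.contDiffOn_bracketInChart hP.smooth hσ.smooth hτ.smooth)) fun c' hc' => by
          rw [hchart c' hc'.1]
    exact (hsmooth.contMDiffAt ((A.d.isOpen_inter_preimage A.d.open_target).mem_nhds
      ⟨hc, A.d.map_source hc⟩)).contMDiffWithinAt

lemma charBracket_add (hυ : IsSection F f (charConormal F sharp f) υ) :
    charBracket sharp hf σ (τ + υ) = charBracket sharp hf σ τ + charBracket sharp hf σ υ := by
  funext c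
  obtain ⟨A, hc⟩ := exists_adaptedChart hf c
  have hu := A.d.map_source hc
  refine covectorInChart_injective A.e_mem (A.mapsTo c hc) ?_
  have hlift : A.liftInChart (τ + υ) = A.liftInChart τ + A.liftInChart υ := rfl
  rw [covectorInChart_charBracket hf hP hσ (hτ.add hυ) A hc, AdaptedChart.bracketInChart, hlift,
    koszulForm_add (A.differentiableAt_liftInChart hτ.smooth hu)
      (A.differentiableAt_liftInChart hυ.smooth hu)]
  exact congrArg₂ (· + ·) (covectorInChart_charBracket hf hP hσ hτ A hc).symm
    (covectorInChart_charBracket hf hP hσ hυ A hc).symm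

lemma charBracket_swap : charBracket sharp hf σ τ = -charBracket sharp hf τ σ := by
  funext c
  obtain ⟨A, hc⟩ := exists_adaptedChart hf c
  refine covectorInChart_injective A.e_mem (A.mapsTo c hc) ?_
  rw [Pi.neg_apply, covectorInChart_neg, covectorInChart_charBracket hf hP hσ hτ A hc,
    covectorInChart_charBracket hf hP hτ hσ A hc]
  exact koszulForm_swap (A.differentiableAt_contractionInChart hP.smooth (A.d.map_source hc))
    (.of_forall (isSkew_contractionInChart hP.skew))

lemma charBracket_smul_fun {h : C → ℝ} (hh : SmoothFunOn F h Set.univ) (c : C) :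
    charBracket sharp hf σ (fun c => h c • τ c) c = h c • charBracket sharp hf σ τ c +
      (dfun (E := F) h c (charAnchor sharp hf c ⟨σ c, hσ.mem c⟩) : ℝ) • τ c := by
  obtain ⟨A, hc⟩ := exists_adaptedChart hf c
  have hlift : A.liftInChart (fun c => h c • τ c) =
      fun y => h (A.d.symm (A.ρ y)) • A.liftInChart τ y := rfl
  refine covectorInChart_injective A.e_mem (A.mapsTo c hc) ?_
  rw [covectorInChart_add, covectorInChart_smul, covectorInChart_smul,
    covectorInChart_charBracket hf hP hσ (hτ.smul_fun hh) A hc,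
    covectorInChart_charBracket hf hP hσ hτ A hc, AdaptedChart.bracketInChart, hlift,
    koszulForm_smul (A.differentiableAt_comp_symm_ρ hh hc)
      (A.differentiableAt_liftInChart hτ.smooth (A.d.map_source hc)),
    A.contractionInChart_liftInChart hf hσ.mem hc, A.fderiv_comp_symm_ρ hh hc, A.liftInChart_ι,
    A.sectionInChart_apply _ hc, A.ρ_ι, A.d.left_inv hc]
  rfl

lemma AdaptedChart.bracketInChart_charBracket (A : AdaptedChart (E := E) (F := F) f)
    (hυ : IsSection F f (charConormal F sharp f) υ) {u : F} (hu : u ∈ A.d.target) :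
    A.bracketInChart sharp σ (charBracket sharp hf τ υ) u =
      koszulForm (contractionInChart A.e sharp) (A.liftInChart σ)
        (koszulForm (contractionInChart A.e sharp) (A.liftInChart τ) (A.liftInChart υ))
        (A.ι u) := by
  have hinner := ((A.contDiffOn_koszulForm_liftInChart hP.smooth hτ.smooth hυ.smooth).contDiffAt
    (A.isOpen_target_inter_preimage_ρ.mem_nhds
      (A.ι_mem_target_inter_preimage_ρ hu))).differentiableAt (by simp)
  refine A.bracketInChart_eq_koszulForm hσ (isSection_charBracket hf hP hτ hυ) hu
    (A.differentiableAt_liftInChart hσ.smooth hu) hinner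
    (.of_forall fun x => A.liftInChart_ι σ x) ?_
  filter_upwards [A.d.open_target.mem_nhds hu] with x hx
    using (sectionInChart_charBracket hf hP hτ hυ A hx).symm

lemma charBracket_jacobi (hυ : IsSection F f (charConormal F sharp f) υ) :
    charBracket sharp hf σ (charBracket sharp hf τ υ) +
      charBracket sharp hf τ (charBracket sharp hf υ σ) +
        charBracket sharp hf υ (charBracket sharp hf σ τ) = 0 := by
  funext c
  obtain ⟨A, hc⟩ := exists_adaptedChart hf c
  have hu := A.d.map_source hc
  refine covectorInChart_injective A.e_mem (A.mapsTo c hc) ?_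
  simp only [Pi.add_apply, covectorInChart_add]
  rw [covectorInChart_charBracket hf hP hσ (isSection_charBracket hf hP hτ hυ) A hc,
    covectorInChart_charBracket hf hP hτ (isSection_charBracket hf hP hυ hσ) A hc,
    covectorInChart_charBracket hf hP hυ (isSection_charBracket hf hP hσ hτ) A hc,
    A.bracketInChart_charBracket hf hP hσ hτ hυ hu, A.bracketInChart_charBracket hf hP hτ hυ hσ hu,
    A.bracketInChart_charBracket hf hP hυ hσ hτ hu]
  have htwo : (2 : WithTop ℕ∞) ≤ ∞ := WithTop.coe_le_coe.2 le_top
  exact koszulForm_jacobi ((A.contDiffAt_contractionInChart hP.smooth hu).of_le htwo)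
    (.of_forall (isSkew_contractionInChart hP.skew))
    (Filter.eventually_of_mem (A.e.open_target.mem_nhds (A.ι_mem_target hu))
      fun _ hy => hP.jacobiAt_contractionInChart A.e_mem hy)
    ((A.contDiffAt_liftInChart hσ.smooth hu).of_le htwo)
    ((A.contDiffAt_liftInChart hτ.smooth hu).of_le htwo)
    ((A.contDiffAt_liftInChart hυ.smooth hu).of_le htwo)

end BracketLaws

variable [IsManifold 𝓘(ℝ, F) ∞ C]

/-- The Lie algebroid structure on `N*C ∩ ♯⁻¹TC` induced by that of `T*P`. -/
def charAlgebroid (hf : IsImmersion 𝓘(ℝ, F) 𝓘(ℝ, E) ∞ f) (hP : IsPoisson sharp) :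
    LieAlgebroid F f (charConormal F sharp f) where
  anchor := charAnchor sharp hf
  bracket := charBracket sharp hf
  anchor_smooth _ hσ := smoothFieldOn_charAnchor hf hP.smooth hσ
  bracket_isSection _ _ hσ hτ := isSection_charBracket hf hP hσ hτ
  add _ _ _ hσ hτ hυ := charBracket_add hf hP hσ hτ hυ
  skew _ _ hσ hτ := charBracket_swap hf hP hσ hτ
  jacobi _ _ _ hσ hτ hυ := charBracket_jacobi hf hP hσ hτ hυ
  leibniz _ _ hσ hτ _ hh c := charBracket_smul_fun hf hP hσ hτ hh c

lemma isInduced_charAlgebroid (hf : IsImmersion 𝓘(ℝ, F) 𝓘(ℝ, E) ∞ f) (hP : IsPoisson sharp) :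
    (charAlgebroid hf hP).IsInduced sharp where
  anchor c ξ := mfderiv_charAnchor hf c ξ
  bracket σ τ hσ hτ U α β Z hU hα hβ hZ hασ hβτ c hc := by
    have hfU : f ⁻¹' U ∈ 𝓝 c := hf.contMDiff.continuous.continuousAt (hU.mem_nhds hc)
    exact charBracket_apply_eq_koszul hf hP hσ hτ
      ⟨⟨U, hU, hc, hα⟩, Filter.eventually_of_mem hfU hασ⟩
      ⟨⟨U, hU, hc, hβ⟩, Filter.eventually_of_mem hfU hβτ⟩ hU hc hZ

end CharAlgebroid

section Annihilator

variable {E : Type*} [NormedAddCommGroup E] [NormedSpace ℝ E] [FiniteDimensional ℝ E]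
  {P : Type*} [TopologicalSpace P] [ChartedSpace E P]

instance instFiniteDimensionalTan (x : P) : FiniteDimensional ℝ (Tan E x) :=
  inferInstanceAs (FiniteDimensional ℝ E)

instance instT2SpaceTan (x : P) : T2Space (Tan E x) := inferInstanceAs (T2Space E)

lemma mem_of_forall_mem_ann {x : P} {W : Submodule ℝ (Tan E x)} {v : Tan E x}
    (h : ∀ ξ ∈ ann W, ξ v = 0) : v ∈ W :=
  (Subspace.forall_mem_dualAnnihilator_apply_eq_zero_iff W v).1 fun φ hφ =>
    h (LinearMap.toContinuousLinearMap φ) fun w hw => (Submodule.mem_dualAnnihilator φ).1 hφ w hw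

lemma finrank_add_finrank_ann {x : P} (W : Submodule ℝ (Tan E x)) :
    Module.finrank ℝ W + Module.finrank ℝ (ann W) = Module.finrank ℝ E := by
  let toCot : Module.Dual ℝ (Tan E x) ≃ₗ[ℝ] Cot E x := LinearMap.toContinuousLinearMap
  have hann : ann W = W.dualAnnihilator.map toCot.toLinearMap := by
    ext ξ
    refine Iff.trans ?_ (Submodule.mem_map_equiv (e := toCot) _).symm
    exact (Submodule.mem_dualAnnihilator (toCot.symm ξ)).symm
  rw [hann, LinearEquiv.finrank_map_eq]
  exact Subspace.finrank_add_finrank_dualAnnihilator_eq W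

variable {F : Type*} [NormedAddCommGroup F] [NormedSpace ℝ F]
  {C : Type*} [TopologicalSpace C] [ChartedSpace F C]
  {sharp : ∀ x : P, Cot E x →L[ℝ] Tan E x}

lemma charConormal_eq_ann (hskew : ∀ (x : P) (α β : Cot E x), β (sharp x α) = -α (sharp x β))
    (f : C → P) (c : C) :
    charConormal F sharp f c = ann (tangentAlong F f c ⊔ sharpConormal F sharp f c) := by
  ext ξ
  constructor
  · rintro ⟨hξ, hsharp⟩ v hv
    obtain ⟨w, hw, _, ⟨η, hη, rfl⟩, rfl⟩ := Submodule.mem_sup.1 hv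
    have hηξ : η (sharp (f c) ξ) = 0 := hη _ hsharp
    have hξη : ξ (sharp (f c) η) = 0 := by rw [hskew, hηξ, neg_zero]
    exact (map_add ξ _ _).trans ((congrArg₂ (· + ·) (hξ w hw) hξη).trans (add_zero _))
  · intro h
    refine ⟨fun v hv => h v (Submodule.mem_sup_left hv), ?_⟩
    change sharp (f c) ξ ∈ tangentAlong F f c
    refine mem_of_forall_mem_ann fun η hη => ?_
    have hξη : ξ (sharp (f c) η) = 0 := h _ (Submodule.mem_sup_right ⟨η, hη, rfl⟩)
    exact (hskew (f c) ξ η).trans (by rw [hξη, neg_zero])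

lemma finrank_add_finrank_charConormal
    (hskew : ∀ (x : P) (α β : Cot E x), β (sharp x α) = -α (sharp x β)) (f : C → P) (c : C) :
    Module.finrank ℝ ↥(tangentAlong F f c ⊔ sharpConormal F sharp f c)
      + Module.finrank ℝ (charConormal F sharp f c) = Module.finrank ℝ E := by
  rw [charConormal_eq_ann hskew, finrank_add_finrank_ann]

end Annihilator

section ConstantRank

variable {E : Type*} [NormedAddCommGroup E] [NormedSpace ℝ E]
  {P : Type*} [TopologicalSpace P] [ChartedSpace E P]
  {F : Type*} [NormedAddCommGroup F] [NormedSpace ℝ F]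
  {C : Type*} [TopologicalSpace C] [ChartedSpace F C]
  {sharp : ∀ x : P, Cot E x →L[ℝ] Tan E x} {f : C → P}

/-- The linear equivalence of a cotangent space with the dual of the model space given by a
chart. -/
def covectorInChartEquiv {e : OpenPartialHomeomorph P E}
    (he : e ∈ IsManifold.maximalAtlas 𝓘(ℝ, E) ∞ P) {x : P} (hx : x ∈ e.source) :
    Cot E x ≃ₗ[ℝ] (E →L[ℝ] ℝ) where
  toFun := covectorInChart e
  map_add' := covectorInChart_add
  map_smul' := covectorInChart_smul
  invFun := covectorOfChart e x
  left_inv := covectorOfChart_covectorInChart he hx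
  right_inv := covectorInChart_covectorOfChart he hx

lemma AdaptedChart.map_charCovectors_eq_charConormal (A : AdaptedChart (E := E) (F := F) f) {c : C}
    (hc : c ∈ A.d.source) :
    (charCovectors (contractionInChart A.e sharp (A.ι (A.d c))) A.ι).map
      (covectorInChartEquiv A.e_mem (A.mapsTo c hc)).symm.toLinearMap =
        charConormal F sharp f c := by
  ext ξ
  rw [A.mem_charConormal_iff sharp hc]
  exact Submodule.mem_map_equiv (e := (covectorInChartEquiv A.e_mem (A.mapsTo c hc)).symm) _

lemma AdaptedChart.finrank_ker_charMap (A : AdaptedChart (E := E) (F := F) f) {u : F}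
    (hu : u ∈ A.d.target) :
    Module.finrank ℝ (charMap (contractionInChart A.e sharp (A.ι u)) A.ι A.ρ).ker =
      Module.finrank ℝ (charConormal F sharp f (A.d.symm u)) := by
  rw [← A.map_charCovectors_eq_charConormal (A.d.map_target hu), LinearEquiv.finrank_map_eq,
    A.d.right_inv hu, ker_charMap A.ρ_ι]

variable [IsManifold 𝓘(ℝ, E) ∞ P]

lemma IsSmoothSubbundle.exists_finrank_eq {B : ∀ c, Submodule ℝ (Cot E (f c))}
    (hB : IsSmoothSubbundle F f B) :
    ∃ k, ∀ c, Module.finrank ℝ (B c) = k := by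
  obtain ⟨k, hk⟩ := hB
  refine ⟨k, fun c => ?_⟩
  obtain ⟨U, -, hcU, s, -, hs⟩ := hk c
  rw [← (hs c hcU).2, finrank_span_eq_card (hs c hcU).1, Fintype.card_fin]

lemma AdaptedChart.contDiffOn_charMap [FiniteDimensional ℝ E]
    (A : AdaptedChart (E := E) (F := F) f) (hs : SmoothContraction sharp) :
    ContDiffOn ℝ ∞ (fun u => charMap (contractionInChart A.e sharp (A.ι u)) A.ι A.ρ)
      A.d.target := by
  have hcontraction : ContDiffOn ℝ ∞ (fun u => contractionInChart A.e sharp (A.ι u)) A.d.target :=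
    (contDiffOn_contractionInChart A.e_mem hs).comp A.ι.contDiff.contDiffOn
      fun _ hu => A.ι_mem_target hu
  exact contDiffOn_clm_apply.2 fun a => contDiffOn_const.prodMk
    ((ContinuousLinearMap.id ℝ E - A.ι.comp A.ρ).contDiff.comp_contDiffOn
      (hcontraction.clm_apply contDiffOn_const))

variable [FiniteDimensional ℝ E]

lemma isSmoothSubbundle_charConormal (hf : IsImmersion 𝓘(ℝ, F) 𝓘(ℝ, E) ∞ f)
    (hs : SmoothContraction sharp) {k : ℕ}
    (hk : ∀ c, Module.finrank ℝ (charConormal F sharp f c) = k) :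
    IsSmoothSubbundle F f (charConormal F sharp f) := by
  refine ⟨k, fun c₀ => ?_⟩
  obtain ⟨A, hc₀⟩ := exists_adaptedChart hf c₀
  obtain ⟨W, -, hW, hcW, s, hsmooth, hframe⟩ :=
    exists_smooth_frame_ker A.d.open_target (A.contDiffOn_charMap hs)
      (fun u hu => (A.finrank_ker_charMap hu).trans (hk _)) (A.d.map_source hc₀)
  refine ⟨A.d.source ∩ A.d ⁻¹' W, A.d.isOpen_inter_preimage hW, ⟨hc₀, hcW⟩,
    fun i => A.sectionOfChart (s i), fun i => A.smoothAlongOn_sectionOfChart (hsmooth i),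
    fun c hc => ?_⟩
  obtain ⟨hindep, hspan⟩ := hframe (A.d c) hc.2
  refine ⟨hindep.map' (covectorInChartEquiv A.e_mem (A.mapsTo c hc.1)).symm.toLinearMap
    (LinearEquiv.ker _), ?_⟩
  rw [← A.map_charCovectors_eq_charConormal hc.1, ← ker_charMap A.ρ_ι, ← hspan,
    Submodule.map_span, ← Set.range_comp]
  rfl

lemma isLieSubalgebroid_charConormal_iff [IsManifold 𝓘(ℝ, F) ∞ C]
    (hf : IsImmersion 𝓘(ℝ, F) 𝓘(ℝ, E) ∞ f) (hP : IsPoisson sharp) :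
    IsLieSubalgebroid F sharp f (charConormal F sharp f) ↔ IsPrePoisson F sharp f := by
  have hrank := finrank_add_finrank_charConormal (F := F) hP.skew f
  constructor
  · rintro ⟨hB, -⟩
    obtain ⟨k, hk⟩ := hB.exists_finrank_eq
    exact ⟨Module.finrank ℝ E - k, fun c => by have := hrank c; have := hk c; omega⟩
  · rintro ⟨k, hk⟩
    exact ⟨isSmoothSubbundle_charConormal hf hP.smooth (k := Module.finrank ℝ E - k)
      fun c => by have := hrank c; have := hk c; omega, _, isInduced_charAlgebroid hf hP⟩

end ConstantRank

section Cosymplectic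

variable {E : Type*} [NormedAddCommGroup E] [NormedSpace ℝ E]
  {P : Type*} [TopologicalSpace P] [ChartedSpace E P]
  {G : Type*} [NormedAddCommGroup G] [NormedSpace ℝ G]
  {Q : Type*} [TopologicalSpace Q] [ChartedSpace G Q]
  {sharp : ∀ x : P, Cot E x →L[ℝ] Tan E x} {j : Q → P}

variable {F : Type*} [NormedAddCommGroup F] [NormedSpace ℝ F]
  {C : Type*} [TopologicalSpace C] [ChartedSpace F C] {g : C → Q} {V : Set C}

lemma SmoothAlongOn.comp_mfderiv [IsManifold 𝓘(ℝ, E) ∞ P] [FiniteDimensional ℝ G]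
    [IsManifold 𝓘(ℝ, G) ∞ Q] (hj : ContMDiff 𝓘(ℝ, G) 𝓘(ℝ, E) ∞ j)
    (hg : ContMDiffOn 𝓘(ℝ, F) 𝓘(ℝ, G) ∞ g V) {σ : ∀ c, Cot E (j (g c))}
    (hσ : SmoothAlongOn F (fun c => j (g c)) σ V) :
    SmoothAlongOn F g (fun c => (σ c).comp (mfderiv 𝓘(ℝ, G) 𝓘(ℝ, E) j (g c))) V :=
  smoothAlongOn_of_apply hg fun _ hU _ hX => (hσ.mono hU).apply
    (hX.tangentMap isOpen_univ hj.contMDiffOn (Set.mapsTo_univ _ _))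

namespace AdaptedChart

lemma range_sup_map_conormalSpace (A : AdaptedChart (E := E) (F := G) j) {q : Q}
    (hcos : IsCosymplectic G sharp j) (hq : q ∈ A.d.source) :
    A.ι.range ⊔
      (conormalSpace A.ι).map (contractionInChart A.e sharp (A.ι (A.d q))).toLinearMap = ⊤ := by
  refine eq_top_iff.2 fun v _ => ?_
  obtain ⟨_, ⟨w, rfl⟩, _, ⟨ξ, hξ, rfl⟩, hsum⟩ := Submodule.mem_sup.1
    ((hcos q).sup_eq_top.ge (Submodule.mem_top (x := chartDerivSymm A.e (A.e (j q)) v)))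
  refine Submodule.mem_sup.2 ⟨A.ι (chartDeriv A.d q w), ⟨_, rfl⟩, _,
    ⟨covectorInChart A.e ξ, (A.mem_conormal_iff hq ξ).1 hξ, rfl⟩, ?_⟩
  calc A.ι (chartDeriv A.d q w)
        + contractionInChart A.e sharp (A.ι (A.d q)) (covectorInChart A.e ξ)
    _ = chartDeriv A.e (j q) (mfderiv 𝓘(ℝ, G) 𝓘(ℝ, E) j q w)
          + chartDeriv A.e (j q) (sharp (j q) ξ) := by
      rw [A.chartDeriv_mfderiv hq, ← A.apply_eq q hq,
        contractionInChart_covectorInChart A.e_mem (A.mapsTo q hq)]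
    _ = chartDeriv A.e (j q) (mfderiv 𝓘(ℝ, G) 𝓘(ℝ, E) j q w + sharp (j q) ξ) :=
      (map_add _ _ _).symm
    _ = chartDeriv A.e (j q) (chartDerivSymm A.e (A.e (j q)) v) := congrArg _ hsum
    _ = v := chartDeriv_chartDerivSymm A.e_mem (A.mapsTo q hq) v

end AdaptedChart

variable [FiniteDimensional ℝ E]

lemma isSkew_inducedSharp (hskew : ∀ (x : P) (α β : Cot E x), β (sharp x α) = -α (sharp x β))
    (q : Q) (α β : Cot G q) :
    β (inducedSharp (F := G) sharp j q α) = -α (inducedSharp (F := G) sharp j q β) :=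
  hskew (j q) (α.comp (cosymplecticProj (F := G) sharp j q))
    (β.comp (cosymplecticProj (F := G) sharp j q))

namespace AdaptedChart

variable (A : AdaptedChart (E := E) (F := G) j)

variable (sharp) in
/-- The expression of `cosymplecticProj` in an adapted chart. -/
def projInChart (u : G) : E →L[ℝ] G :=
  (chartDeriv A.d (A.d.symm u)).comp
    ((cosymplecticProj (F := G) sharp j (A.d.symm u)).comp
      (chartDerivSymm A.e (A.e (j (A.d.symm u)))))

lemma projInChart_chartDeriv {q : Q} (hq : q ∈ A.d.source) (v : Tan E (j q)) :
    A.projInChart sharp (A.d q) (chartDeriv A.e (j q) v) =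
      chartDeriv A.d q (cosymplecticProj (F := G) sharp j q v) := by
  rw [projInChart, A.d.left_inv hq]
  exact congrArg (fun v : Tan E (j q) => chartDeriv A.d q (cosymplecticProj (F := G) sharp j q v))
    (chartDerivSymm_chartDeriv A.e_mem (A.mapsTo q hq) v)

end AdaptedChart

section Pointwise

variable (hj : IsImmersion 𝓘(ℝ, G) 𝓘(ℝ, E) ∞ j) (hcos : IsCosymplectic G sharp j) {q : Q}
include hj hcos

lemma cosymplecticProj_mfderiv (w : Tan G q) :
    cosymplecticProj (F := G) sharp j q (mfderiv 𝓘(ℝ, G) 𝓘(ℝ, E) j q w) = w := by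
  have h := And.intro (mfderiv_injective_of_isImmersion hj q) (hcos q)
  have hprojection : (tangentAlong G j q).projectionOnto (sharpConormal G sharp j q) h.2
      (mfderiv 𝓘(ℝ, G) 𝓘(ℝ, E) j q w) = LinearEquiv.ofInjective _ h.1 w :=
    Submodule.projectionOnto_apply_left h.2 (LinearEquiv.ofInjective _ h.1 w)
  rw [cosymplecticProj, dif_pos h]
  exact (congrArg (LinearEquiv.ofInjective _ h.1).symm hprojection).trans
    (LinearEquiv.symm_apply_apply _ w)

lemma cosymplecticProj_sharp {ξ : Cot E (j q)} (hξ : ξ ∈ conormal G j q) :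
    cosymplecticProj (F := G) sharp j q (sharp (j q) ξ) = 0 := by
  have h := And.intro (mfderiv_injective_of_isImmersion hj q) (hcos q)
  have hprojection : (tangentAlong G j q).projectionOnto (sharpConormal G sharp j q) h.2
      (sharp (j q) ξ) = 0 :=
    (Submodule.projectionOnto_apply_eq_zero_iff h.2).2 ⟨ξ, hξ, rfl⟩
  rw [cosymplecticProj, dif_pos h]
  exact (congrArg (LinearEquiv.ofInjective _ h.1).symm hprojection).trans (map_zero _)

lemma mfderiv_inducedSharp (hskew : ∀ (x : P) (α β : Cot E x), β (sharp x α) = -α (sharp x β))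
    (η : Cot G q) :
    mfderiv 𝓘(ℝ, G) 𝓘(ℝ, E) j q (inducedSharp (F := G) sharp j q η) =
      sharp (j q) (η.comp (cosymplecticProj (F := G) sharp j q)) := by
  have htangent : sharp (j q) (η.comp (cosymplecticProj (F := G) sharp j q)) ∈
      tangentAlong G j q := by
    refine mem_of_forall_mem_ann fun ξ hξ => ?_
    rw [hskew, neg_eq_zero]
    exact (congrArg η (cosymplecticProj_sharp hj hcos hξ)).trans (map_zero η)
  obtain ⟨w, hw⟩ := htangent
  have hinduced : inducedSharp (F := G) sharp j q η = w :=
    (congrArg (cosymplecticProj (F := G) sharp j q) hw.symm).trans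
      (cosymplecticProj_mfderiv hj hcos w)
  rw [hinduced]
  exact hw

lemma comp_mfderiv_comp_cosymplecticProj {ξ : Cot E (j q)}
    (hξ : ∀ η ∈ conormal G j q, ξ (sharp (j q) η) = 0) :
    (ξ.comp (mfderiv 𝓘(ℝ, G) 𝓘(ℝ, E) j q)).comp (cosymplecticProj (F := G) sharp j q) = ξ := by
  ext v
  obtain ⟨_, ⟨w, rfl⟩, _, ⟨η, hη, rfl⟩, rfl⟩ := Submodule.mem_sup.1
    ((hcos q).sup_eq_top.ge (Submodule.mem_top (x := v)))
  have hproj : cosymplecticProj (F := G) sharp j q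
      (mfderiv 𝓘(ℝ, G) 𝓘(ℝ, E) j q w + sharp (j q) η) = w := by
    rw [map_add, cosymplecticProj_mfderiv hj hcos, cosymplecticProj_sharp hj hcos hη, add_zero]
  refine (congrArg (fun w => ξ (mfderiv 𝓘(ℝ, G) 𝓘(ℝ, E) j q w)) hproj).trans ?_
  refine Eq.symm ((map_add ξ _ _).trans ?_)
  exact (congrArg _ (hξ η hη)).trans (add_zero _)

end Pointwise

namespace AdaptedChart

variable (A : AdaptedChart (E := E) (F := G) j) {u : G}

variable (hj : IsImmersion 𝓘(ℝ, G) 𝓘(ℝ, E) ∞ j) (hcos : IsCosymplectic G sharp j)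
include hj hcos

lemma isCosymplecticProjection_projInChart (hu : u ∈ A.d.target) :
    IsCosymplecticProjection (contractionInChart A.e sharp (A.ι u)) A.ι
      (A.projInChart sharp u) := by
  obtain ⟨q, hq, rfl⟩ : ∃ q ∈ A.d.source, A.d q = u := ⟨_, A.d.map_target hu, A.d.right_inv hu⟩
  refine ⟨fun z => ?_, fun k hk => ?_⟩
  · have hz := A.chartDeriv_mfderiv hq (chartDerivSymm A.d (A.d q) z)
    rw [chartDeriv_chartDerivSymm A.d_mem hq] at hz
    rw [← hz, A.projInChart_chartDeriv hq]
    exact (congrArg (chartDeriv A.d q) (cosymplecticProj_mfderiv hj hcos _)).trans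
      (chartDeriv_chartDerivSymm A.d_mem hq z)
  · have hcov := covectorInChart_covectorOfChart A.e_mem (A.mapsTo q hq) k
    have hconormal : covectorOfChart A.e (j q) k ∈ conormal G j q := by
      rwa [A.mem_conormal_iff hq, hcov]
    rw [← hcov, ← A.apply_eq q hq, contractionInChart_covectorInChart A.e_mem (A.mapsTo q hq),
      A.projInChart_chartDeriv hq, cosymplecticProj_sharp hj hcos hconormal]
    exact map_zero (chartDeriv A.d q)

lemma contDiffOn_projInChart [IsManifold 𝓘(ℝ, E) ∞ P] (hs : SmoothContraction sharp) :
    ContDiffOn ℝ ∞ (A.projInChart sharp) A.d.target := by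
  have := A.finiteDimensional_source
  refine contDiffOn_cosymplecticProjection A.ρ_ι
    ((contDiffOn_contractionInChart A.e_mem hs).comp A.ι.contDiff.contDiffOn
      fun _ hu => A.ι_mem_target hu)
    (fun _ hu => A.isCosymplecticProjection_projInChart hj hcos hu) fun u hu => ?_
  simpa only [A.d.right_inv hu, Function.comp_apply] using
    A.range_sup_map_conormalSpace hcos (A.d.map_target hu)

end AdaptedChart

variable [IsManifold 𝓘(ℝ, E) ∞ P] [IsManifold 𝓘(ℝ, G) ∞ Q]

variable (hj : IsImmersion 𝓘(ℝ, G) 𝓘(ℝ, E) ∞ j) (hcos : IsCosymplectic G sharp j)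
include hj hcos

lemma SmoothFieldAlongOn.cosymplecticProj (hs : SmoothContraction sharp)
    (hg : ContMDiffOn 𝓘(ℝ, F) 𝓘(ℝ, G) ∞ g V) {X : ∀ c, Tan E (j (g c))}
    (hX : SmoothFieldAlongOn F (fun c => j (g c)) X V) :
    SmoothFieldAlongOn F g (fun c => cosymplecticProj (F := G) sharp j (g c) (X c)) V := by
  intro c hc
  obtain ⟨A, hgc⟩ := exists_adaptedChart hj (g c)
  have hsubset : V ∩ g ⁻¹' A.d.source ⊆ V := Set.inter_subset_left
  have hnhds : V ∩ g ⁻¹' A.d.source ∈ 𝓝[V] c := Filter.inter_mem self_mem_nhdsWithin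
    ((hg c hc).continuousWithinAt (A.d.open_source.mem_nhds hgc))
  have hXchart := (smoothFieldAlongOn_iff A.e_mem (hX.contMDiffOn_base.mono hsubset)
    fun c hc => A.mapsTo _ hc.2).1 (hX.mono hsubset)
  have hprojchart : ContMDiffOn 𝓘(ℝ, F) 𝓘(ℝ, E →L[ℝ] G) ∞
      (fun c => A.projInChart sharp (A.d (g c))) (V ∩ g ⁻¹' A.d.source) :=
    (A.contDiffOn_projInChart hj hcos hs).contMDiffOn.comp
      ((contMDiffOn_of_mem_maximalAtlas A.d_mem).comp (hg.mono hsubset) fun _ hc => hc.2)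
      fun _ hc => A.d.map_source hc.2
  have hproj : SmoothFieldAlongOn F g
      (fun c => _root_.cosymplecticProj (F := G) sharp j (g c) (X c)) (V ∩ g ⁻¹' A.d.source) :=
    (smoothFieldAlongOn_iff A.d_mem (hg.mono hsubset) fun _ hc => hc.2).2
      ((hprojchart.clm_apply hXchart).congr fun c hc => (A.projInChart_chartDeriv hc.2 (X c)).symm)
  exact (hproj c ⟨hc, hgc⟩).mono_of_mem_nhdsWithin hnhds

lemma SmoothAlongOn.comp_cosymplecticProj (hs : SmoothContraction sharp)
    {τ : ∀ c, Cot G (g c)} (hτ : SmoothAlongOn F g τ V) :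
    SmoothAlongOn F (fun c => j (g c))
      (fun c => (τ c).comp (cosymplecticProj (F := G) sharp j (g c))) V :=
  smoothAlongOn_of_apply (hj.contMDiff.comp_contMDiffOn hτ.contMDiffOn_base) fun _ hU _ hX =>
    (hτ.mono hU).apply
      (SmoothFieldAlongOn.cosymplecticProj hj hcos hs (hτ.contMDiffOn_base.mono hU) hX)

end Cosymplectic

section Transport

variable {E : Type*} [NormedAddCommGroup E] [NormedSpace ℝ E]
  {P : Type*} [TopologicalSpace P] [ChartedSpace E P] [IsManifold 𝓘(ℝ, E) ∞ P]
  {G : Type*} [NormedAddCommGroup G] [NormedSpace ℝ G]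
  {Q : Type*} [TopologicalSpace Q] [ChartedSpace G Q] [IsManifold 𝓘(ℝ, G) ∞ Q]
  {F : Type*} [NormedAddCommGroup F] [NormedSpace ℝ F]
  {C : Type*} [TopologicalSpace C] [ChartedSpace F C]

variable (F) in
/-- Fibrewise linear maps of `T*P|_C` and `T*Q|_C` that restrict to mutually inverse isomorphisms
of the subbundles `B` and `B'` and preserve smoothness of sections. -/
structure SubbundleEquiv (f : C → P) (B : ∀ c, Submodule ℝ (Cot E (f c)))
    (g : C → Q) (B' : ∀ c, Submodule ℝ (Cot G (g c))) where
  res : ∀ c, Cot E (f c) →ₗ[ℝ] Cot G (g c)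
  ext : ∀ c, Cot G (g c) →ₗ[ℝ] Cot E (f c)
  ext_res : ∀ c, ∀ ξ ∈ B c, ext c (res c ξ) = ξ
  res_ext : ∀ c, ∀ η ∈ B' c, res c (ext c η) = η
  res_mem : ∀ c, ∀ ξ ∈ B c, res c ξ ∈ B' c
  ext_mem : ∀ c, ∀ η ∈ B' c, ext c η ∈ B c
  smooth_res : ∀ σ, IsSection F f B σ → SmoothAlongOn F g (fun c => res c (σ c)) Set.univ
  smooth_ext : ∀ τ, IsSection F g B' τ → SmoothAlongOn F f (fun c => ext c (τ c)) Set.univ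

namespace SubbundleEquiv

variable {f : C → P} {B : ∀ c, Submodule ℝ (Cot E (f c))}
  {g : C → Q} {B' : ∀ c, Submodule ℝ (Cot G (g c))} (Φ : SubbundleEquiv F f B g B')

lemma isSection_res {σ : ∀ c, Cot E (f c)} (hσ : IsSection F f B σ) :
    IsSection F g B' (fun c => Φ.res c (σ c)) :=
  ⟨fun c => Φ.res_mem c _ (hσ.mem c), Φ.smooth_res σ hσ⟩

lemma isSection_ext {τ : ∀ c, Cot G (g c)} (hτ : IsSection F g B' τ) :
    IsSection F f B (fun c => Φ.ext c (τ c)) :=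
  ⟨fun c => Φ.ext_mem c _ (hτ.mem c), Φ.smooth_ext τ hτ⟩

lemma ext_res_section {σ : ∀ c, Cot E (f c)} (hσ : IsSection F f B σ) :
    (fun c => Φ.ext c (Φ.res c (σ c))) = σ := funext fun c => Φ.ext_res c _ (hσ.mem c)

/-- The linear isomorphism of the fibres of the subbundles at `c`. -/
def fibreEquiv (c : C) : B c ≃ₗ[ℝ] B' c where
  toFun ξ := ⟨Φ.res c ξ, Φ.res_mem c ξ ξ.2⟩
  map_add' _ _ := Subtype.ext (map_add (Φ.res c) _ _)
  map_smul' r _ := Subtype.ext (map_smul (Φ.res c) r _)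
  invFun η := ⟨Φ.ext c η, Φ.ext_mem c η η.2⟩
  left_inv ξ := Subtype.ext (Φ.ext_res c ξ ξ.2)
  right_inv η := Subtype.ext (Φ.res_ext c η η.2)

variable [IsManifold 𝓘(ℝ, F) ∞ C] (L : LieAlgebroid F f B)

/-- The Lie algebroid structure transported along an isomorphism of subbundles. -/
def transport : LieAlgebroid F g B' where
  anchor c := L.anchor c ∘ₗ (Φ.fibreEquiv c).symm.toLinearMap
  bracket σ τ c := Φ.res c (L.bracket (fun c => Φ.ext c (σ c)) (fun c => Φ.ext c (τ c)) c)
  anchor_smooth σ hσ := L.anchor_smooth _ (Φ.isSection_ext hσ)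
  bracket_isSection σ τ hσ hτ :=
    Φ.isSection_res (L.bracket_isSection _ _ (Φ.isSection_ext hσ) (Φ.isSection_ext hτ))
  add σ τ₁ τ₂ hσ hτ₁ hτ₂ := by
    have hext : (fun c => Φ.ext c ((τ₁ + τ₂) c)) =
        (fun c => Φ.ext c (τ₁ c)) + fun c => Φ.ext c (τ₂ c) :=
      funext fun c => map_add (Φ.ext c) _ _
    funext c
    rw [hext, L.add _ _ _ (Φ.isSection_ext hσ) (Φ.isSection_ext hτ₁) (Φ.isSection_ext hτ₂)]
    exact map_add (Φ.res c) _ _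
  skew σ τ hσ hτ := by
    funext c
    rw [L.skew _ _ (Φ.isSection_ext hσ) (Φ.isSection_ext hτ)]
    exact map_neg (Φ.res c) _
  jacobi σ τ υ hσ hτ hυ := by
    have hσ' := Φ.isSection_ext hσ
    have hτ' := Φ.isSection_ext hτ
    have hυ' := Φ.isSection_ext hυ
    funext c
    rw [Φ.ext_res_section (L.bracket_isSection _ _ hτ' hυ'),
      Φ.ext_res_section (L.bracket_isSection _ _ hυ' hσ'),
      Φ.ext_res_section (L.bracket_isSection _ _ hσ' hτ')]
    have hres := congrArg (Φ.res c) (congrFun (L.jacobi _ _ _ hσ' hτ' hυ') c)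
    rwa [Pi.zero_apply, map_zero, Pi.add_apply, Pi.add_apply, map_add, map_add] at hres
  leibniz σ τ hσ hτ h hh c := by
    have hext : (fun c => Φ.ext c (h c • τ c)) = fun c => h c • Φ.ext c (τ c) :=
      funext fun c => map_smul (Φ.ext c) _ _
    rw [hext, L.leibniz _ _ (Φ.isSection_ext hσ) (Φ.isSection_ext hτ) h hh c, map_add, map_smul,
      map_smul, Φ.res_ext c _ (hτ.mem c)]
    rfl

/-- The isomorphism of a Lie algebroid with the transported one. -/
def transportIso : LieAlgebroid.Iso L (Φ.transport L) where
  toFun := Φ.fibreEquiv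
  smooth _ hσ := Φ.isSection_res hσ
  symm_smooth _ hτ := Φ.isSection_ext hτ
  anchor c ξ := congrArg (L.anchor c) ((Φ.fibreEquiv c).symm_apply_apply ξ)
  bracket σ τ hσ hτ c := by
    change Φ.res c (L.bracket σ τ c) = Φ.res c (L.bracket (fun c => Φ.ext c (Φ.res c (σ c)))
      (fun c => Φ.ext c (Φ.res c (τ c))) c)
    rw [Φ.ext_res_section hσ, Φ.ext_res_section hτ]

end SubbundleEquiv

end Transport

section CosymplecticAlgebroid

variable {E : Type*} [NormedAddCommGroup E] [NormedSpace ℝ E]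
  {P : Type*} [TopologicalSpace P] [ChartedSpace E P]
  {G : Type*} [NormedAddCommGroup G] [NormedSpace ℝ G]
  {Q : Type*} [TopologicalSpace Q] [ChartedSpace G Q]
  {F : Type*} [NormedAddCommGroup F] [NormedSpace ℝ F]
  {C : Type*} [TopologicalSpace C] [ChartedSpace F C]
  {sharp : ∀ x : P, Cot E x →L[ℝ] Tan E x} {j : Q → P} {g : C → Q}

section Composition

variable (hj : ContMDiff 𝓘(ℝ, G) 𝓘(ℝ, E) ∞ j) (hg : ContMDiff 𝓘(ℝ, F) 𝓘(ℝ, G) ∞ g) (c : C)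
include hj hg

lemma mfderiv_comp_eq_mfderiv_mfderiv (w : Tan F c) :
    mfderiv 𝓘(ℝ, F) 𝓘(ℝ, E) (fun c => j (g c)) c w =
      mfderiv 𝓘(ℝ, G) 𝓘(ℝ, E) j (g c) (mfderiv 𝓘(ℝ, F) 𝓘(ℝ, G) g c w) :=
  congrArg (fun T : F →L[ℝ] E => T w) (mfderiv_comp c
    ((hj (g c)).mdifferentiableAt (by simp)) ((hg c).mdifferentiableAt (by simp)))

lemma comp_mfderiv_mem_conormal_iff (ξ : Cot E (j (g c))) :
    ξ.comp (mfderiv 𝓘(ℝ, G) 𝓘(ℝ, E) j (g c)) ∈ conormal (E := G) F g c ↔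
      ξ ∈ conormal F (fun c => j (g c)) c := by
  constructor
  · rintro h _ ⟨w, rfl⟩
    exact (congrArg ξ (mfderiv_comp_eq_mfderiv_mfderiv hj hg c w)).trans (h _ ⟨w, rfl⟩)
  · rintro h _ ⟨w, rfl⟩
    exact (congrArg ξ (mfderiv_comp_eq_mfderiv_mfderiv hj hg c w)).symm.trans (h _ ⟨w, rfl⟩)

lemma conormal_le_conormal_comp :
    conormal (E := E) G j (g c) ≤ conormal F (fun c => j (g c)) c := by
  rintro ξ h _ ⟨w, rfl⟩
  exact (congrArg ξ (mfderiv_comp_eq_mfderiv_mfderiv hj hg c w)).trans (h _ ⟨_, rfl⟩)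

end Composition

lemma apply_sharp_eq_zero_of_mem_charConormal
    (hskew : ∀ (x : P) (α β : Cot E x), β (sharp x α) = -α (sharp x β)) {f : C → P} {c : C}
    {ξ η : Cot E (f c)} (hξ : ξ ∈ charConormal F sharp f c) (hη : η ∈ conormal F f c) :
    ξ (sharp (f c) η) = 0 := by
  rw [hskew, neg_eq_zero]
  exact hη _ hξ.2

lemma IsLocalExtension.comp_continuous [IsManifold 𝓘(ℝ, E) ∞ P] {τ : ∀ q, Cot E (j q)}
    {α : ∀ x : P, Cot E x} {c : C} (hα : IsLocalExtension j τ (g c) α) (hg : Continuous g)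
    {σ : ∀ c, Cot E (j (g c))} (hσ : ∀ᶠ c' in 𝓝 c, τ (g c') = σ c') :
    IsLocalExtension (fun c => j (g c)) σ c α :=
  ⟨hα.1, by filter_upwards [hg.continuousAt.eventually hα.2, hσ] with c' h h'; exact h.trans h'⟩

variable [FiniteDimensional ℝ E]

namespace AdaptedChart

variable (A : AdaptedChart (E := E) (F := G) j) {u : G}

lemma covectorOfChart_comp_cosymplecticProj {q : Q} (hq : q ∈ A.d.source) (a : G →L[ℝ] ℝ) :
    (covectorOfChart A.d q a).comp (cosymplecticProj (F := G) sharp j q) =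
      covectorOfChart A.e (j q) (a.comp (A.projInChart sharp (A.d q))) := by
  ext v
  exact congrArg a (A.projInChart_chartDeriv hq v).symm

lemma contractionInChart_inducedSharp (hu : u ∈ A.d.target) :
    contractionInChart A.d (inducedSharp (F := G) sharp j) u =
      inducedContraction (contractionInChart A.e sharp) A.ι (A.projInChart sharp) u := by
  obtain ⟨q, hq, rfl⟩ : ∃ q ∈ A.d.source, A.d q = u := ⟨_, A.d.map_target hu, A.d.right_inv hu⟩
  ext a
  calc contractionInChart A.d (inducedSharp (F := G) sharp j) (A.d q) a
    _ = chartDeriv A.d q (cosymplecticProj (F := G) sharp j q (sharp (j q)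
          ((covectorOfChart A.d q a).comp (cosymplecticProj (F := G) sharp j q)))) :=
      contractionInChart_apply hq _ a
    _ = A.projInChart sharp (A.d q) (chartDeriv A.e (j q) (sharp (j q)
          (covectorOfChart A.e (j q) (a.comp (A.projInChart sharp (A.d q)))))) := by
      rw [A.projInChart_chartDeriv hq, A.covectorOfChart_comp_cosymplecticProj hq]
    _ = A.projInChart sharp (A.d q) (contractionInChart A.e sharp (A.ι (A.d q))
          (a.comp (A.projInChart sharp (A.d q)))) := by
      rw [← contractionInChart_apply (A.mapsTo q hq), A.apply_eq q hq]

lemma contractionInChart_inducedSharp_eventuallyEq (hu : u ∈ A.d.target) :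
    contractionInChart A.d (inducedSharp (F := G) sharp j) =ᶠ[𝓝 u]
      inducedContraction (contractionInChart A.e sharp) A.ι (A.projInChart sharp) :=
  Filter.eventually_of_mem (A.d.open_target.mem_nhds hu)
    fun _ hu => A.contractionInChart_inducedSharp hu

lemma sectionInChart_comp_cosymplecticProj (hu : u ∈ A.d.target) (α : ∀ q : Q, Cot G q) :
    A.sectionInChart (fun q => (α q).comp (cosymplecticProj (F := G) sharp j q)) u =
      (formInChart A.d α u).comp (A.projInChart sharp u) := by
  obtain ⟨q, hq, rfl⟩ : ∃ q ∈ A.d.source, A.d q = u := ⟨_, A.d.map_target hu, A.d.right_inv hu⟩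
  rw [A.sectionInChart_apply _ hq, formInChart_apply hq,
    ← covectorInChart_covectorOfChart A.e_mem (A.mapsTo q hq)
      ((covectorInChart A.d (α q)).comp _),
    ← A.covectorOfChart_comp_cosymplecticProj hq, covectorOfChart_covectorInChart A.d_mem hq]

end AdaptedChart

section Pointwise

variable (hj : IsImmersion 𝓘(ℝ, G) 𝓘(ℝ, E) ∞ j) (hcos : IsCosymplectic G sharp j) {q : Q}
include hj hcos

lemma comp_cosymplecticProj_comp_mfderiv (η : Cot G q) :
    (η.comp (cosymplecticProj (F := G) sharp j q)).comp (mfderiv 𝓘(ℝ, G) 𝓘(ℝ, E) j q) = η := by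
  ext w
  exact congrArg η (cosymplecticProj_mfderiv hj hcos w)

lemma comp_cosymplecticProj_mem_charConormal
    (hskew : ∀ (x : P) (α β : Cot E x), β (sharp x α) = -α (sharp x β))
    (hg : ContMDiff 𝓘(ℝ, F) 𝓘(ℝ, G) ∞ g)
    (hcoi : IsCoisotropic F (inducedSharp (F := G) sharp j) g) {c : C} {η : Cot G (g c)}
    (hη : η ∈ conormal F g c) :
    η.comp (cosymplecticProj (F := G) sharp j (g c)) ∈
      charConormal F sharp (fun c => j (g c)) c := by
  refine ⟨(comp_mfderiv_mem_conormal_iff hj.contMDiff hg c _).1 ?_, ?_⟩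
  · rwa [comp_cosymplecticProj_comp_mfderiv hj hcos]
  · obtain ⟨w, hw⟩ := hcoi c ⟨η, hη, rfl⟩
    exact ⟨w, (mfderiv_comp_eq_mfderiv_mfderiv hj.contMDiff hg c w).trans
      ((congrArg (mfderiv 𝓘(ℝ, G) 𝓘(ℝ, E) j (g c)) hw).trans
        (mfderiv_inducedSharp hj hcos hskew η))⟩

end Pointwise

variable [IsManifold 𝓘(ℝ, E) ∞ P] [IsManifold 𝓘(ℝ, G) ∞ Q] [IsManifold 𝓘(ℝ, F) ∞ C]

/-- For `C` coisotropic in the cosymplectic submanifold `Q`, restriction of covectors to `TQ` as an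
isomorphism of `N*C ∩ ♯⁻¹TC` with the conormal bundle of `C` in `Q`; its inverse extends covectors
by zero on `♯N*Q`. -/
def restrictConormal (hskew : ∀ (x : P) (α β : Cot E x), β (sharp x α) = -α (sharp x β))
    (hs : SmoothContraction sharp) (hj : IsImmersion 𝓘(ℝ, G) 𝓘(ℝ, E) ∞ j)
    (hcos : IsCosymplectic G sharp j) (hg : ContMDiff 𝓘(ℝ, F) 𝓘(ℝ, G) ∞ g)
    (hcoi : IsCoisotropic F (inducedSharp (F := G) sharp j) g) :
    SubbundleEquiv F (fun c => j (g c)) (charConormal F sharp fun c => j (g c))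
      g (conormal (E := G) F g) where
  res c := (ContinuousLinearMap.precomp ℝ (mfderiv 𝓘(ℝ, G) 𝓘(ℝ, E) j (g c))).toLinearMap
  ext c := (ContinuousLinearMap.precomp ℝ (cosymplecticProj (F := G) sharp j (g c))).toLinearMap
  ext_res c _ hξ := comp_mfderiv_comp_cosymplecticProj hj hcos fun _ hη =>
    apply_sharp_eq_zero_of_mem_charConormal (f := fun c => j (g c)) hskew hξ
      (conormal_le_conormal_comp hj.contMDiff hg c hη)
  res_ext _ η _ := comp_cosymplecticProj_comp_mfderiv hj hcos η
  res_mem c ξ hξ := (comp_mfderiv_mem_conormal_iff hj.contMDiff hg c ξ).2 hξ.1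
  ext_mem _ _ hη := comp_cosymplecticProj_mem_charConormal hj hcos hskew hg hcoi hη
  smooth_res _ hσ c hc := by
    obtain ⟨A, -⟩ := exists_adaptedChart hj (g c)
    have := A.finiteDimensional_source
    exact SmoothAlongOn.comp_mfderiv hj.contMDiff hg.contMDiffOn hσ.smooth c hc
  smooth_ext _ hτ := SmoothAlongOn.comp_cosymplecticProj hj hcos hs hτ.smooth

section Koszul

variable (hj : IsImmersion 𝓘(ℝ, G) 𝓘(ℝ, E) ∞ j) (hcos : IsCosymplectic G sharp j)
  (hs : SmoothContraction sharp)
include hj hcos hs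

lemma smoothFieldOn_inducedSharp {α : ∀ q : Q, Cot G q} {U : Set Q} (hα : SmoothFormOn α U) :
    SmoothFieldOn (fun q => inducedSharp (F := G) sharp j q (α q)) U :=
  SmoothFieldAlongOn.cosymplecticProj (g := fun q => q) hj hcos hs contMDiffOn_id
    ((SmoothAlongOn.comp_cosymplecticProj (g := fun q => q) hj hcos hs hα).sharp hs)

lemma koszul_eq_koszul_inducedSharp
    (hskew : ∀ (x : P) (α β : Cot E x), β (sharp x α) = -α (sharp x β))
    {U : Set Q} (hU : IsOpen U) {q : Q} (hq : q ∈ U) {α β : ∀ q : Q, Cot G q}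
    {Z : ∀ q : Q, Tan G q} (hα : SmoothFormOn α U) (hβ : SmoothFormOn β U)
    (hZ : SmoothFieldOn Z U) {α' β' : ∀ x : P, Cot E x}
    (hα' : IsLocalExtension j (fun q => (α q).comp (cosymplecticProj (F := G) sharp j q)) q α')
    (hβ' : IsLocalExtension j (fun q => (β q).comp (cosymplecticProj (F := G) sharp j q)) q β')
    {O : Set P} (hO : IsOpen O) (hqO : j q ∈ O) {Z' : ∀ x : P, Tan E x} (hZ' : SmoothFieldOn Z' O)
    (hZZ' : Z' (j q) = mfderiv 𝓘(ℝ, G) 𝓘(ℝ, E) j q (Z q)) :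
    koszul sharp α' β' Z' (j q) = koszul (inducedSharp (F := G) sharp j) α β Z q := by
  obtain ⟨A, hA⟩ := exists_adaptedChart hj q
  have := A.finiteDimensional_source
  have hu : A.d q ∈ A.d.target := A.d.map_source hA
  have hS := A.differentiableAt_contractionInChart hs hu
  have hp : DifferentiableAt ℝ (A.projInChart sharp) (A.d q) :=
    ((A.contDiffOn_projInChart hj hcos hs).contDiffAt
      (A.d.open_target.mem_nhds hu)).differentiableAt (by simp)
  have hS' := A.contractionInChart_inducedSharp_eventuallyEq (sharp := sharp) hu
  have hrestrict {γ : ∀ q : Q, Cot G q} {γ' : ∀ x : P, Cot E x} (hγ' : IsLocalExtension j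
      (fun q => (γ q).comp (cosymplecticProj (F := G) sharp j q)) q γ') :
      ∀ᶠ u in 𝓝 (A.d q), formInChart A.e γ' (A.ι u) =
        (formInChart A.d γ u).comp (A.projInChart sharp u) := by
    filter_upwards [A.formInChart_ι_eventuallyEq hA hγ'.2, A.d.open_target.mem_nhds hu]
      with u hγu hu
    rw [hγu, A.sectionInChart_comp_cosymplecticProj hu]
  rw [A.koszul_eq_koszulForm_of_isLocalExtension hskew hs hA hα' hβ' hO hqO hZ', hZZ',
    A.chartDeriv_mfderiv hA,
    koszul_eq_koszulForm_inChart A.d_mem hA hU hq (isSkew_inducedSharp hskew)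
      (hS'.differentiableAt_iff.2 (differentiableAt_inducedContraction hS hp)) hα hβ hZ
      (smoothFieldOn_inducedSharp hj hcos hs hα) (smoothFieldOn_inducedSharp hj hcos hs hβ),
    koszulForm_congr_sharp hS']
  exact koszulForm_inducedContraction hS (isSkew_contractionInChart hskew _) hp
    (Filter.eventually_of_mem (A.d.open_target.mem_nhds hu)
      fun _ hu => A.isCosymplecticProjection_projInChart hj hcos hu)
    (differentiableAt_formInChart A.d_mem hA hU hq hα)
    (differentiableAt_formInChart A.d_mem hA hU hq hβ)
    (A.differentiableAt_formInChart_of_isLocalExtension hA hα')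
    (A.differentiableAt_formInChart_of_isLocalExtension hA hβ') (hrestrict hα') (hrestrict hβ') _

end Koszul

lemma isInduced_transport (hP : IsPoisson sharp) (hj : IsImmersion 𝓘(ℝ, G) 𝓘(ℝ, E) ∞ j)
    (hcos : IsCosymplectic G sharp j) (hg : ContMDiff 𝓘(ℝ, F) 𝓘(ℝ, G) ∞ g)
    (hcoi : IsCoisotropic F (inducedSharp (F := G) sharp j) g)
    (hf : IsImmersion 𝓘(ℝ, F) 𝓘(ℝ, E) ∞ fun c => j (g c)) :
    ((restrictConormal hP.skew hP.smooth hj hcos hg hcoi).transport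
      (charAlgebroid hf hP)).IsInduced (inducedSharp (F := G) sharp j) where
  anchor c η := mfderiv_injective_of_isImmersion hj (g c) <|
    (mfderiv_comp_eq_mfderiv_mfderiv hj.contMDiff hg c _).symm.trans <|
      (mfderiv_charAnchor hf c _).trans
        (mfderiv_inducedSharp hj hcos hP.skew (η : Cot G (g c))).symm
  bracket σ τ hσ hτ U α β Z hU hα hβ hZ hασ hβτ c hc := by
    obtain ⟨A, hA⟩ := exists_adaptedChart hj (g c)
    have hgU : g ⁻¹' U ∈ 𝓝 c := hg.continuous.continuousAt (hU.mem_nhds hc)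
    have hα' := A.isLocalExtension_extend hU hc
      (SmoothAlongOn.comp_cosymplecticProj (g := fun q => q) hj hcos hP.smooth hα) hA
    have hβ' := A.isLocalExtension_extend hU hc
      (SmoothAlongOn.comp_cosymplecticProj (g := fun q => q) hj hcos hP.smooth hβ) hA
    have hZ' := smoothFieldOn_chartDerivSymm A.e_mem (A.ι (chartDeriv A.d (g c) (Z (g c))))
    have hZZ' := (A.mfderiv_eq hA (Z (g c))).symm
    have hbracket := charBracket_apply_eq_koszul hf hP
      ((restrictConormal hP.skew hP.smooth hj hcos hg hcoi).isSection_ext hσ)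
      ((restrictConormal hP.skew hP.smooth hj hcos hg hcoi).isSection_ext hτ)
      (hα'.comp_continuous hg.continuous (Filter.eventually_of_mem hgU fun c' hc' => by
        rw [hασ c' hc']; rfl))
      (hβ'.comp_continuous hg.continuous (Filter.eventually_of_mem hgU fun c' hc' => by
        rw [hβτ c' hc']; rfl))
      A.e.open_source (A.mapsTo _ hA) hZ'
    rw [hZZ'] at hbracket
    exact hbracket.trans (koszul_eq_koszul_inducedSharp hj hcos hP.smooth hP.skew hU hc hα hβ hZ
      hα' hβ' A.e.open_source (A.mapsTo _ hA) hZ' hZZ')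

end CosymplecticAlgebroid

theorem mainTheorem6_general
    {E : Type*} [NormedAddCommGroup E] [NormedSpace ℝ E] [FiniteDimensional ℝ E]
    {P : Type*} [TopologicalSpace P] [ChartedSpace E P] [IsManifold 𝓘(ℝ, E) ∞ P]
    (sharp : ∀ x : P, Cot E x →L[ℝ] Tan E x) (hP : IsPoisson sharp)
    {F : Type*} [NormedAddCommGroup F] [NormedSpace ℝ F]
    {C : Type*} [TopologicalSpace C] [ChartedSpace F C] [IsManifold 𝓘(ℝ, F) ∞ C]
    (f : C → P) (hf : IsImmersion 𝓘(ℝ, F) 𝓘(ℝ, E) ∞ f) :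
    (IsLieSubalgebroid F sharp f (charConormal F sharp f) ↔ IsPrePoisson F sharp f) ∧
    ∀ {G : Type*} [NormedAddCommGroup G] [NormedSpace ℝ G]
      {Q : Type*} [TopologicalSpace Q] [ChartedSpace G Q] [IsManifold 𝓘(ℝ, G) ∞ Q]
      (j : Q → P) (_ : IsImmersion 𝓘(ℝ, G) 𝓘(ℝ, E) ∞ j)
      (g : C → Q) (_ : Continuous g) (_ : ∀ c, j (g c) = f c),
      IsCosymplectic G sharp j → IsCoisotropic F (inducedSharp (F := G) sharp j) g →
      ∃ (L : LieAlgebroid F f (charConormal F sharp f)) (L' : LieAlgebroid F g (conormal F g)),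
        L.IsInduced sharp ∧ L'.IsInduced (inducedSharp (F := G) sharp j) ∧
        Nonempty (LieAlgebroid.Iso L L') := by
  refine ⟨isLieSubalgebroid_charConormal_iff hf hP, ?_⟩
  intro G _ _ Q _ _ _ j hj g hg hjg hcos hcoi
  obtain rfl : (fun c => j (g c)) = f := funext hjg
  have hg_smooth : ContMDiff 𝓘(ℝ, F) 𝓘(ℝ, G) ∞ g :=
    (ContMDiff.iff_comp_isImmersion hj).2 ⟨hg, hf.contMDiff⟩
  exact ⟨_, _, isInduced_charAlgebroid hf hP, isInduced_transport hP hj hcos hg_smooth hcoi hf,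
    ⟨SubbundleEquiv.transportIso _ _⟩⟩

end

theorem mainTheorem6
    {E : Type*} [NormedAddCommGroup E] [NormedSpace ℝ E] [FiniteDimensional ℝ E]
    {P : Type*} [TopologicalSpace P] [T2Space P] [SecondCountableTopology P]
    [ChartedSpace E P] [IsManifold 𝓘(ℝ, E) ∞ P]
    (sharp : ∀ x : P, Cot E x →L[ℝ] Tan E x) (hP : IsPoisson sharp)
    {F : Type*} [NormedAddCommGroup F] [NormedSpace ℝ F] [FiniteDimensional ℝ F]
    {C : Type*} [TopologicalSpace C] [ChartedSpace F C] [IsManifold 𝓘(ℝ, F) ∞ C]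
    (f : C → P) (hf : IsSmoothEmbedding 𝓘(ℝ, F) 𝓘(ℝ, E) ∞ f) :
    (IsLieSubalgebroid F sharp f (charConormal F sharp f) ↔ IsPrePoisson F sharp f) ∧
    (IsPrePoisson F sharp f →
      ∀ {G : Type*} [NormedAddCommGroup G] [NormedSpace ℝ G] [FiniteDimensional ℝ G]
        {Q : Type*} [TopologicalSpace Q] [ChartedSpace G Q] [IsManifold 𝓘(ℝ, G) ∞ Q]
        (j : Q → P) (_ : IsSmoothEmbedding 𝓘(ℝ, G) 𝓘(ℝ, E) ∞ j)
        (g : C → Q) (_ : ∀ c, j (g c) = f c),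
        IsCosymplectic G sharp j → IsCoisotropic F (inducedSharp (F := G) sharp j) g →
        ∃ (L : LieAlgebroid F f (charConormal F sharp f)) (L' : LieAlgebroid F g (conormal F g)),
          L.IsInduced sharp ∧ L'.IsInduced (inducedSharp (F := G) sharp j) ∧
          Nonempty (LieAlgebroid.Iso L L')) := by
  obtain ⟨hiff, hiso⟩ := mainTheorem6_general sharp hP f hf.isImmersion
  refine ⟨hiff, fun _ G _ _ _ Q _ _ _ j hj g hjg => hiso j hj.isImmersion g ?_ hjg⟩
  have hjg' : j ∘ g = f := funext hjg
  exact hj.isEmbedding.continuous_iff.2 (hjg' ▸ hf.contMDiff.continuous)
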